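/- **Definition.** A (real) generalized polynomial $h$ is given by finitely many real numbers $0<L_0<\dots<L_d<\infty$ and real coefficients $\alpha_0,\dots,\alpha_d$ with $\alpha_d\neq 0$, through $$h(k)=\sum_{j=0}^d \alpha_j\,\frac{L_j(L_j+1)\cdots(L_j+k-1)}{k!},\qquad k=0,1,2,\dots$$ (the quotient is $1$ for $k=0$). Its degree is $\deg(h)=L_d-1$ and its leading coefficient is $\alpha_d$. **Theorem (Gaussian case).** Let $h$ be a fixed generalized polynomial. For $n\ge 1$ and real $c_0,\dots,c_n$ let $P_n(z)=\sum_{i=0}^n c_i\xi_i z^i$, where $\xi_0,\dots,\xi_n$ are independent standard Gaussian random variables, and let $N_{P_n}(\mathbb R)$ be the number of real zeros of $P_n$, counted with multiplicity (and $0$ if $P_n$ vanishes identically). (i) Suppose that $h$ has positive leading coefficient, and let $N_0\ge 0$ be an integer and $C_1>0$, $r>0$ be real numbers. Then there is a constant $K$, depending only on $h$, $N_0$, $C_1$ and $r$, such that for all $n\ge1$, all $m,M>0$ with $M/m=r$ and all real $c_0,\dots,c_n$ satisfying $$m\,h(k)\le c_k^2\le M\,h(k)\quad (N_0\le k\le n),\qquad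 c_k^2\le C_1M\quad (0\le k<N_0,\ k\le n),$$ the variable $N_{P_n}(\mathbb R)$ is integrable and $$\frac{m^2}{M^2}\Big[\frac{1+\sqrt{\deg(h)+1}}{\pi}\log n-K\Big]\le \mathbb E N_{P_n}(\mathbb R)\le \frac{M^2}{m^2}\Big[\frac{1+\sqrt{\deg(h)+1}}{\pi}\log n+K\Big].$$ (ii) In particular, there is a constant $K$ depending only on $h$ such that, whenever $n\ge1$ and $c_k^2=h(k)$ for $k=0,\dots,n$, the variable $N_{P_n}(\mathbb R)$ is integrable and $$\Big|\mathbb E N_{P_n}(\mathbb R)-\frac{1+\sqrt{\deg(h)+1}}{\pi}\log n\Big|\le K .$$ -/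

import Mathlib

open MeasureTheory ProbabilityTheory

universe u

/-- A (real) generalized polynomial: exponents `0 < L_0 < ... < L_d` and real coefficients
`α_0, ..., α_d` with `α_d ≠ 0`, representing the function
`h(k) = ∑ j, α_j * L_j (L_j + 1) ... (L_j + k - 1) / k!` on the natural numbers. -/
structure GenPoly where
  d : ℕ
  L : Fin (d + 1) → ℝ
  α : Fin (d + 1) → ℝ
  L_pos : ∀ j, 0 < L j
  L_strictMono : StrictMono L
  α_last_ne_zero : α (Fin.last d) ≠ 0

/-- The value `h(k)`; the product is empty, hence equal to `1`, for `k = 0`. -/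
noncomputable def GenPoly.eval (h : GenPoly) (k : ℕ) : ℝ :=
  ∑ j, h.α j * ((∏ i ∈ Finset.range k, (h.L j + (i : ℝ))) / (k.factorial : ℝ))

/-- The leading coefficient `α_d`. -/
def GenPoly.leadingCoeff (h : GenPoly) : ℝ := h.α (Fin.last h.d)

/-- The (possibly fractional) degree `L_d - 1`. -/
noncomputable def GenPoly.degree (h : GenPoly) : ℝ := h.L (Fin.last h.d) - 1

/-- The polynomial `∑_{i ≤ n} c_i x_i z^i` with real coefficients. -/
noncomputable def weightedPoly (n : ℕ) (c x : Fin (n + 1) → ℝ) : Polynomial ℝ :=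
  ∑ i : Fin (n + 1), Polynomial.C (c i * x i) * Polynomial.X ^ (i : ℕ)

/-- The number of real zeros of a real polynomial, counted with multiplicity;
by convention the zero polynomial has no (finite) zeros. -/
noncomputable def numRealZeros (P : Polynomial ℝ) : ℕ := Multiset.card P.roots

/-! The expected number of zeros is computed exactly by a Kac–Rice formula and the resulting
integral is then estimated.

Positive zeros are written as `z = exp s`. Fix an index `j` with `c j ≠ 0`. The equation `P(exp s) =
0` says that `ξ_j` equals a smooth function `g(s)` that is linear in the other variables, so
conditionally on these the zeros are the preimages of a Gaussian level. The area formula turns their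
expected number into the integral of the density at `g(s)` times `|g'(s)|`, and Fubini leaves a
Gaussian expectation for each `s`. Its value is `1/π` times the standard deviation of the
distribution on `{0, ..., n}` with weights proportional to `c_k ^ 2 * x ^ k`, `x = exp (2 s)`.
Negative zeros contribute the same amount, and the zero at the origin has almost surely a fixed
multiplicity (`kacRice`).

The logarithms come from the two sides of the unit circle. Write `L = deg(h) + 1`. For `x = exp
(-t)` with `A / n ≤ t ≤ δ` the tilted weights behave like a negative binomial law of exponent `L`,
with standard deviation about `√L / t`. For `x = exp t` the reversed weights are almost constant,
the law is nearly geometric and the standard deviation is about `1 / t`. Integration gives `(√L + 1)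
log n` with bounded error. The range `t < A / n` costs at most `A` on each side, since the standard
deviation is at most `n`. For `t > δ` there is exponential decay, up to the effect of finitely many
uncontrolled low coefficients. That effect is bounded by Kac–Rice read backwards: a polynomial of
degree `k₀` has at most `k₀` zeros, so the integral of its standard deviation is at most `π k₀`
(`integral_tiltStd_exp_le`).

Coefficients only comparable with `h` are handled by writing the variance as a double sum of
nonnegative terms, which is monotone in the weights (`tiltSpread_mono`). Replacing them by the
values of `h` costs one factor `M / m`. -/

/-! ### One-dimensional Sard theorem and area formula -/

/-- Sard's theorem on the line: the derivative, as a linear map of `ℝ`, has zero determinant at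
critical points. -/
theorem measure_image_critical_eq_zero {g g' : ℝ → ℝ} (hg : ∀ s, HasDerivAt g (g' s) s) :
    volume (g '' {s | g' s = 0}) = 0 := by
  refine addHaar_image_eq_zero_of_det_fderivWithin_eq_zero volume (f := g)
    (f' := fun s => ContinuousLinearMap.toSpanSingleton ℝ (g' s))
    (fun x _ => ((hg x).hasFDerivAt).hasFDerivWithinAt) ?_
  intro x hx
  simpa using hx

theorem ae_regular_value {g g' : ℝ → ℝ} (hg : ∀ s, HasDerivAt g (g' s) s) :
    ∀ᵐ y, ∀ s, g s = y → g' s ≠ 0 := by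
  have h := measure_image_critical_eq_zero hg
  refine measure_mono_null ?_ h
  intro y hy
  simp only [Set.mem_compl_iff, Set.mem_ofPred_eq, not_forall, not_not] at hy
  obtain ⟨s, h1, h2⟩ := hy
  exact ⟨s, h2, h1⟩

/-- Rational intervals on which `g` is injective cover the regular set. -/
theorem exists_injOn_rat_Ioo {g g' : ℝ → ℝ} (hg : ∀ s, HasDerivAt g (g' s) s)
    (hc : Continuous g') {s : ℝ} (hs : g' s ≠ 0) :
    ∃ p : ℚ × ℚ, s ∈ Set.Ioo (p.1 : ℝ) p.2 ∧ Set.InjOn g (Set.Ioo (p.1 : ℝ) p.2) := by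
  have hopen : IsOpen {t | g' t ≠ 0} := isOpen_ne_fun hc continuous_const
  obtain ⟨ε, hε, hball⟩ := Metric.isOpen_iff.1 hopen s hs
  obtain ⟨a, ha1, ha2⟩ := exists_rat_btwn (show s - ε < s by linarith)
  obtain ⟨b, hb1, hb2⟩ := exists_rat_btwn (show s < s + ε by linarith)
  refine ⟨(a, b), ⟨ha2, hb1⟩, ?_⟩
  have hne : ∀ x ∈ Set.Ioo (a : ℝ) b, g' x ≠ 0 := by
    intro x hx
    apply hball
    rw [Real.ball_eq_Ioo]
    exact ⟨by linarith [hx.1], by linarith [hx.2]⟩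
  intro x hx y hy hxy
  by_contra hne'
  wlog hlt : x < y generalizing x y
  · exact this hy hx hxy.symm (Ne.symm hne') (lt_of_le_of_ne (not_lt.1 hlt) (Ne.symm hne'))
  obtain ⟨z, hz, hz0⟩ := exists_hasDerivAt_eq_zero hlt
    (fun t _ => (hg t).continuousAt.continuousWithinAt) hxy (fun t _ => hg t)
  exact hne z ⟨lt_trans hx.1 hz.1, lt_trans hz.2 hy.2⟩ hz0

/-- The area formula for a continuously differentiable function of one variable. -/
theorem lintegral_mul_count_preimage {g g' : ℝ → ℝ} (hg : ∀ s, HasDerivAt g (g' s) s)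
    (hc : Continuous g') {f : ℝ → ENNReal} (hf : Measurable f) :
    ∫⁻ y, f y * Measure.count {s | g s = y} =
      ∫⁻ s, f (g s) * ENNReal.ofReal |g' s| := by
  classical
  have hgc : Continuous g := continuous_iff_continuousAt.2 fun s => (hg s).continuousAt
  obtain ⟨e, he⟩ : ∃ e : ℕ → ℚ × ℚ, Function.Surjective e := exists_surjective_nat _
  -- The pairs of rationals are enumerated, and pairs whose interval is not an interval of
  -- injectivity are replaced by the empty set. Disjointing the sequence cuts the regular points
  -- into countably many measurable pieces on which `g` is injective.
  let J : ℕ → Set ℝ := fun k =>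
    if Set.InjOn g (Set.Ioo ((e k).1 : ℝ) (e k).2) then Set.Ioo ((e k).1 : ℝ) (e k).2 else ∅
  have hJm : ∀ k, MeasurableSet (J k) := by
    intro k; dsimp only [J]; split_ifs
    · exact measurableSet_Ioo
    · exact MeasurableSet.empty
  have hJi : ∀ k, Set.InjOn g (J k) := by
    intro k; dsimp only [J]; split_ifs with h
    · exact h
    · exact Set.injOn_empty g
  have hR : MeasurableSet {s | g' s ≠ 0} := (isOpen_ne_fun hc continuous_const).measurableSet
  let S : ℕ → Set ℝ := fun k => disjointed J k ∩ {s | g' s ≠ 0}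
  have hSm : ∀ k, MeasurableSet (S k) := fun k => (MeasurableSet.disjointed hJm k).inter hR
  have hSi : ∀ k, Set.InjOn g (S k) := fun k =>
    (hJi k).mono (Set.inter_subset_left.trans (disjointed_subset J k))
  have hSd : Pairwise (Function.onFun Disjoint S) := fun i j hij =>
    (disjoint_disjointed J hij).mono Set.inter_subset_left Set.inter_subset_left
  have hSU : ⋃ k, S k = {s | g' s ≠ 0} := by
    have h1 : ⋃ k, S k = (⋃ k, disjointed J k) ∩ {s | g' s ≠ 0} := by
      rw [Set.iUnion_inter]
    rw [h1, iUnion_disjointed]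
    apply Set.inter_eq_right.2
    intro s hs
    obtain ⟨p, hp1, hp2⟩ := exists_injOn_rat_Ioo hg hc hs
    obtain ⟨k, rfl⟩ := he p
    refine Set.mem_iUnion.2 ⟨k, ?_⟩
    dsimp only [J]
    rw [if_pos hp2]; exact hp1
  have himg : ∀ k, MeasurableSet (g '' S k) := fun k =>
    (hSm k).image_of_continuousOn_injOn hgc.continuousOn (hSi k)
  have hcount : ∀ᵐ y, f y * Measure.count {s | g s = y} =
      ∑' k, (g '' S k).indicator f y := by
    -- For a regular value `y` the whole fibre lies in the pieces, and each piece contains at most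
    -- one of its points.
    filter_upwards [ae_regular_value hg] with y hy
    have h1 : {s | g s = y} = ⋃ k, (S k ∩ {s | g s = y}) := by
      rw [← Set.iUnion_inter, hSU]
      ext s; simp only [Set.mem_ofPred_eq, Set.mem_inter_iff]
      exact ⟨fun h => ⟨hy s h, h⟩, fun h => h.2⟩
    have hm : MeasurableSet {s | g s = y} := (isClosed_eq hgc continuous_const).measurableSet
    rw [h1, measure_iUnion (fun i j hij => (hSd hij).mono Set.inter_subset_left
      Set.inter_subset_left) (fun k => (hSm k).inter hm), ← ENNReal.tsum_mul_left]
    congr 1; ext k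
    by_cases hk : y ∈ g '' S k
    · obtain ⟨s, hs, rfl⟩ := hk
      rw [Set.indicator_of_mem (Set.mem_image_of_mem g hs)]
      have : S k ∩ {t | g t = g s} = {s} := by
        ext t; simp only [Set.mem_inter_iff, Set.mem_ofPred_eq, Set.mem_singleton_iff]
        exact ⟨fun h => hSi k h.1 hs h.2, fun h => by rw [h]; exact ⟨hs, rfl⟩⟩
      rw [this, Measure.count_singleton, mul_one]
    · rw [Set.indicator_of_notMem hk]
      have : S k ∩ {t | g t = y} = ∅ := by
        ext t; simp only [Set.mem_inter_iff, Set.mem_ofPred_eq, Set.mem_empty_iff_false, iff_false]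
        exact fun h => hk ⟨t, h.1, h.2⟩
      rw [this]; simp
  rw [lintegral_congr_ae hcount, lintegral_tsum (fun k => (hf.indicator (himg k)).aemeasurable)]
  have h2 : ∀ k, ∫⁻ y, (g '' S k).indicator f y =
      ∫⁻ s in S k, f (g s) * ENNReal.ofReal |g' s| := by
    intro k
    rw [lintegral_indicator (himg k), lintegral_image_eq_lintegral_abs_deriv_mul (hSm k)
      (fun x _ => (hg x).hasDerivWithinAt) (hSi k)]
    simp_rw [mul_comm]
  simp_rw [h2]
  rw [← lintegral_iUnion hSm hSd, hSU, ← lintegral_indicator hR]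
  congr 1; ext s
  by_cases hs : g' s = 0
  · simp [hs]
  · rw [Set.indicator_of_mem]; exact hs

/-! ### Measurability of the number of zeros -/

theorem measurableSet_of_isSigmaCompact {X : Type*} [TopologicalSpace X] [T2Space X]
    [MeasurableSpace X] [BorelSpace X] {s : Set X} (hs : IsSigmaCompact s) : MeasurableSet s := by
  obtain ⟨K, hK, rfl⟩ := hs
  exact MeasurableSet.iUnion fun n => (hK n).isClosed.measurableSet

/-- A closed subset of a σ-compact space is σ-compact, and so is its projection. This avoids
analytic sets. -/
theorem measurableSet_image_fst {X Y : Type*} [TopologicalSpace X] [T2Space X]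
    [MeasurableSpace X] [BorelSpace X] [TopologicalSpace Y] [SigmaCompactSpace X]
    [SigmaCompactSpace Y] {s : Set (X × Y)} (hs : IsClosed s) :
    MeasurableSet (Prod.fst '' s) :=
  measurableSet_of_isSigmaCompact
    ((isSigmaCompact_univ.of_isClosed_subset hs (Set.subset_univ s)).image continuous_fst)

theorem le_count_iff {Y : Type*} [MeasurableSpace Y] [MeasurableSingletonClass Y] {s : Set Y}
    {m : ℕ} : (m : ENNReal) ≤ Measure.count s ↔
      ∃ x : Fin m → Y, Function.Injective x ∧ ∀ i, x i ∈ s := by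
  constructor
  · intro h
    have : ∃ t : Finset Y, (t : Set Y) ⊆ s ∧ t.card = m := by
      by_cases hs : s.Finite
      · rw [Measure.count_apply_finite s hs, Nat.cast_le] at h
        obtain ⟨t, ht, htm⟩ := Finset.exists_subset_card_eq h
        exact ⟨t, fun x hx => hs.mem_toFinset.1 (ht hx), htm⟩
      · exact Set.Infinite.exists_subset_card_eq hs m
    obtain ⟨t, ht, rfl⟩ := this
    exact ⟨fun i => (t.equivFin.symm i : Y),
      Subtype.val_injective.comp t.equivFin.symm.injective, fun i => ht (t.equivFin.symm i).2⟩
  · rintro ⟨x, hx, hs⟩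
    classical
    have h1 : ((Finset.univ.image x : Finset Y) : Set Y) ⊆ s := by
      intro y hy
      simp only [Finset.coe_image, Finset.coe_univ, Set.image_univ, Set.mem_range] at hy
      obtain ⟨i, rfl⟩ := hy
      exact hs i
    calc (m : ENNReal) = ((Finset.univ.image x).card : ENNReal) := by
          rw [Finset.card_image_of_injective _ hx]; simp
      _ = Measure.count ((Finset.univ.image x : Finset Y) : Set Y) := by
          rw [Measure.count_apply_finset]
      _ ≤ _ := measure_mono h1

/-- Having at least `m` zeros means having an `m`-tuple of zeros with mutual distances at least `1 /
(k + 1)` for some `k`. For fixed `k` such tuples form a closed set, whose projection is measurable;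
without the quantitative separation the set would not be closed. -/
theorem measurable_count_zeros {X : Type*} [TopologicalSpace X] [T2Space X]
    [MeasurableSpace X] [BorelSpace X] [SigmaCompactSpace X] {F : X → ℝ → ℝ}
    (hF : Continuous (Function.uncurry F)) :
    Measurable fun ξ => (Measure.count {s : ℝ | F ξ s = 0}) := by
  have key : ∀ m : ℕ, MeasurableSet {ξ | (m : ENNReal) ≤ Measure.count {s : ℝ | F ξ s = 0}} := by
    intro m
    have h : {ξ | (m : ENNReal) ≤ Measure.count {s : ℝ | F ξ s = 0}} =
        ⋃ k : ℕ, Prod.fst '' {p : X × (Fin m → ℝ) | (∀ i, F p.1 (p.2 i) = 0) ∧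
          ∀ i j, i ≠ j → 1 / ((k : ℝ) + 1) ≤ |p.2 i - p.2 j|} := by
      ext ξ
      simp only [Set.mem_ofPred_eq, Set.mem_iUnion, Set.mem_image, Prod.exists, exists_and_right,
        exists_eq_right]
      rw [le_count_iff]
      constructor
      · rintro ⟨x, hx, hs⟩
        have h0 : ∀ p : Fin m × Fin m, ∃ k : ℕ, p.1 ≠ p.2 → 1 / ((k : ℝ) + 1) ≤ |x p.1 - x p.2| := by
          intro p
          by_cases hp : p.1 = p.2
          · exact ⟨0, fun h => absurd hp h⟩
          · obtain ⟨k, hk⟩ := exists_nat_one_div_lt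
              (abs_pos.2 (sub_ne_zero.2 (fun h => hp (hx h))) : 0 < |x p.1 - x p.2|)
            exact ⟨k, fun _ => hk.le⟩
        choose K hK using h0
        refine ⟨Finset.univ.sup K, x, hs, fun i j hij => le_trans ?_ (hK (i, j) hij)⟩
        apply one_div_le_one_div_of_le (by positivity)
        have : K (i, j) ≤ Finset.univ.sup K := Finset.le_sup (Finset.mem_univ _)
        have : (K (i, j) : ℝ) ≤ (Finset.univ.sup K : ℕ) := by exact_mod_cast this
        linarith
      · rintro ⟨k, x, hs, hsep⟩
        refine ⟨x, fun i j hij => ?_, hs⟩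
        by_contra hne
        have := hsep i j hne
        rw [hij, sub_self, abs_zero] at this
        have h2 : 0 < 1 / ((k : ℝ) + 1) := by positivity
        linarith
    rw [h]
    refine MeasurableSet.iUnion fun k => measurableSet_image_fst ?_
    rw [Set.ofPred_and, Set.ofPred_forall, Set.ofPred_forall]
    refine IsClosed.inter (isClosed_iInter fun i => ?_) (isClosed_iInter fun i => ?_)
    · exact isClosed_eq (hF.comp (continuous_fst.prodMk ((continuous_apply i).comp continuous_snd)))
        continuous_const
    · rw [Set.ofPred_forall]
      refine isClosed_iInter fun j => ?_
      by_cases hij : i = j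
      · simp [hij]
      · simp only [ne_eq, hij, not_false_eq_true, forall_const]
        exact isClosed_le continuous_const (by fun_prop)
  refine measurable_of_Ioi fun a => ?_
  have h : (fun ξ => (Measure.count {s : ℝ | F ξ s = 0})) ⁻¹' Set.Ioi a =
      ⋃ m : ℕ, {ξ | a < m ∧ (m : ENNReal) ≤ Measure.count {s : ℝ | F ξ s = 0}} := by
    ext ξ
    simp only [Set.mem_preimage, Set.mem_Ioi, Set.mem_iUnion, Set.mem_ofPred_eq]
    constructor
    · intro h
      by_cases hs : {s : ℝ | F ξ s = 0}.Finite
      · rw [Measure.count_apply_finite _ hs] at h ⊢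
        exact ⟨_, h, le_rfl⟩
      · have htop := Measure.count_apply_infinite hs
        rw [htop] at h ⊢
        obtain ⟨m, hm⟩ := ENNReal.exists_nat_gt h.ne
        exact ⟨m, hm, le_top⟩
    · rintro ⟨m, h1, h2⟩
      exact lt_of_lt_of_le h1 h2
  rw [h]
  refine MeasurableSet.iUnion fun m => ?_
  by_cases hm : a < m
  · simpa [hm] using key m
  · simp [hm]

/-! ### Gaussian integrals -/

theorem integral_abs_gaussianReal_one : ∫ x, |x| ∂(gaussianReal 0 1) = √(2 / Real.pi) := by
  rw [integral_gaussianReal_eq_integral_smul (by norm_num)]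
  have h1 : ∀ x : ℝ, gaussianPDFReal 0 1 x • |x| =
      (fun y : ℝ => (√(2 * Real.pi))⁻¹ * (y ^ (1:ℝ) * Real.exp (-(1/2) * y ^ (2:ℝ)))) |x| := by
    intro x
    have h2 : |x| ^ (2:ℝ) = x ^ 2 := by
      rw [show (2:ℝ) = ((2:ℕ):ℝ) by norm_num, Real.rpow_natCast, sq_abs]
    simp only [gaussianPDFReal, smul_eq_mul, Real.rpow_one, h2]
    simp
    ring_nf
  rw [integral_congr_ae (ae_of_all _ h1)]
  have h3 := integral_comp_abs (f := fun y : ℝ =>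
    (√(2 * Real.pi))⁻¹ * (y ^ (1:ℝ) * Real.exp (-(1/2) * y ^ (2:ℝ))))
  refine h3.trans ?_
  rw [integral_const_mul,
    integral_rpow_mul_exp_neg_mul_rpow (by norm_num) (by norm_num) (by norm_num)]
  norm_num
  have hpi := Real.pi_pos
  field_simp
  rw [Real.sq_sqrt (by norm_num)]

theorem lintegral_abs_gaussianReal (v : NNReal) :
    ∫⁻ x, ENNReal.ofReal |x| ∂(gaussianReal 0 v) = ENNReal.ofReal √(2 * v / Real.pi) := by
  have h : gaussianReal 0 v = (gaussianReal 0 1).map (fun x => √(v : ℝ) * x) := by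
    rw [gaussianReal_map_const_mul]
    congr 1
    · simp
    · ext; simp
  have hint : Integrable (fun x : ℝ => |x|) (gaussianReal 0 1) :=
    ((memLp_id_gaussianReal 1).integrable (by norm_num)).abs
  rw [h, lintegral_map (by fun_prop) (by fun_prop)]
  simp_rw [abs_mul, ENNReal.ofReal_mul (abs_nonneg _)]
  rw [lintegral_const_mul _ (by fun_prop), ← ofReal_integral_eq_lintegral_ofReal hint
    (ae_of_all _ fun x => abs_nonneg x), integral_abs_gaussianReal_one,
    ← ENNReal.ofReal_mul (abs_nonneg _), abs_of_nonneg (Real.sqrt_nonneg _),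
    ← Real.sqrt_mul (by positivity)]
  congr 2; ring

/-- The product of two centred Gaussian densities, of variances `1` and `A`, is a multiple of the
one of variance `A / (1 + A)`. The case `A = 0` is a Dirac mass and is treated apart. -/
theorem lintegral_gaussianPDF_mul (A : NNReal) {H : ℝ → ENNReal} (hH : Measurable H) :
    ∫⁻ x, gaussianPDF 0 1 x * H x ∂(gaussianReal 0 A) =
      ENNReal.ofReal (1 / √(2 * Real.pi * (1 + A))) * ∫⁻ x, H x ∂(gaussianReal 0 (A / (1 + A))) := by
  have hpi := Real.pi_pos
  by_cases hA : A = 0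
  · subst hA
    simp only [zero_div, gaussianReal_zero_var]
    rw [lintegral_dirac, lintegral_dirac]
    congr 1
    simp [gaussianPDF, gaussianPDFReal]
  have hA' : A / (1 + A) ≠ 0 := div_ne_zero hA (by positivity)
  rw [gaussianReal_of_var_ne_zero _ hA, gaussianReal_of_var_ne_zero _ hA',
    lintegral_withDensity_eq_lintegral_mul _ (measurable_gaussianPDF _ _)
      (g := fun x => gaussianPDF 0 1 x * H x) ((measurable_gaussianPDF _ _).mul hH),
    lintegral_withDensity_eq_lintegral_mul _ (measurable_gaussianPDF _ _) hH,
    ← lintegral_const_mul _ ((measurable_gaussianPDF _ _).mul hH)]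
  congr 1; ext x
  simp only [Pi.mul_apply]
  rw [← mul_assoc, ← mul_assoc]
  congr 1
  simp only [gaussianPDF]
  rw [← ENNReal.ofReal_mul (gaussianPDFReal_nonneg _ _ _), ← ENNReal.ofReal_mul (by positivity)]
  congr 1
  have hA0 : (0 : ℝ) < A := lt_of_le_of_ne A.2 (fun h => hA (by ext; exact h.symm))
  simp only [gaussianPDFReal, NNReal.coe_div, NNReal.coe_add, NNReal.coe_one]
  have e1 : √(2 * Real.pi * (A / (1 + A))) = √(2 * Real.pi * A) / √(1 + A) := by
    rw [← mul_div_assoc, Real.sqrt_div (by positivity)]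
  have e2 : √(2 * Real.pi * (1 + A)) = √(2 * Real.pi) * √(1 + A) := Real.sqrt_mul (by positivity) _
  rw [e1, e2]
  have e3 : Real.exp (-(x - 0) ^ 2 / (2 * ((A : ℝ) / (1 + A)))) =
      Real.exp (-(x - 0) ^ 2 / (2 * A)) * Real.exp (-(x - 0) ^ 2 / (2 * 1)) := by
    rw [← Real.exp_add]; congr 1; field_simp; ring
  rw [e3]
  have : √(1 + (A : ℝ)) ≠ 0 := by positivity
  have : √(2 * Real.pi) ≠ 0 := by positivity
  have : √(2 * Real.pi * A) ≠ 0 := by positivity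
  field_simp

section LinearFunctionals

variable {ι : Type*} [Fintype ι]

theorem hasLaw_eval_pi_gaussian (i : ι) :
    HasLaw (fun η : ι → ℝ => η i) (gaussianReal 0 1) (Measure.pi fun _ => gaussianReal 0 1) :=
  (measurePreserving_eval (fun _ : ι => gaussianReal 0 1) i).hasLaw

theorem iIndepFun_eval_pi_gaussian :
    iIndepFun (fun (i : ι) (η : ι → ℝ) => η i) (Measure.pi fun _ => gaussianReal 0 1) :=
  (iIndepFun_iff_hasLaw_pi_pi hasLaw_eval_pi_gaussian).2 HasLaw.id

theorem hasGaussianLaw_pi_gaussian :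
    HasGaussianLaw (fun (η : ι → ℝ) i => η i) (Measure.pi fun _ => gaussianReal 0 1) :=
  iIndepFun_eval_pi_gaussian.hasGaussianLaw fun i => (hasLaw_eval_pi_gaussian i).hasGaussianLaw

theorem covariance_linear_pi_gaussian (a b : ι → ℝ) :
    cov[fun η : ι → ℝ => ∑ i, a i * η i, fun η => ∑ i, b i * η i;
      Measure.pi fun _ => gaussianReal 0 1] = ∑ i, a i * b i := by
  classical
  have hm : ∀ i : ι, MemLp (fun η : ι → ℝ => η i) 2 (Measure.pi fun _ => gaussianReal 0 1) :=
    fun i => (hasLaw_eval_pi_gaussian i).hasGaussianLaw.memLp_two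
  rw [covariance_fun_sum_fun_sum (fun i => (hm i).const_mul _) (fun i => (hm i).const_mul _)]
  have hc : ∀ i j : ι, cov[fun η : ι → ℝ => η i, fun η => η j;
      Measure.pi fun _ => gaussianReal 0 1] = if i = j then 1 else 0 := by
    intro i j
    split_ifs with h
    · subst h
      rw [covariance_self (hm i).aemeasurable, (hasLaw_eval_pi_gaussian i).variance_eq,
        variance_id_gaussianReal]
      rfl
    · exact (iIndepFun_eval_pi_gaussian.indepFun h).covariance_eq_zero (hm i) (hm j)
  simp_rw [covariance_const_mul_left, covariance_const_mul_right, hc]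
  simp

theorem hasGaussianLaw_linear_pair (a b : ι → ℝ) :
    HasGaussianLaw (fun η : ι → ℝ => (∑ i, a i * η i, ∑ i, b i * η i))
      (Measure.pi fun _ => gaussianReal 0 1) := by
  let L : (ι → ℝ) → ((ι → ℝ) →L[ℝ] ℝ) := fun a => ∑ i, a i • ContinuousLinearMap.proj i
  have h := (hasGaussianLaw_pi_gaussian (ι := ι)).map_fun ((L a).prod (L b))
  simpa [L, sum_apply] using h

theorem hasLaw_linear_pi_gaussian (a : ι → ℝ) :
    HasLaw (fun η : ι → ℝ => ∑ i, a i * η i) (gaussianReal 0 (∑ i, a i ^ 2).toNNReal)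
      (Measure.pi fun _ => gaussianReal 0 1) := by
  have hG := (hasGaussianLaw_linear_pair a a).fst
  have hint : ∀ i : ι, Integrable (fun η : ι → ℝ => η i) (Measure.pi fun _ => gaussianReal 0 1) :=
    fun i => (hasLaw_eval_pi_gaussian i).hasGaussianLaw.integrable
  have h0 : ∀ i : ι, ∫ η : ι → ℝ, η i ∂(Measure.pi fun _ => gaussianReal 0 1) = 0 := by
    intro i
    rw [(hasLaw_eval_pi_gaussian i).integral_eq, integral_id_gaussianReal]
  refine ⟨hG.aemeasurable, ?_⟩
  rw [hG.map_eq_gaussianReal]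
  congr 1
  · rw [integral_finsetSum _ fun i _ => (hint i).const_mul _]
    simp_rw [integral_const_mul, h0]
    simp
  · rw [← covariance_self hG.aemeasurable, covariance_linear_pi_gaussian]
    simp_rw [pow_two]

/-- With `X = ∑ a_i η_i` and `Y = ∑ b_i η_i`, regress `Y = β X + Z` with `Z` uncorrelated with `X`,
hence independent of it. The density factor only changes the variance of `X` to `A / (1 + A)`, so `β
X + Z` remains a centred Gaussian and its mean absolute value is known. -/
theorem lintegral_gaussianPDF_mul_abs_linear (a b : ι → ℝ) :
    ∫⁻ η : ι → ℝ, gaussianPDF 0 1 (∑ i, a i * η i) * ENNReal.ofReal |∑ i, b i * η i|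
        ∂(Measure.pi fun _ => gaussianReal 0 1) =
      ENNReal.ofReal (1 / Real.pi * √((∑ i, b i ^ 2) / (1 + ∑ i, a i ^ 2) -
        ((∑ i, a i * b i) / (1 + ∑ i, a i ^ 2)) ^ 2)) := by
  have hpi := Real.pi_pos
  set A := ∑ i, a i ^ 2 with hA
  set B := ∑ i, b i ^ 2 with hB
  set C := ∑ i, a i * b i with hC
  have hA0 : 0 ≤ A := Finset.sum_nonneg fun i _ => sq_nonneg _
  -- If `A = 0` then all `a i` vanish and `C = 0`, so the default value `C / 0 = 0` is the right
  -- coefficient.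
  set β := C / A with hβ
  have hβA : β * A = C := by
    by_cases h : A = 0
    · have ha : ∀ i, a i = 0 := fun i => by
        have := (Finset.sum_eq_zero_iff_of_nonneg (fun i _ => sq_nonneg (a i))).1 (hA ▸ h) i
          (Finset.mem_univ i)
        exact pow_eq_zero_iff (two_ne_zero) |>.1 this
      rw [h, mul_zero, hC]; simp [ha]
    · rw [hβ]; field_simp
  set z : ι → ℝ := fun i => b i - β * a i with hz
  set V := ∑ i, z i ^ 2 with hV
  have hV0 : 0 ≤ V := Finset.sum_nonneg fun i _ => sq_nonneg _
  have hVe : V = B - β * C := by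
    have : V = B - 2 * β * C + β ^ 2 * A := by
      rw [hV, hB, hC, hA, Finset.mul_sum, Finset.mul_sum, ← Finset.sum_sub_distrib,
        ← Finset.sum_add_distrib]
      exact Finset.sum_congr rfl fun i _ => by simp only [hz]; ring
    rw [this, pow_two, mul_assoc β β A, hβA]; ring
  have hind : IndepFun (fun η : ι → ℝ => ∑ i, a i * η i) (fun η => ∑ i, z i * η i)
      (Measure.pi fun _ => gaussianReal 0 1) := by
    apply (hasGaussianLaw_linear_pair a z).indepFun_of_covariance_eq_zero
    rw [covariance_linear_pi_gaussian]
    have : ∑ i, a i * z i = C - β * A := by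
      rw [hC, hA, Finset.mul_sum, ← Finset.sum_sub_distrib]
      exact Finset.sum_congr rfl fun i _ => by simp only [hz]; ring
    rw [this, hβA, sub_self]
  have hlaw := hind.hasLaw_prod (hasLaw_linear_pi_gaussian a) (hasLaw_linear_pi_gaussian z)
  rw [← hA, ← hV] at hlaw
  have hfun : ∀ η : ι → ℝ, ∑ i, b i * η i = β * (∑ i, a i * η i) + ∑ i, z i * η i := by
    intro η
    rw [Finset.mul_sum, ← Finset.sum_add_distrib]
    exact Finset.sum_congr rfl fun i _ => by simp only [hz]; ring
  simp_rw [hfun]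
  have hmeas : Measurable fun p : ℝ × ℝ => gaussianPDF 0 1 p.1 * ENNReal.ofReal |β * p.1 + p.2| :=
    ((measurable_gaussianPDF 0 1).comp measurable_fst).mul (by fun_prop)
  have hin : Measurable fun p : ℝ × ℝ => ENNReal.ofReal |β * p.1 + p.2| := by fun_prop
  rw [hlaw.lintegral_comp (f := fun p : ℝ × ℝ => gaussianPDF 0 1 p.1 *
    ENNReal.ofReal |β * p.1 + p.2|) hmeas.aemeasurable, lintegral_prod _ hmeas.aemeasurable]
  have h1 : ∀ x : ℝ, ∫⁻ y, gaussianPDF 0 1 x * ENNReal.ofReal |β * x + y|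
      ∂(gaussianReal 0 V.toNNReal) = gaussianPDF 0 1 x *
        ∫⁻ y, ENNReal.ofReal |β * x + y| ∂(gaussianReal 0 V.toNNReal) := fun x =>
    lintegral_const_mul _ (by fun_prop)
  rw [lintegral_congr h1, lintegral_gaussianPDF_mul _ (hin.lintegral_prod_right (ν := gaussianReal 0 V.toNNReal)),
    ← lintegral_prod (f := fun p : ℝ × ℝ => ENNReal.ofReal |β * p.1 + p.2|) hin.aemeasurable]
  set A' := A.toNNReal / (1 + A.toNNReal)
  have hconv : ((gaussianReal 0 A').prod (gaussianReal 0 V.toNNReal)).map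
      (fun p : ℝ × ℝ => β * p.1 + p.2) = gaussianReal 0 (NNReal.mk (β ^ 2) (sq_nonneg _) * A' + V.toNNReal) := by
    have h2 := gaussianReal_conv_gaussianReal (m₁ := 0) (m₂ := 0)
      (v₁ := NNReal.mk (β ^ 2) (sq_nonneg _) * A') (v₂ := V.toNNReal)
    rw [add_zero] at h2
    rw [← h2, Measure.conv]
    have h3 : gaussianReal 0 (NNReal.mk (β ^ 2) (sq_nonneg _) * A') = (gaussianReal 0 A').map (fun x => β * x) := by
      rw [gaussianReal_map_const_mul, mul_zero]
    have h4 : ((gaussianReal 0 A').map (fun x => β * x)).prod (gaussianReal 0 V.toNNReal) =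
        ((gaussianReal 0 A').prod (gaussianReal 0 V.toNNReal)).map (Prod.map (fun x => β * x) id) := by
      rw [← Measure.map_prod_map _ _ (by fun_prop) measurable_id, Measure.map_id]
    rw [h3, h4, Measure.map_map (by fun_prop) (by fun_prop)]
    rfl
  have h5 := lintegral_map (μ := (gaussianReal 0 A').prod (gaussianReal 0 V.toNNReal))
    (f := fun x : ℝ => ENNReal.ofReal |x|) (g := fun p : ℝ × ℝ => β * p.1 + p.2)
    (by fun_prop) (by fun_prop)
  rw [← h5, hconv, lintegral_abs_gaussianReal, ← ENNReal.ofReal_mul (by positivity)]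
  congr 1
  simp only [A', NNReal.coe_add, NNReal.coe_mul, NNReal.coe_mk, NNReal.coe_div, NNReal.coe_one,
    Real.coe_toNNReal _ hA0, Real.coe_toNNReal _ hV0]
  have hA1 : 0 < 1 + A := by linarith
  have e0 : β ^ 2 * (A / (1 + A)) + V = (1 + A) * (B / (1 + A) - (C / (1 + A)) ^ 2) := by
    rw [hVe, ← hβA]; field_simp; ring
  rw [e0]
  set Q := B / (1 + A) - (C / (1 + A)) ^ 2
  have hQ : 0 ≤ (1 + A) * Q := by rw [← e0]; positivity
  have hQ' : 0 ≤ Q := nonneg_of_mul_nonneg_right hQ hA1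
  rw [← Real.sqrt_sq (show 0 ≤ 1 / √(2 * Real.pi * (1 + A)) by positivity),
    ← Real.sqrt_sq (show 0 ≤ 1 / Real.pi by positivity), ← Real.sqrt_mul (by positivity),
    ← Real.sqrt_mul (by positivity)]
  congr 1
  rw [div_pow, Real.sq_sqrt (by positivity)]
  field_simp

end LinearFunctionals

/-! ### Moments and variance of tilted weights -/

/-- The moment `∑_{k ≤ n} k ^ p * w k * x ^ k` of the weights `w` tilted by `x`. -/
noncomputable def tiltMoment (n : ℕ) (w : ℕ → ℝ) (p : ℕ) (x : ℝ) : ℝ :=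
  ∑ k ∈ Finset.range (n + 1), (k : ℝ) ^ p * w k * x ^ k

/-- The double sum `∑_{i, j ≤ n} (i - j) ^ 2 * (w i * x ^ i) * (w j * x ^ j)`. -/
noncomputable def tiltSpread (n : ℕ) (w : ℕ → ℝ) (x : ℝ) : ℝ :=
  ∑ i ∈ Finset.range (n + 1), ∑ j ∈ Finset.range (n + 1),
    ((i : ℝ) - j) ^ 2 * (w i * x ^ i) * (w j * x ^ j)

/-- The standard deviation of the probability distribution on `{0, ..., n}` with weights
proportional to `w k * x ^ k`. -/
noncomputable def tiltStd (n : ℕ) (w : ℕ → ℝ) (x : ℝ) : ℝ :=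
  √(tiltSpread n w x / 2) / tiltMoment n w 0 x

/-- The variance expressed by two independent copies, expanded about an arbitrary centre `a`. The
centres needed later are `0`, the index solved for in Kac–Rice, and the mean of a truncation. -/
theorem sum_sum_sq_sub_mul {ι : Type*} (S : Finset ι) (f u : ι → ℝ) (a : ℝ) :
    ∑ i ∈ S, ∑ j ∈ S, (f i - f j) ^ 2 * u i * u j =
      2 * ((∑ i ∈ S, u i) * (∑ i ∈ S, (f i - a) ^ 2 * u i) - (∑ i ∈ S, (f i - a) * u i) ^ 2) := by
  have h : ∀ i ∈ S, ∑ j ∈ S, (f i - f j) ^ 2 * u i * u j =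
      (f i - a) ^ 2 * u i * (∑ j ∈ S, u j) - 2 * ((f i - a) * u i) * (∑ j ∈ S, (f j - a) * u j)
        + u i * ∑ j ∈ S, (f j - a) ^ 2 * u j := by
    intro i _
    rw [Finset.mul_sum, Finset.mul_sum, Finset.mul_sum, ← Finset.sum_sub_distrib,
      ← Finset.sum_add_distrib]
    exact Finset.sum_congr rfl fun j _ => by ring
  rw [Finset.sum_congr rfl h, Finset.sum_add_distrib, Finset.sum_sub_distrib, ← Finset.sum_mul,
    ← Finset.sum_mul, ← Finset.sum_mul, ← Finset.mul_sum]
  ring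

theorem tiltSpread_eq (n : ℕ) (w : ℕ → ℝ) (x : ℝ) (a : ℝ) :
    tiltSpread n w x = 2 * (tiltMoment n w 0 x *
      (∑ k ∈ Finset.range (n + 1), ((k : ℝ) - a) ^ 2 * (w k * x ^ k)) -
      (∑ k ∈ Finset.range (n + 1), ((k : ℝ) - a) * (w k * x ^ k)) ^ 2) := by
  have h := sum_sum_sq_sub_mul (Finset.range (n + 1)) (fun k : ℕ => (k : ℝ))
    (fun k => w k * x ^ k) a
  simp only [tiltSpread, tiltMoment, pow_zero, one_mul]
  exact h

/-! ### The Kac–Rice formula for exponential sums -/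

/-- Extension by zero of the squares of the coefficients. -/
noncomputable def sqWeight {n : ℕ} (c : Fin (n + 1) → ℝ) (k : ℕ) : ℝ :=
  if h : k < n + 1 then c ⟨k, h⟩ ^ 2 else 0

theorem sqWeight_coe {n : ℕ} (c : Fin (n + 1) → ℝ) (i : Fin (n + 1)) :
    sqWeight c (i : ℕ) = c i ^ 2 := by
  rw [sqWeight, dif_pos i.2]

theorem sqWeight_nonneg {n : ℕ} (c : Fin (n + 1) → ℝ) (k : ℕ) : 0 ≤ sqWeight c k := by
  unfold sqWeight; split_ifs <;> positivity

/-- The random exponential sum `∑ c_i ξ_i e ^ {i s}`. -/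
noncomputable def expSum {n : ℕ} (c ξ : Fin (n + 1) → ℝ) (s : ℝ) : ℝ :=
  ∑ i, c i * ξ i * Real.exp ((i : ℕ) * s)

/-- The derivative `∑ i c_i ξ_i e ^ {i s}` of `expSum c ξ` at `s`. -/
noncomputable def expSumDeriv {n : ℕ} (c ξ : Fin (n + 1) → ℝ) (s : ℝ) : ℝ :=
  ∑ i, c i * ξ i * (((i : ℕ) : ℝ) * Real.exp ((i : ℕ) * s))

theorem continuous_uncurry_expSum {n : ℕ} (c : Fin (n + 1) → ℝ) :
    Continuous (Function.uncurry (expSum c)) := by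
  unfold Function.uncurry expSum; fun_prop

theorem continuous_uncurry_expSumDeriv {n : ℕ} (c : Fin (n + 1) → ℝ) :
    Continuous (Function.uncurry (expSumDeriv c)) := by
  unfold Function.uncurry expSumDeriv; fun_prop

/-- The coefficients expressing the zero condition as `ξ_j = ∑ a_i(s) ξ_i`. -/
noncomputable def solveCoeff {n : ℕ} (c : Fin (n + 1) → ℝ) (j : Fin (n + 1)) (s : ℝ) (i : Fin n) :
    ℝ :=
  -(c (j.succAbove i) / c j) * Real.exp ((((j.succAbove i : Fin (n + 1)) : ℕ) - ((j : ℕ) : ℝ)) * s)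

noncomputable def solveCoeffDeriv {n : ℕ} (c : Fin (n + 1) → ℝ) (j : Fin (n + 1)) (s : ℝ)
    (i : Fin n) : ℝ :=
  (((j.succAbove i : Fin (n + 1)) : ℕ) - ((j : ℕ) : ℝ)) * solveCoeff c j s i

section

variable {n : ℕ} {c : Fin (n + 1) → ℝ} {j : Fin (n + 1)}

theorem expSum_insertNth (hj : c j ≠ 0) (y : ℝ) (η : Fin n → ℝ) (s : ℝ) :
    expSum c (j.insertNth (α := fun _ => ℝ) y η) s =
      c j * Real.exp ((j : ℕ) * s) * (y - ∑ i, solveCoeff c j s i * η i) := by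
  unfold expSum
  rw [Fin.sum_univ_succAbove _ j, mul_sub, Finset.mul_sum, sub_eq_add_neg, ← Finset.sum_neg_distrib]
  congr 1
  · simp; ring
  · refine Finset.sum_congr rfl fun i _ => ?_
    simp only [Fin.insertNth_apply_succAbove, solveCoeff]
    have : Real.exp (((j.succAbove i : Fin (n + 1)) : ℕ) * s) = Real.exp ((j : ℕ) * s) *
        Real.exp ((((j.succAbove i : Fin (n + 1)) : ℕ) - ((j : ℕ) : ℝ)) * s) := by
      rw [← Real.exp_add]; ring_nf
    rw [this]; field_simp

/-- At a zero of the sum the first term vanishes, so a double zero makes `y` a critical value of the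
function solved for. -/
theorem expSumDeriv_insertNth (hj : c j ≠ 0) (y : ℝ) (η : Fin n → ℝ) (s : ℝ) :
    expSumDeriv c (j.insertNth (α := fun _ => ℝ) y η) s =
      (j : ℕ) * expSum c (j.insertNth (α := fun _ => ℝ) y η) s -
      c j * Real.exp ((j : ℕ) * s) * ∑ i, solveCoeffDeriv c j s i * η i := by
  unfold expSum expSumDeriv
  rw [Fin.sum_univ_succAbove _ j, Fin.sum_univ_succAbove _ j, mul_add, Finset.mul_sum,
    Finset.mul_sum, add_sub_assoc, ← Finset.sum_sub_distrib]
  congr 1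
  · simp; ring
  · refine Finset.sum_congr rfl fun i _ => ?_
    simp only [Fin.insertNth_apply_succAbove, solveCoeffDeriv, solveCoeff]
    have : Real.exp (((j.succAbove i : Fin (n + 1)) : ℕ) * s) = Real.exp ((j : ℕ) * s) *
        Real.exp ((((j.succAbove i : Fin (n + 1)) : ℕ) - ((j : ℕ) : ℝ)) * s) := by
      rw [← Real.exp_add]; ring_nf
    rw [this]; field_simp; ring

theorem expSum_insertNth_eq_zero_iff (hj : c j ≠ 0) (y : ℝ) (η : Fin n → ℝ) (s : ℝ) :
    expSum c (j.insertNth (α := fun _ => ℝ) y η) s = 0 ↔ ∑ i, solveCoeff c j s i * η i = y := by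
  rw [expSum_insertNth hj, mul_eq_zero, or_iff_right (mul_ne_zero hj (Real.exp_ne_zero _)),
    sub_eq_zero, eq_comm]

theorem hasDerivAt_solve (η : Fin n → ℝ) (s : ℝ) :
    HasDerivAt (fun s => ∑ i, solveCoeff c j s i * η i) (∑ i, solveCoeffDeriv c j s i * η i) s := by
  refine HasDerivAt.fun_sum fun i _ => ?_
  refine HasDerivAt.mul_const ?_ _
  unfold solveCoeffDeriv solveCoeff
  set d : ℝ := (((j.succAbove i : Fin (n + 1)) : ℕ) - ((j : ℕ) : ℝ))
  have h := (((hasDerivAt_id s).const_mul d).exp).const_mul (-(c (j.succAbove i) / c j))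
  simp only [id, mul_one] at h
  convert h using 1
  ring

theorem lintegral_expSum_split (j : Fin (n + 1)) {D : (Fin (n + 1) → ℝ) → ENNReal}
    (hD : Measurable D) :
    ∫⁻ ξ, D ξ ∂(Measure.pi fun _ => gaussianReal 0 1) =
      ∫⁻ η : Fin n → ℝ, ∫⁻ y, D (j.insertNth (α := fun _ => ℝ) y η) ∂(gaussianReal 0 1)
        ∂(Measure.pi fun _ => gaussianReal 0 1) := by
  have h := (measurePreserving_piFinSuccAbove (fun _ : Fin (n + 1) => gaussianReal 0 1) j).symm
  rw [← h.lintegral_comp hD]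
  exact lintegral_prod_symm _ (hD.comp h.measurable).aemeasurable

/-- Given the other variables, a double zero forces `ξ_j` to be a critical value of a smooth
function, a Lebesgue-null event by Sard and hence Gaussian-null. Fubini finishes, the exceptional
set being measurable as a projection of a closed set. -/
theorem ae_simple_zeros (hj : c j ≠ 0) :
    ∀ᵐ ξ ∂(Measure.pi fun _ => gaussianReal 0 1), ∀ s, expSum c ξ s = 0 → expSumDeriv c ξ s ≠ 0 := by
  set N : Set (Fin (n + 1) → ℝ) := {ξ | ∃ s, expSum c ξ s = 0 ∧ expSumDeriv c ξ s = 0} with hN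
  have hNm : MeasurableSet N := by
    have : N = Prod.fst '' {p : (Fin (n + 1) → ℝ) × ℝ | expSum c p.1 p.2 = 0 ∧
        expSumDeriv c p.1 p.2 = 0} := by
      ext ξ; simp [hN]
    rw [this]
    exact measurableSet_image_fst ((isClosed_eq (continuous_uncurry_expSum c) continuous_const).inter
      (isClosed_eq (continuous_uncurry_expSumDeriv c) continuous_const))
  have h0 : (Measure.pi fun _ : Fin (n + 1) => gaussianReal 0 1) N = 0 := by
    rw [← lintegral_indicator_one hNm,
      lintegral_expSum_split j (measurable_one.indicator hNm)]
    have hz : ∀ η : Fin n → ℝ, ∫⁻ y, N.indicator 1 (j.insertNth (α := fun _ => ℝ) y η)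
        ∂(gaussianReal 0 1) = (0 : ENNReal) := by
      intro η
      have hae : ∀ᵐ y ∂(gaussianReal 0 1), ∀ s, ∑ i, solveCoeff c j s i * η i = y →
          ∑ i, solveCoeffDeriv c j s i * η i ≠ 0 :=
        (gaussianReal_absolutelyContinuous 0 one_ne_zero).ae_le
          (ae_regular_value fun s => hasDerivAt_solve (c := c) (j := j) η s)
      rw [lintegral_eq_zero_of_ae_eq_zero]
      filter_upwards [hae] with y hy
      rw [Set.indicator_of_notMem]; · rfl
      rintro ⟨s, h1, h2⟩
      rw [expSumDeriv_insertNth hj, h1, mul_zero, zero_sub, neg_eq_zero, mul_eq_zero,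
        or_iff_right (mul_ne_zero hj (Real.exp_ne_zero _))] at h2
      exact hy s ((expSum_insertNth_eq_zero_iff hj y η s).1 h1) h2
    simp_rw [hz]; simp
  have : ∀ᵐ ξ ∂(Measure.pi fun _ : Fin (n + 1) => gaussianReal 0 1), ξ ∉ N :=
    measure_eq_zero_iff_ae_notMem.1 h0
  filter_upwards [this] with ξ hξ s h1 h2
  exact hξ ⟨s, h1, h2⟩

/-- Dividing the tilted weight of index `k ≠ j` by that of index `j` gives the square of a solving
coefficient. The functions `1`, `t`, `t ^ 2` then produce the moments about the centre `j`; the term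
`f 0` is the index `j` itself. -/
theorem sum_solveCoeff (hj : c j ≠ 0) (s : ℝ) (f : ℝ → ℝ) :
    ∑ k ∈ Finset.range (n + 1), f ((k : ℝ) - (j : ℕ)) * (sqWeight c k * Real.exp (2 * s) ^ k) =
      c j ^ 2 * Real.exp (2 * s) ^ (j : ℕ) * (f 0 + ∑ i : Fin n,
        f (((j.succAbove i : Fin (n + 1)) : ℕ) - ((j : ℕ) : ℝ)) * solveCoeff c j s i ^ 2) := by
  rw [← Fin.sum_univ_eq_sum_range (fun k => f ((k : ℝ) - (j : ℕ)) *
    (sqWeight c k * Real.exp (2 * s) ^ k)), Fin.sum_univ_succAbove _ j, mul_add, Finset.mul_sum]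
  simp_rw [sqWeight_coe]
  congr 1
  · simp; ring
  · refine Finset.sum_congr rfl fun i _ => ?_
    unfold solveCoeff
    rw [mul_pow, ← Real.exp_nat_mul, ← Real.exp_nat_mul, ← Real.exp_nat_mul, neg_sq, div_pow]
    have : Real.exp (((j.succAbove i : Fin (n + 1)) : ℕ) * (2 * s)) = Real.exp ((j : ℕ) * (2 * s)) *
        Real.exp ((2 : ℕ) * ((((j.succAbove i : Fin (n + 1)) : ℕ) - ((j : ℕ) : ℝ)) * s)) := by
      rw [← Real.exp_add]; push_cast; ring_nf
    rw [this]; field_simp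

/-- Up to a common factor, `1 + ∑ a ^ 2`, `∑ a b` and `∑ b ^ 2` are the moments of order 0, 1, 2 of
the tilted weights about `j`, so the radicand is their variance. -/
theorem tiltStd_eq_solveCoeff (hj : c j ≠ 0) (s : ℝ) :
    √((∑ i, solveCoeffDeriv c j s i ^ 2) / (1 + ∑ i, solveCoeff c j s i ^ 2) -
      ((∑ i, solveCoeff c j s i * solveCoeffDeriv c j s i) / (1 + ∑ i, solveCoeff c j s i ^ 2)) ^ 2) =
      tiltStd n (sqWeight c) (Real.exp (2 * s)) := by
  set A := ∑ i, solveCoeff c j s i ^ 2 with hA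
  set B := ∑ i, solveCoeffDeriv c j s i ^ 2 with hB
  set C := ∑ i, solveCoeff c j s i * solveCoeffDeriv c j s i with hC
  have hA0 : 0 < 1 + A := by
    have : 0 ≤ A := Finset.sum_nonneg fun i _ => sq_nonneg _
    linarith
  set T := c j ^ 2 * Real.exp (2 * s) ^ (j : ℕ) with hT
  have hT0 : 0 < T := by positivity
  have h0 : tiltMoment n (sqWeight c) 0 (Real.exp (2 * s)) = T * (1 + A) := by
    have h := sum_solveCoeff hj s (fun _ => 1)
    simp only [one_mul] at h
    simp only [tiltMoment, pow_zero, one_mul]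
    rw [h]
  have h1 := sum_solveCoeff hj s (fun t => t)
  have h2 := sum_solveCoeff hj s (fun t => t ^ 2)
  have e1 : ∑ i : Fin n, (((j.succAbove i : Fin (n + 1)) : ℕ) - ((j : ℕ) : ℝ)) *
      solveCoeff c j s i ^ 2 = C := by
    rw [hC]; exact Finset.sum_congr rfl fun i _ => by unfold solveCoeffDeriv; ring
  have e2 : ∑ i : Fin n, (((j.succAbove i : Fin (n + 1)) : ℕ) - ((j : ℕ) : ℝ)) ^ 2 *
      solveCoeff c j s i ^ 2 = B := by
    rw [hB]; exact Finset.sum_congr rfl fun i _ => by unfold solveCoeffDeriv; ring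
  rw [e1, zero_add] at h1
  rw [e2, zero_pow two_ne_zero, zero_add] at h2
  unfold tiltStd
  rw [tiltSpread_eq n _ _ (j : ℕ), h0, h1, h2]
  have e3 : B / (1 + A) - (C / (1 + A)) ^ 2 =
      2 * (T * (1 + A) * (T * B) - (T * C) ^ 2) / 2 / (T * (1 + A)) ^ 2 := by
    field_simp
  rw [e3, Real.sqrt_div' _ (by positivity), Real.sqrt_sq (by positivity)]

/-- The Kac–Rice formula for the positive zeros of a Gaussian polynomial. -/
theorem lintegral_count_expSum (hj : c j ≠ 0) :
    ∫⁻ ξ, Measure.count {s | expSum c ξ s = 0} ∂(Measure.pi fun _ => gaussianReal 0 1) =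
      ∫⁻ s, ENNReal.ofReal (1 / Real.pi * tiltStd n (sqWeight c) (Real.exp (2 * s))) := by
  rw [lintegral_expSum_split j (measurable_count_zeros (continuous_uncurry_expSum c))]
  have hcont : Continuous fun p : (Fin n → ℝ) × ℝ => ∑ i, solveCoeff c j p.2 i * p.1 i := by
    unfold solveCoeff; fun_prop
  have hcont' : Continuous fun p : (Fin n → ℝ) × ℝ => ∑ i, solveCoeffDeriv c j p.2 i * p.1 i := by
    unfold solveCoeffDeriv solveCoeff; fun_prop
  -- The inner integral runs over `ξ_j` alone and is the area formula with the Gaussian density as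
  -- weight.
  have h1 : ∀ η : Fin n → ℝ,
      ∫⁻ y, Measure.count {s | expSum c (j.insertNth (α := fun _ => ℝ) y η) s = 0}
        ∂(gaussianReal 0 1) =
      ∫⁻ s, gaussianPDF 0 1 (∑ i, solveCoeff c j s i * η i) *
        ENNReal.ofReal |∑ i, solveCoeffDeriv c j s i * η i| := by
    intro η
    simp_rw [expSum_insertNth_eq_zero_iff hj]
    have hg : Continuous fun s => ∑ i, solveCoeff c j s i * η i :=
      hcont.comp (continuous_const.prodMk continuous_id)
    have hm : Measurable fun y => Measure.count {s | ∑ i, solveCoeff c j s i * η i = y} := by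
      have := measurable_count_zeros (X := ℝ) (F := fun y s => ∑ i, solveCoeff c j s i * η i - y)
        (by exact (hg.comp continuous_snd).sub continuous_fst)
      simpa only [sub_eq_zero] using this
    rw [gaussianReal_of_var_ne_zero _ one_ne_zero,
      lintegral_withDensity_eq_lintegral_mul _ (measurable_gaussianPDF _ _) hm]
    exact lintegral_mul_count_preimage (fun s => hasDerivAt_solve η s)
      (hcont'.comp (continuous_const.prodMk continuous_id)) (measurable_gaussianPDF _ _)
  simp_rw [h1]
  rw [lintegral_lintegral_swap]
  · refine lintegral_congr fun s => ?_
    rw [lintegral_gaussianPDF_mul_abs_linear, tiltStd_eq_solveCoeff hj]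
  · exact (((measurable_gaussianPDF 0 1).comp hcont.measurable).mul
      (hcont'.measurable.abs.ennreal_ofReal)).aemeasurable

end

/-! ### From exponential sums to roots of polynomials -/

section Roots

variable {n : ℕ}

/-- The coefficients of `P(-z)`. -/
def altCoeff (c : Fin (n + 1) → ℝ) (i : Fin (n + 1)) : ℝ := (-1) ^ (i : ℕ) * c i

theorem sqWeight_altCoeff (c : Fin (n + 1) → ℝ) : sqWeight (altCoeff c) = sqWeight c := by
  ext k
  unfold sqWeight altCoeff
  split_ifs with h
  · rw [mul_pow, ← pow_mul, mul_comm k 2, pow_mul]; simp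
  · rfl

theorem eval_weightedPoly (c x : Fin (n + 1) → ℝ) (t : ℝ) :
    (weightedPoly n c x).eval t = ∑ i, c i * x i * t ^ (i : ℕ) := by
  simp [weightedPoly, Polynomial.eval_finsetSum]

theorem eval_weightedPoly_exp (c x : Fin (n + 1) → ℝ) (s : ℝ) :
    (weightedPoly n c x).eval (Real.exp s) = expSum c x s := by
  rw [eval_weightedPoly, expSum]
  exact Finset.sum_congr rfl fun i _ => by rw [Real.exp_nat_mul]

theorem eval_weightedPoly_neg_exp (c x : Fin (n + 1) → ℝ) (s : ℝ) :
    (weightedPoly n c x).eval (-Real.exp s) = expSum (altCoeff c) x s := by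
  rw [eval_weightedPoly, expSum]
  exact Finset.sum_congr rfl fun i _ => by
    rw [Real.exp_nat_mul, neg_pow]; unfold altCoeff; ring

theorem eval_derivative_weightedPoly_mul (c x : Fin (n + 1) → ℝ) (t : ℝ) :
    (weightedPoly n c x).derivative.eval t * t = ∑ i, c i * x i * (((i : ℕ) : ℝ) * t ^ (i : ℕ)) := by
  simp only [weightedPoly, Polynomial.derivative_sum, Polynomial.eval_finsetSum, Finset.sum_mul]
  refine Finset.sum_congr rfl fun i _ => ?_
  rw [Polynomial.derivative_C_mul_X_pow]
  simp only [Polynomial.eval_mul, Polynomial.eval_C, Polynomial.eval_pow, Polynomial.eval_X]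
  rcases Nat.eq_zero_or_pos (i : ℕ) with h | h
  · simp [h]
  · have : t ^ (i : ℕ) = t ^ ((i : ℕ) - 1) * t := by
      rw [← pow_succ, Nat.sub_add_cancel h]
    rw [this]; ring

theorem eval_derivative_weightedPoly_exp (c x : Fin (n + 1) → ℝ) (s : ℝ) :
    (weightedPoly n c x).derivative.eval (Real.exp s) * Real.exp s = expSumDeriv c x s := by
  rw [eval_derivative_weightedPoly_mul, expSumDeriv]
  exact Finset.sum_congr rfl fun i _ => by rw [Real.exp_nat_mul]

theorem eval_derivative_weightedPoly_neg_exp (c x : Fin (n + 1) → ℝ) (s : ℝ) :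
    (weightedPoly n c x).derivative.eval (-Real.exp s) * -Real.exp s =
      expSumDeriv (altCoeff c) x s := by
  rw [eval_derivative_weightedPoly_mul, expSumDeriv]
  exact Finset.sum_congr rfl fun i _ => by
    rw [Real.exp_nat_mul, neg_pow]; unfold altCoeff; ring

theorem coeff_weightedPoly (c x : Fin (n + 1) → ℝ) (i : Fin (n + 1)) :
    (weightedPoly n c x).coeff i = c i * x i := by
  simp only [weightedPoly, Polynomial.finsetSum_coeff, Polynomial.coeff_C_mul_X_pow]
  rw [Finset.sum_eq_single i]
  · simp
  · intro b _ hb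
    rw [if_neg]; exact fun h => hb (Fin.ext h.symm)
  · simp

theorem natDegree_weightedPoly_le (c x : Fin (n + 1) → ℝ) : (weightedPoly n c x).natDegree ≤ n := by
  refine Polynomial.natDegree_sum_le_of_forall_le _ _ fun i _ => ?_
  exact (Polynomial.natDegree_C_mul_X_pow_le _ _).trans (Nat.lt_succ_iff.1 i.2)

theorem numRealZeros_weightedPoly_le (c x : Fin (n + 1) → ℝ) :
    numRealZeros (weightedPoly n c x) ≤ n :=
  (Polynomial.card_roots' _).trans (natDegree_weightedPoly_le c x)

theorem coeff_weightedPoly_of_lt (c x : Fin (n + 1) → ℝ) {k : ℕ} (hk : n < k) :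
    (weightedPoly n c x).coeff k = 0 :=
  Polynomial.coeff_eq_zero_of_natDegree_lt ((natDegree_weightedPoly_le c x).trans_lt hk)

/-- The multiplicity of the root `0` depends only on which coefficients vanish, so it is almost
surely not random. -/
theorem natTrailingDegree_weightedPoly (c : Fin (n + 1) → ℝ) {x : Fin (n + 1) → ℝ}
    (hx : ∀ i, x i ≠ 0) :
    (weightedPoly n c x).natTrailingDegree = (weightedPoly n c 1).natTrailingDegree := by
  have : (weightedPoly n c x).support = (weightedPoly n c 1).support := by
    ext k
    rw [Polynomial.mem_support_iff, Polynomial.mem_support_iff]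
    rcases lt_or_ge n k with hk | hk
    · rw [coeff_weightedPoly_of_lt _ _ hk, coeff_weightedPoly_of_lt _ _ hk]
    · have h1 := coeff_weightedPoly c x ⟨k, Nat.lt_succ_of_le hk⟩
      have h2 := coeff_weightedPoly c 1 ⟨k, Nat.lt_succ_of_le hk⟩
      simp only at h1 h2
      rw [h1, h2]
      simp [hx]
  unfold Polynomial.natTrailingDegree Polynomial.trailingDegree
  rw [this]

theorem natTrailingDegree_weightedPoly_le {c : Fin (n + 1) → ℝ} {j : Fin (n + 1)} (hj : c j ≠ 0) :
    (weightedPoly n c 1).natTrailingDegree ≤ j := by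
  apply Polynomial.natTrailingDegree_le_of_ne_zero
  rw [coeff_weightedPoly]; simpa using hj

/-- Nonzero roots are simple, so they are counted as a set through `s ↦ ± exp s`; the origin, the
only root these maps miss, brings its multiplicity. -/
theorem card_roots_eq_of_simple {P : Polynomial ℝ} (hP : P ≠ 0)
    (hs : ∀ t, t ≠ 0 → P.eval t = 0 → P.derivative.eval t ≠ 0) :
    ((Multiset.card P.roots : ℕ) : ENNReal) = P.natTrailingDegree +
      Measure.count {s | P.eval (Real.exp s) = 0} + Measure.count {s | P.eval (-Real.exp s) = 0} := by
  classical
  have hcount : ∀ t ∈ P.roots.toFinset, t ≠ 0 → P.roots.count t = 1 := by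
    intro t ht h0
    have hr : P.IsRoot t := Polynomial.isRoot_of_mem_roots (Multiset.mem_toFinset.1 ht)
    rw [Polynomial.count_roots]
    have h1 : 0 < P.rootMultiplicity t := (Polynomial.rootMultiplicity_pos hP).2 hr
    have h2 : ¬ 1 < P.rootMultiplicity t := fun h =>
      hs t h0 hr ((Polynomial.one_lt_rootMultiplicity_iff_isRoot hP).1 h).2
    omega
  have hset : ∀ σ : ℝ, σ = 1 ∨ σ = -1 →
      Measure.count {s | P.eval (σ * Real.exp s) = 0} =
        ((P.roots.toFinset.filter fun t => 0 < σ * t).card : ENNReal) := by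
    intro σ hσ
    have hσ0 : σ ≠ 0 := by rcases hσ with h | h <;> rw [h] <;> norm_num
    have hσ2 : σ * σ = 1 := by rcases hσ with h | h <;> rw [h] <;> norm_num
    have hm : MeasurableSet {s | P.eval (σ * Real.exp s) = 0} := by
      refine (isClosed_eq ?_ continuous_const).measurableSet
      exact P.continuous.comp (continuous_const.mul Real.continuous_exp)
    have hinj : Function.Injective fun s => σ * Real.exp s :=
      (mul_right_injective₀ hσ0).comp Real.exp_injective
    have himg : (fun s => σ * Real.exp s) '' {s | P.eval (σ * Real.exp s) = 0} =
        ((P.roots.toFinset.filter fun t => 0 < σ * t : Finset ℝ) : Set ℝ) := by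
      ext t
      simp only [Set.mem_image, Set.mem_ofPred_eq, Finset.coe_filter, Multiset.mem_toFinset,
        Polynomial.mem_roots hP, Polynomial.IsRoot.def]
      constructor
      · rintro ⟨s, h1, rfl⟩
        refine ⟨h1, ?_⟩
        rw [← mul_assoc, hσ2, one_mul]; exact Real.exp_pos s
      · rintro ⟨h1, h2⟩
        refine ⟨Real.log (σ * t), ?_, ?_⟩
        · rw [Real.exp_log h2, ← mul_assoc, hσ2, one_mul]; exact h1
        · rw [Real.exp_log h2, ← mul_assoc, hσ2, one_mul]
    rw [Measure.count_apply hm, ← hinj.encard_image, himg, Set.encard_coe_eq_coe_finsetCard]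
    simp
  have hp := hset 1 (Or.inl rfl)
  have hn := hset (-1) (Or.inr rfl)
  simp only [one_mul] at hp
  simp only [neg_mul, one_mul] at hn
  rw [hp, hn, ← Multiset.toFinset_sum_count_eq]
  have hsplit : ∑ t ∈ P.roots.toFinset, P.roots.count t = P.natTrailingDegree +
      (P.roots.toFinset.filter fun t => 0 < t).card +
      (P.roots.toFinset.filter fun t => 0 < -t).card := by
    have h3 : ∀ t ∈ P.roots.toFinset, P.roots.count t =
        (if t = 0 then P.natTrailingDegree else 0) + (if 0 < t then 1 else 0) +
          (if 0 < -t then 1 else 0) := by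
      intro t ht
      rcases lt_trichotomy t 0 with h | h | h
      · rw [hcount t ht h.ne, if_neg h.ne, if_neg (by linarith), if_pos (by linarith)]
      · subst h
        rw [if_pos rfl, if_neg (lt_irrefl _), if_neg (by simp), Polynomial.count_roots,
          Polynomial.rootMultiplicity_eq_natTrailingDegree', add_zero, add_zero]
      · rw [hcount t ht h.ne', if_neg h.ne', if_pos h, if_neg (by linarith)]
    rw [Finset.sum_congr rfl h3, Finset.sum_add_distrib, Finset.sum_add_distrib,
      Finset.card_filter, Finset.card_filter, Finset.sum_ite_eq']
    congr 2
    split_ifs with h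
    · rfl
    · rw [Multiset.mem_toFinset, Polynomial.mem_roots hP] at h
      rw [← Polynomial.rootMultiplicity_eq_natTrailingDegree']
      exact (Polynomial.rootMultiplicity_eq_zero h).symm
  rw [hsplit]; push_cast; rfl

theorem ae_numRealZeros_eq {c : Fin (n + 1) → ℝ} {j : Fin (n + 1)} (hj : c j ≠ 0) :
    ∀ᵐ x ∂(Measure.pi fun _ => gaussianReal 0 1),
      (numRealZeros (weightedPoly n c x) : ENNReal) = (weightedPoly n c 1).natTrailingDegree +
        Measure.count {s | expSum c x s = 0} + Measure.count {s | expSum (altCoeff c) x s = 0} := by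
  have hj' : altCoeff c j ≠ 0 := mul_ne_zero (pow_ne_zero _ (by norm_num)) hj
  have hx0 : ∀ᵐ x ∂(Measure.pi fun _ : Fin (n + 1) => gaussianReal 0 1), ∀ i, x i ≠ 0 := by
    rw [ae_all_iff]
    intro i
    have h := (measurePreserving_eval (fun _ : Fin (n + 1) => gaussianReal 0 1) i)
    have h1 : ∀ᵐ y ∂(gaussianReal 0 1), y ≠ 0 := by
      have := nullSingletonClass_gaussianReal (μ := 0) (one_ne_zero : (1 : NNReal) ≠ 0)
      exact Measure.ae_ne _ 0
    exact h.quasiMeasurePreserving.ae h1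
  filter_upwards [ae_simple_zeros hj, ae_simple_zeros hj', hx0] with x h1 h2 h3
  have hP : weightedPoly n c x ≠ 0 := by
    intro h
    have e1 := eval_weightedPoly_exp c x 0
    have e2 := eval_derivative_weightedPoly_exp c x 0
    rw [h] at e1 e2
    simp only [Polynomial.eval_zero, Polynomial.derivative_zero, zero_mul] at e1 e2
    exact h1 0 e1.symm e2.symm
  rw [← natTrailingDegree_weightedPoly c h3]
  have hset1 : {s | expSum c x s = 0} = {s | (weightedPoly n c x).eval (Real.exp s) = 0} := by
    ext s; rw [Set.mem_ofPred_eq, Set.mem_ofPred_eq, eval_weightedPoly_exp]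
  have hset2 : {s | expSum (altCoeff c) x s = 0} =
      {s | (weightedPoly n c x).eval (-Real.exp s) = 0} := by
    ext s; rw [Set.mem_ofPred_eq, Set.mem_ofPred_eq, eval_weightedPoly_neg_exp]
  rw [hset1, hset2]
  refine card_roots_eq_of_simple hP fun t ht he hd => ?_
  rcases lt_or_gt_of_ne ht with h | h
  · have ht' : t = -Real.exp (Real.log (-t)) := by rw [Real.exp_log (by linarith)]; ring
    refine h2 (Real.log (-t)) ?_ ?_
    · rw [← eval_weightedPoly_neg_exp, ← ht', he]
    · rw [← eval_derivative_weightedPoly_neg_exp, ← ht', hd, zero_mul]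
  · have ht' : t = Real.exp (Real.log t) := by rw [Real.exp_log h]
    refine h1 (Real.log t) ?_ ?_
    · rw [← eval_weightedPoly_exp, ← ht', he]
    · rw [← eval_derivative_weightedPoly_exp, ← ht', hd, zero_mul]

theorem tiltMoment_nonneg {n : ℕ} {w : ℕ → ℝ} (hw : ∀ k ≤ n, 0 ≤ w k) (p : ℕ) {x : ℝ} (hx : 0 ≤ x) :
    0 ≤ tiltMoment n w p x :=
  Finset.sum_nonneg fun k hk => by
    have := hw k (Nat.lt_succ_iff.1 (Finset.mem_range.1 hk))
    positivity

theorem tiltStd_nonneg {n : ℕ} {w : ℕ → ℝ} (hw : ∀ k ≤ n, 0 ≤ w k) {x : ℝ} (hx : 0 ≤ x) :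
    0 ≤ tiltStd n w x :=
  div_nonneg (Real.sqrt_nonneg _) (tiltMoment_nonneg hw 0 hx)

theorem tiltMoment_zero_pos {n : ℕ} {w : ℕ → ℝ} (hw : ∀ k ≤ n, 0 ≤ w k) {j : ℕ} (hj : j ≤ n)
    (hwj : 0 < w j) {x : ℝ} (hx : 0 < x) : 0 < tiltMoment n w 0 x := by
  refine Finset.sum_pos' (fun k hk => ?_) ⟨j, Finset.mem_range.2 (Nat.lt_succ_of_le hj), ?_⟩
  · have := hw k (Nat.lt_succ_iff.1 (Finset.mem_range.1 hk))
    positivity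
  · positivity

theorem continuous_tiltStd_exp {n : ℕ} {w : ℕ → ℝ} (hw : ∀ k ≤ n, 0 ≤ w k) {j : ℕ} (hj : j ≤ n)
    (hwj : 0 < w j) : Continuous fun u => tiltStd n w (Real.exp u) := by
  unfold tiltStd
  refine Continuous.div ?_ ?_ fun u => (tiltMoment_zero_pos hw hj hwj (Real.exp_pos u)).ne'
  · unfold tiltSpread; fun_prop
  · unfold tiltMoment; fun_prop

/-- The two signs double the integral over `s` and the substitution `u = 2 s` halves it. All
integrability comes from the deterministic bound `n` on the number of zeros. -/
theorem kacRice {c : Fin (n + 1) → ℝ} {j : Fin (n + 1)} (hj : c j ≠ 0) :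
    Integrable (fun u => tiltStd n (sqWeight c) (Real.exp u)) ∧
    Integrable (fun x => (numRealZeros (weightedPoly n c x) : ℝ))
      (Measure.pi fun _ => gaussianReal 0 1) ∧
    ∫ x, (numRealZeros (weightedPoly n c x) : ℝ) ∂(Measure.pi fun _ => gaussianReal 0 1) =
      (weightedPoly n c 1).natTrailingDegree +
        1 / Real.pi * ∫ u, tiltStd n (sqWeight c) (Real.exp u) := by
  have hpi := Real.pi_pos
  have hj' : altCoeff c j ≠ 0 := mul_ne_zero (pow_ne_zero _ (by norm_num)) hj
  have hw : ∀ k ≤ n, 0 ≤ sqWeight c k := fun k _ => sqWeight_nonneg c k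
  have hwj : 0 < sqWeight c j := by rw [sqWeight_coe]; positivity
  have hcont := continuous_tiltStd_exp hw (Nat.lt_succ_iff.1 j.2) hwj
  have hm1 := measurable_count_zeros (continuous_uncurry_expSum c)
  have hm2 := measurable_count_zeros (continuous_uncurry_expSum (altCoeff c))
  have hae := ae_numRealZeros_eq hj
  set I := ∫⁻ s, ENNReal.ofReal (1 / Real.pi * tiltStd n (sqWeight c) (Real.exp (2 * s))) with hI
  set m := (weightedPoly n c 1).natTrailingDegree
  have hlin : ∫⁻ x, (numRealZeros (weightedPoly n c x) : ENNReal)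
      ∂(Measure.pi fun _ => gaussianReal 0 1) = m + I + I := by
    rw [lintegral_congr_ae hae, lintegral_add_right _ hm2, lintegral_add_right _ hm1,
      lintegral_const, measure_univ, mul_one, lintegral_count_expSum hj,
      lintegral_count_expSum hj', sqWeight_altCoeff]
  have hAEm : AEMeasurable (fun x => (numRealZeros (weightedPoly n c x) : ENNReal))
      (Measure.pi fun _ => gaussianReal 0 1) :=
    ⟨_, (measurable_const.add hm1).add hm2, hae⟩
  have hAE : AEStronglyMeasurable (fun x => (numRealZeros (weightedPoly n c x) : ℝ))
      (Measure.pi fun _ => gaussianReal 0 1) := by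
    have := hAEm.ennreal_toReal
    simpa using this.aestronglyMeasurable
  have hint : Integrable (fun x => (numRealZeros (weightedPoly n c x) : ℝ))
      (Measure.pi fun _ => gaussianReal 0 1) := by
    refine Integrable.of_bound hAE (n : ℝ) (ae_of_all _ fun x => ?_)
    rw [Real.norm_of_nonneg (by positivity)]
    exact_mod_cast numRealZeros_weightedPoly_le c x
  have hfin : m + I + I ≠ ⊤ := by
    rw [← hlin]
    refine ne_top_of_le_ne_top ?_ (lintegral_mono fun x => (show
      (numRealZeros (weightedPoly n c x) : ENNReal) ≤ n by
        exact_mod_cast numRealZeros_weightedPoly_le c x))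
    rw [lintegral_const, measure_univ, mul_one]
    exact ENNReal.natCast_ne_top n
  have hIfin : I ≠ ⊤ := fun h => hfin (by rw [h]; simp)
  have hcont2 : Continuous fun s => 1 / Real.pi * tiltStd n (sqWeight c) (Real.exp (2 * s)) :=
    continuous_const.mul (hcont.comp (continuous_const.mul continuous_id))
  have hnn : ∀ s, 0 ≤ 1 / Real.pi * tiltStd n (sqWeight c) (Real.exp (2 * s)) := fun s =>
    mul_nonneg (by positivity) (tiltStd_nonneg hw (Real.exp_pos _).le)
  have hint2 : Integrable fun s => 1 / Real.pi * tiltStd n (sqWeight c) (Real.exp (2 * s)) := by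
    refine ⟨hcont2.aestronglyMeasurable, ?_⟩
    rw [hasFiniteIntegral_iff_ofReal (ae_of_all _ hnn)]
    exact lt_top_iff_ne_top.2 hIfin
  have hint3 : Integrable fun u => tiltStd n (sqWeight c) (Real.exp u) := by
    have h1 := hint2.const_mul Real.pi
    have h2 : Integrable fun s => tiltStd n (sqWeight c) (Real.exp (2 * s)) := by
      convert h1 using 2 with s
      field_simp
    exact (integrable_comp_mul_left_iff (fun u => tiltStd n (sqWeight c) (Real.exp u))
      two_ne_zero).1 h2
  refine ⟨hint3, hint, ?_⟩
  have hIreal : I = ENNReal.ofReal (1 / Real.pi * (1 / 2 * ∫ u, tiltStd n (sqWeight c) (Real.exp u))) := by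
    rw [hI, ← ofReal_integral_eq_lintegral_ofReal hint2 (ae_of_all _ hnn), integral_const_mul,
      Measure.integral_comp_mul_left (fun u => tiltStd n (sqWeight c) (Real.exp u)) 2]
    congr 3
    norm_num
  have hInn : 0 ≤ ∫ u, tiltStd n (sqWeight c) (Real.exp u) :=
    integral_nonneg fun u => tiltStd_nonneg hw (Real.exp_pos _).le
  rw [integral_eq_lintegral_of_nonneg_ae (ae_of_all _ fun x => by positivity) hAE]
  simp_rw [ENNReal.ofReal_natCast]
  rw [hlin, hIreal, ENNReal.toReal_add (by simp) (by simp), ENNReal.toReal_add (by simp) (by simp),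
    ENNReal.toReal_ofReal (by positivity), ENNReal.toReal_natCast]
  ring

/-- The total integral of the standard deviation along the tilts is at most `π n`. -/
theorem integral_tiltStd_exp_le {n : ℕ} {w : ℕ → ℝ} (hw : ∀ k ≤ n, 0 ≤ w k) {j : ℕ} (hj : j ≤ n)
    (hwj : 0 < w j) :
    Integrable (fun u => tiltStd n w (Real.exp u)) ∧
      ∫ u, tiltStd n w (Real.exp u) ≤ Real.pi * n := by
  have hpi := Real.pi_pos
  set c : Fin (n + 1) → ℝ := fun i => √(w i) with hc
  have hcw : ∀ k ∈ Finset.range (n + 1), sqWeight c k = w k := by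
    intro k hk
    have hk' := Finset.mem_range.1 hk
    rw [sqWeight, dif_pos hk', hc]
    exact Real.sq_sqrt (hw k (Nat.lt_succ_iff.1 hk'))
  have heq : ∀ x, tiltStd n (sqWeight c) x = tiltStd n w x := by
    intro x
    have h1 : tiltSpread n (sqWeight c) x = tiltSpread n w x :=
      Finset.sum_congr rfl fun i hi => Finset.sum_congr rfl fun k hk => by rw [hcw i hi, hcw k hk]
    have h2 : tiltMoment n (sqWeight c) 0 x = tiltMoment n w 0 x :=
      Finset.sum_congr rfl fun i hi => by rw [hcw i hi]
    rw [tiltStd, h1, h2, tiltStd]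
  have hcj : c ⟨j, Nat.lt_succ_of_le hj⟩ ≠ 0 := (Real.sqrt_pos.2 hwj).ne'
  obtain ⟨h1, h2, h3⟩ := kacRice hcj
  simp_rw [heq] at h1 h3
  refine ⟨h1, ?_⟩
  -- Kac–Rice is used backwards: with coefficients `√(w k)`, the degree bounds the expected number
  -- of zeros and hence the integral.
  have h4 : ∫ x, (numRealZeros (weightedPoly n c x) : ℝ) ∂(Measure.pi fun _ => gaussianReal 0 1) ≤
      n := by
    calc _ ≤ ∫ x : Fin (n + 1) → ℝ, (n : ℝ) ∂(Measure.pi fun _ => gaussianReal 0 1) :=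
          integral_mono h2 (integrable_const _) fun x =>
            Nat.cast_le.2 (numRealZeros_weightedPoly_le c x)
      _ = n := by simp
  rw [h3] at h4
  have h5 : 1 / Real.pi * ∫ u, tiltStd n w (Real.exp u) ≤ n := by
    have : (0 : ℝ) ≤ (weightedPoly n c 1).natTrailingDegree := by positivity
    linarith
  rw [one_div, inv_mul_le_iff₀ hpi] at h5
  exact h5

end Roots

/-! ### Rising factorial quotients and their generating functions -/

/-- The quotient `L (L + 1) ... (L + k - 1) / k!`. -/
noncomputable def risingRatio (L : ℝ) (k : ℕ) : ℝ :=
  (∏ i ∈ Finset.range k, (L + (i : ℝ))) / (k.factorial : ℝ)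

theorem risingRatio_zero (L : ℝ) : risingRatio L 0 = 1 := by simp [risingRatio]

theorem risingRatio_succ (L : ℝ) (k : ℕ) :
    risingRatio L (k + 1) = risingRatio L k * (L + k) / (k + 1) := by
  unfold risingRatio
  rw [Finset.prod_range_succ, Nat.factorial_succ]
  push_cast
  field_simp

theorem risingRatio_pos {L : ℝ} (hL : 0 < L) (k : ℕ) : 0 < risingRatio L k := by
  unfold risingRatio
  refine div_pos (Finset.prod_pos fun i _ => by positivity) (by positivity)

theorem risingRatio_one (k : ℕ) : risingRatio 1 k = 1 := by
  induction k with
  | zero => exact risingRatio_zero 1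
  | succ k ih => rw [risingRatio_succ, ih]; field_simp; ring

theorem mul_risingRatio_add_one (L : ℝ) (k : ℕ) :
    L * risingRatio (L + 1) k = (L + k) * risingRatio L k := by
  induction k with
  | zero => simp [risingRatio_zero]
  | succ k ih =>
    rw [risingRatio_succ, risingRatio_succ, mul_div_assoc', ← mul_assoc, ih]
    push_cast; ring

theorem sum_risingRatio (L : ℝ) (n : ℕ) :
    ∑ k ∈ Finset.range (n + 1), risingRatio L k = risingRatio (L + 1) n := by
  induction n with
  | zero => simp [risingRatio_zero]
  | succ n ih =>
    rw [Finset.sum_range_succ, ih, risingRatio_succ, risingRatio_succ (L + 1)]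
    have := mul_risingRatio_add_one L n
    field_simp
    linarith

theorem risingRatio_mono {L L' : ℝ} (hL : 0 < L) (h : L ≤ L') (k : ℕ) :
    risingRatio L k ≤ risingRatio L' k := by
  unfold risingRatio
  gcongr

/-- Follows from `(k + 1) r(k + 1) = (L + k) r(k)`. It stands in for monotonicity of the quotient
itself, which fails for `L < 1`. -/
theorem mul_risingRatio_mono {L : ℝ} (hL : 0 < L) {k n : ℕ} (h : k ≤ n) :
    k * risingRatio L k ≤ n * risingRatio L n := by
  induction n, h using Nat.le_induction with
  | base => exact le_rfl
  | succ n _ ih =>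
    refine ih.trans ?_
    rw [risingRatio_succ]
    have := risingRatio_pos hL n
    push_cast
    field_simp
    nlinarith

theorem hasSum_risingRatio (L : ℝ) {x : ℝ} (hx0 : 0 ≤ x) (hx1 : x < 1) :
    HasSum (fun k => risingRatio L k * x ^ k) ((1 - x) ^ (-L)) := by
  have hmem : x ∈ Metric.eball (0 : ℝ) 1 := by
    rw [Metric.mem_eball, edist_dist, Real.dist_eq, sub_zero, abs_of_nonneg hx0]
    exact ENNReal.ofReal_lt_one.2 hx1
  have h := (Real.one_div_one_sub_rpow_hasFPowerSeriesOnBall_zero L).hasSum hmem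
  have hc : ∀ k : ℕ, Ring.choose (L + k - 1) k = risingRatio L k := by
    intro k
    have h1 : Ring.choose (L + k - 1) k = Ring.multichoose L k := by
      rw [Ring.choose]; congr 1; ring
    have h2 := Ring.factorial_nsmul_multichoose_eq_ascPochhammer L k
    rw [Polynomial.ascPochhammer_smeval_eq_eval, nsmul_eq_mul] at h2
    have h3 : ∀ k : ℕ, (ascPochhammer ℝ k).eval L = ∏ i ∈ Finset.range k, (L + (i : ℝ)) := by
      intro k
      induction k with
      | zero => simp
      | succ k ih => rw [ascPochhammer_succ_eval, ih, Finset.prod_range_succ]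
    rw [h1, risingRatio, eq_div_iff (by positivity), mul_comm, h2, h3]
  simp only [FormalMultilinearSeries.ofScalars_apply_eq, zero_add, hc, smul_eq_mul] at h
  rw [Real.rpow_neg (by linarith), ← one_div]
  exact h

/-- The constant `L (L + 1) ... (L + p - 1)`. -/
noncomputable def momentConst (L : ℝ) (p : ℕ) : ℝ := ∏ q ∈ Finset.range p, (L + (q : ℝ))

theorem momentConst_succ' (L : ℝ) (p : ℕ) : momentConst L (p + 1) = L * momentConst (L + 1) p := by
  unfold momentConst
  rw [Finset.prod_range_succ']
  push_cast
  rw [add_zero, mul_comm]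
  congr 1
  exact Finset.prod_congr rfl fun q _ => by ring

theorem momentConst_nonneg {L : ℝ} (hL : 0 < L) (p : ℕ) : 0 ≤ momentConst L p :=
  Finset.prod_nonneg fun q _ => by positivity

/-- Since `k r_L(k) = L (r_{L+1}(k) - r_L(k))`, the moment of order `p + 1` for `L` is `L` times the
difference of the moments of order `p` for `L + 1` and `L`. The second is smaller by a factor of
order `1 - x` and joins the error; hence the induction over all `L` at once. -/
theorem exists_hasSum_moment (p : ℕ) : ∀ {L : ℝ}, 0 < L → ∃ C : ℝ, 0 ≤ C ∧ ∀ x : ℝ, 0 ≤ x → x < 1 →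
    ∃ S, HasSum (fun k : ℕ => (k : ℝ) ^ p * risingRatio L k * x ^ k) S ∧
      |S - momentConst L p * (1 - x) ^ (-(L + p))| ≤ C * ((1 - x) * (1 - x) ^ (-(L + p))) := by
  induction p with
  | zero =>
    intro L hL
    refine ⟨0, le_rfl, fun x hx0 hx1 => ⟨(1 - x) ^ (-L), ?_, ?_⟩⟩
    · simpa using hasSum_risingRatio L hx0 hx1
    · simp [momentConst]
  | succ p ih =>
    intro L hL
    obtain ⟨C, hC, h⟩ := ih hL
    obtain ⟨C', hC', h'⟩ := ih (show 0 < L + 1 by linarith)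
    have hK := momentConst_nonneg hL p
    refine ⟨L * C' + L * (C + momentConst L p), by positivity, fun x hx0 hx1 => ?_⟩
    obtain ⟨S, hS, hSb⟩ := h x hx0 hx1
    obtain ⟨S', hS', hSb'⟩ := h' x hx0 hx1
    have hτ : 0 < 1 - x := by linarith
    refine ⟨L * S' - L * S, ?_, ?_⟩
    · refine ((hS'.mul_left L).sub (hS.mul_left L)).congr_fun fun k => ?_
      have := mul_risingRatio_add_one L k
      rw [pow_succ]
      linear_combination (-(k : ℝ) ^ p * x ^ k) * this
    · rw [momentConst_succ']
      have e1 : (1 - x) ^ (-(L + 1 + p)) = (1 - x) ^ (-(L + ((p + 1 : ℕ) : ℝ))) := by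
        congr 1; push_cast; ring
      have e2 : (1 - x) ^ (-(L + p)) = (1 - x) * (1 - x) ^ (-(L + ((p + 1 : ℕ) : ℝ))) := by
        rw [← Real.rpow_one_add' hτ.le]
        · congr 1; push_cast; ring
        · push_cast; intro h; have : (0 : ℝ) ≤ p := by positivity
          linarith
      rw [e1] at hSb'
      set T := (1 - x) ^ (-(L + ((p + 1 : ℕ) : ℝ)))
      have hT : 0 ≤ T := (Real.rpow_pos_of_pos hτ _).le
      rw [e2] at hSb
      have hS0 : |S| ≤ (C + momentConst L p) * ((1 - x) * T) := by
        have h1 : |S| ≤ |S - momentConst L p * ((1 - x) * T)| + |momentConst L p * ((1 - x) * T)| := by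
          have := abs_add_le (S - momentConst L p * ((1 - x) * T)) (momentConst L p * ((1 - x) * T))
          simpa using this
        rw [abs_of_nonneg (show 0 ≤ momentConst L p * ((1 - x) * T) by positivity)] at h1
        have h2 : C * ((1 - x) * ((1 - x) * T)) ≤ C * ((1 - x) * T) := by
          gcongr
          have : 0 ≤ (1 - x) * T := by positivity
          nlinarith
        linarith
      have h3 : L * S' - L * S - L * momentConst (L + 1) p * T =
          L * (S' - momentConst (L + 1) p * T) - L * S := by ring
      rw [h3]
      calc _ ≤ |L * (S' - momentConst (L + 1) p * T)| + |L * S| := abs_sub _ _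
        _ = L * |S' - momentConst (L + 1) p * T| + L * |S| := by
            rw [abs_mul, abs_mul, abs_of_pos hL]
        _ ≤ L * (C' * ((1 - x) * T)) + L * ((C + momentConst L p) * ((1 - x) * T)) := by gcongr
        _ = _ := by ring

theorem exists_tiltMoment_risingRatio_le (p : ℕ) {L : ℝ} (hL : 0 < L) :
    ∃ C : ℝ, 0 ≤ C ∧ ∀ (n : ℕ) (x : ℝ), 0 ≤ x → x < 1 →
      tiltMoment n (risingRatio L) p x ≤ C * (1 - x) ^ (-(L + p)) := by
  obtain ⟨C, hC, h⟩ := exists_hasSum_moment p hL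
  have hK := momentConst_nonneg hL p
  refine ⟨C + momentConst L p, by positivity, fun n x hx0 hx1 => ?_⟩
  obtain ⟨S, hS, hSb⟩ := h x hx0 hx1
  have hT : 0 ≤ (1 - x) ^ (-(L + p)) := (Real.rpow_pos_of_pos (by linarith) _).le
  have h1 : tiltMoment n (risingRatio L) p x ≤ S :=
    sum_le_hasSum _ (fun k _ => by have := risingRatio_pos hL k; positivity) hS
  have h2 := (abs_le.1 hSb).2
  have h3 : C * ((1 - x) * (1 - x) ^ (-(L + p))) ≤ C * (1 - x) ^ (-(L + p)) := by
    gcongr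
    nlinarith
  linarith

theorem exists_tiltMoment_risingRatio_approx (p : ℕ) {L : ℝ} (hL : 0 < L) :
    ∃ C : ℝ, 0 ≤ C ∧ ∀ (n : ℕ) (x : ℝ), 1 ≤ n → 0 ≤ x → x < 1 →
      |tiltMoment n (risingRatio L) p x - momentConst L p * (1 - x) ^ (-(L + p))| ≤
        C * (1 - x) ^ (-(L + p)) * ((1 - x) + 1 / (n * (1 - x))) := by
  obtain ⟨C, hC, h⟩ := exists_hasSum_moment p hL
  obtain ⟨C', hC', h'⟩ := exists_hasSum_moment (p + 1) hL
  have hK := momentConst_nonneg hL (p + 1)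
  refine ⟨C + (C' + momentConst L (p + 1)), by positivity, fun n x hn hx0 hx1 => ?_⟩
  obtain ⟨S, hS, hSb⟩ := h x hx0 hx1
  obtain ⟨S', hS', hSb'⟩ := h' x hx0 hx1
  have hτ : 0 < 1 - x := by linarith
  have hn' : (0 : ℝ) < n := by exact_mod_cast hn
  have e2 : (1 - x) ^ (-(L + ((p + 1 : ℕ) : ℝ))) = (1 - x) ^ (-(L + p)) / (1 - x) := by
    rw [eq_div_iff hτ.ne', mul_comm, ← Real.rpow_one_add' hτ.le]
    · congr 1; push_cast; ring
    · push_cast; intro h; have : (0 : ℝ) ≤ p := by positivity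
      linarith
  rw [e2] at hSb'
  set T := (1 - x) ^ (-(L + p))
  have hT : 0 ≤ T := (Real.rpow_pos_of_pos hτ _).le
  have hpos : ∀ q k : ℕ, 0 ≤ (k : ℝ) ^ q * risingRatio L k * x ^ k := fun q k => by
    have := risingRatio_pos hL k; positivity
  -- Beyond index `n` one has `k ^ p ≤ k ^ (p + 1) / n`, so the tail is at most the next full moment
  -- divided by `n`.
  have htail : S - tiltMoment n (risingRatio L) p x ≤ S' / n := by
    have h1 := (hasSum_nat_add_iff' (n + 1)).2 hS
    have h2 := (hasSum_nat_add_iff' (n + 1)).2 hS'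
    have h3 : HasSum (fun k : ℕ => ((k + (n + 1) : ℕ) : ℝ) ^ (p + 1) * risingRatio L (k + (n + 1)) *
        x ^ (k + (n + 1)) / n) ((S' - ∑ i ∈ Finset.range (n + 1),
          (i : ℝ) ^ (p + 1) * risingRatio L i * x ^ i) / n) := h2.div_const _
    have h4 := hasSum_le (fun k => ?_) h1 h3
    · refine h4.trans ?_
      gcongr
      have : 0 ≤ ∑ i ∈ Finset.range (n + 1), (i : ℝ) ^ (p + 1) * risingRatio L i * x ^ i :=
        Finset.sum_nonneg fun i _ => hpos _ _
      linarith
    · rw [le_div_iff₀ hn', pow_succ]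
      have h5 := hpos p (k + (n + 1))
      have h6 : (n : ℝ) ≤ ((k + (n + 1) : ℕ) : ℝ) := by push_cast; linarith [(Nat.cast_nonneg k : (0:ℝ) ≤ k)]
      nlinarith [mul_le_mul_of_nonneg_left h6 h5]
  have htail0 : tiltMoment n (risingRatio L) p x ≤ S := sum_le_hasSum _ (fun k _ => hpos _ _) hS
  have hS'b : S' ≤ (C' + momentConst L (p + 1)) * (T / (1 - x)) := by
    have h2 := (abs_le.1 hSb').2
    have h3 : C' * ((1 - x) * (T / (1 - x))) ≤ C' * (T / (1 - x)) := by
      gcongr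
      have : 0 ≤ T / (1 - x) := by positivity
      nlinarith
    linarith
  have h7 : S' / n ≤ (C' + momentConst L (p + 1)) * T * (1 / (n * (1 - x))) := by
    rw [div_le_iff₀ hn']
    refine hS'b.trans (le_of_eq ?_)
    field_simp
  have h8 : |tiltMoment n (risingRatio L) p x - momentConst L p * T| ≤
      C * ((1 - x) * T) + S' / n := by
    have := abs_le.1 hSb
    rw [abs_le]; constructor <;> linarith [this.1, this.2]
  refine h8.trans ?_
  have h9 : 0 ≤ (C' + momentConst L (p + 1)) * T * (1 - x) := by positivity
  have h10 : 0 ≤ C * T * (1 / (n * (1 - x))) := by positivity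
  nlinarith

/-- One step from `k + 1` to `k` changes the quotient by `|L - 1| r(k) / (k + 1)`, and `r(k) ≤ 2
r(n)` for `k ≥ n / 2` by `mul_risingRatio_mono`. The `j` steps add up. -/
theorem abs_risingRatio_sub_le {L : ℝ} (hL : 0 < L) {n j : ℕ} (hn : 1 ≤ n) (hj : 2 * j ≤ n) :
    |risingRatio L (n - j) - risingRatio L n| ≤ 4 * |L - 1| * risingRatio L n * (j / n) := by
  have hn' : (0 : ℝ) < n := by exact_mod_cast hn
  induction j with
  | zero => simp
  | succ j ih =>
    have h1 := ih (by omega)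
    obtain ⟨k, hk⟩ : ∃ k, n - j = k + 1 := ⟨n - j - 1, by omega⟩
    have hk' : n - (j + 1) = k := by omega
    rw [hk'] at *
    rw [hk] at h1
    have hkn : (n : ℝ) ≤ 2 * k := by
      have : n ≤ 2 * k := by omega
      exact_mod_cast this
    have hk0 : (0 : ℝ) < k := by linarith
    have h2 : |risingRatio L k - risingRatio L (k + 1)| ≤ 4 * |L - 1| * risingRatio L n * (1 / n) := by
      have e : risingRatio L k - risingRatio L (k + 1) = -((L - 1) * (risingRatio L k / (k + 1))) := by
        rw [risingRatio_succ]; field_simp; ring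
      have hr := risingRatio_pos hL k
      rw [e, abs_neg, abs_mul, abs_of_nonneg (show 0 ≤ risingRatio L k / ((k : ℝ) + 1) by positivity)]
      have h3 := mul_risingRatio_mono hL (show k ≤ n by omega)
      have h4 : risingRatio L k / (k + 1) ≤ 4 * risingRatio L n * (1 / n) := by
        have h5 : risingRatio L k ≤ 2 * risingRatio L n := by
          have hn2 := risingRatio_pos hL n
          by_contra hcon
          push Not at hcon
          nlinarith
        have hn2 := risingRatio_pos hL n
        rw [mul_one_div, div_le_div_iff₀ (by positivity) hn']
        nlinarith
      calc |L - 1| * (risingRatio L k / (k + 1)) ≤ |L - 1| * (4 * risingRatio L n * (1 / n)) := by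
            gcongr
        _ = _ := by ring
    have h6 := abs_sub_le (risingRatio L k) (risingRatio L (k + 1)) (risingRatio L n)
    refine h6.trans ((add_le_add h2 h1).trans (le_of_eq ?_))
    push_cast; ring

/-- Each step multiplies the ratio, which is at least `1`, by `1 + (L' - L) / (L + k)`; so it
dominates a multiple of the harmonic series. -/
theorem tendsto_risingRatio_div {L L' : ℝ} (hL : 0 < L) (h : L < L') :
    Filter.Tendsto (fun k => risingRatio L' k / risingRatio L k) Filter.atTop Filter.atTop := by
  set b := (L' - L) / (L + 1) with hb
  have hb0 : 0 < b := div_pos (by linarith) (by linarith)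
  have hsum := Real.tendsto_sum_range_one_div_nat_succ_atTop
  refine Filter.tendsto_atTop_mono (fun k => ?_) (hsum.const_mul_atTop hb0)
  induction k with
  | zero => simp [risingRatio_zero]
  | succ k ih =>
    rw [Finset.sum_range_succ, mul_add]
    have hr := risingRatio_pos hL k
    have hr' := risingRatio_pos (hL.trans h) k
    have e : risingRatio L' (k + 1) / risingRatio L (k + 1) =
        risingRatio L' k / risingRatio L k + risingRatio L' k / risingRatio L k *
          ((L' - L) / (L + k)) := by
      rw [risingRatio_succ, risingRatio_succ]; field_simp; ring
    rw [e]
    have h1 : 1 ≤ risingRatio L' k / risingRatio L k := by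
      rw [le_div_iff₀ hr, one_mul]; exact risingRatio_mono hL h.le k
    have h2 : b * (1 / ((k : ℝ) + 1)) ≤ (L' - L) / (L + k) := by
      rw [hb, div_mul_div_comm, mul_one]
      gcongr
      have : (0 : ℝ) ≤ k := by positivity
      nlinarith
    have h3 : 0 ≤ (L' - L) / (L + k) := div_nonneg (by linarith) (by positivity)
    nlinarith

/-! ### Generalized polynomials and their tilted moments for `x < 1` -/

namespace GenPoly

variable (h : GenPoly)

/-- The largest exponent `L_d`. -/
noncomputable def topExp : ℝ := h.L (Fin.last h.d)

theorem topExp_pos : 0 < h.topExp := h.L_pos _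

theorem le_topExp (j : Fin (h.d + 1)) : h.L j ≤ h.topExp := h.L_strictMono.monotone (Fin.le_last j)

theorem lt_topExp {j : Fin (h.d + 1)} (hj : j ≠ Fin.last h.d) : h.L j < h.topExp :=
  h.L_strictMono (lt_of_le_of_ne (Fin.le_last j) hj)

theorem eval_eq (k : ℕ) : h.eval k = ∑ j, h.α j * risingRatio (h.L j) k := rfl

theorem exists_abs_eval_le : ∃ C : ℝ, 0 ≤ C ∧ ∀ k, |h.eval k| ≤ C * risingRatio h.topExp k := by
  refine ⟨∑ j, |h.α j|, Finset.sum_nonneg fun j _ => abs_nonneg _, fun k => ?_⟩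
  rw [eval_eq, Finset.sum_mul]
  refine (Finset.abs_sum_le_sum_abs _ _).trans (Finset.sum_le_sum fun j _ => ?_)
  rw [abs_mul, abs_of_pos (risingRatio_pos (h.L_pos j) k)]
  exact mul_le_mul_of_nonneg_left (risingRatio_mono (h.L_pos j) (h.le_topExp j) k) (abs_nonneg _)

theorem tendsto_eval_div :
    Filter.Tendsto (fun k => h.eval k / risingRatio h.topExp k) Filter.atTop
      (nhds h.leadingCoeff) := by
  have h1 : ∀ j, Filter.Tendsto (fun k => h.α j * (risingRatio (h.L j) k / risingRatio h.topExp k))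
      Filter.atTop (nhds (if j = Fin.last h.d then h.leadingCoeff else 0)) := by
    intro j
    split_ifs with hj
    · subst hj
      have : ∀ k, h.α (Fin.last h.d) * (risingRatio (h.L (Fin.last h.d)) k /
          risingRatio h.topExp k) = h.leadingCoeff := fun k => by
        rw [topExp, div_self (risingRatio_pos (h.L_pos _) k).ne', mul_one, leadingCoeff]
      simp_rw [this]
      exact tendsto_const_nhds
    · have h2 := (tendsto_risingRatio_div (h.L_pos j) (h.lt_topExp hj)).inv_tendsto_atTop
      have h3 := h2.const_mul (h.α j)
      simpa using h3
  have h2 := tendsto_finsetSum Finset.univ fun j _ => h1 j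
  simp only [Finset.sum_ite_eq', Finset.mem_univ, if_true] at h2
  refine h2.congr fun k => ?_
  rw [eval_eq, Finset.sum_div]
  exact Finset.sum_congr rfl fun j _ => by rw [mul_div_assoc]

theorem exists_le_eval (hα : 0 < h.leadingCoeff) :
    ∃ k₁, ∀ k, k₁ ≤ k → h.leadingCoeff / 2 * risingRatio h.topExp k ≤ h.eval k := by
  have h1 := h.tendsto_eval_div.eventually (lt_mem_nhds (half_lt_self hα))
  obtain ⟨k₁, hk⟩ := Filter.eventually_atTop.1 h1
  refine ⟨k₁, fun k hkk => ?_⟩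
  have := hk k hkk
  rw [lt_div_iff₀ (risingRatio_pos h.topExp_pos k)] at this
  exact this.le

/-- This `ε` is a common relative order for the corrections as `x → 1`: the lower exponents, the
error `1 - x` of the leading term (hence `ε ≤ 1`), and a bounded change of the moments (hence `ε ≤
L_d`). -/
theorem exists_gap : ∃ ε : ℝ, 0 < ε ∧ ε ≤ 1 ∧ ε ≤ h.topExp ∧
    ∀ j, j ≠ Fin.last h.d → ε ≤ h.topExp - h.L j := by
  have hle : ∀ a : ℝ, 0 < a → ∀ᶠ ε in nhdsWithin (0 : ℝ) (Set.Ioi 0), ε ≤ a := fun a ha =>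
    nhdsWithin_le_nhds (Iic_mem_nhds ha)
  have hall : ∀ᶠ ε in nhdsWithin (0 : ℝ) (Set.Ioi 0), ∀ j, j ≠ Fin.last h.d →
      ε ≤ h.topExp - h.L j := by
    rw [Filter.eventually_all]
    intro j
    by_cases hj : j = Fin.last h.d
    · exact Filter.Eventually.of_forall fun ε hne => absurd hj hne
    · exact (hle _ (sub_pos.2 (h.lt_topExp hj))).mono fun ε hε _ => hε
  have hpos : ∀ᶠ ε in nhdsWithin (0 : ℝ) (Set.Ioi 0), 0 < ε := self_mem_nhdsWithin
  exact (hpos.and ((hle 1 one_pos).and ((hle _ h.topExp_pos).and hall))).exists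

/-- The values of `h`, with those below `k₀` replaced by `b`. -/
noncomputable def modWeight (k₀ : ℕ) (b : ℝ) (k : ℕ) : ℝ := if k < k₀ then b else h.eval k

variable {h}

theorem tiltMoment_eval (n p : ℕ) (x : ℝ) :
    tiltMoment n h.eval p x = ∑ j, h.α j * tiltMoment n (risingRatio (h.L j)) p x := by
  unfold tiltMoment
  simp_rw [eval_eq, Finset.mul_sum, Finset.sum_mul]
  rw [Finset.sum_comm]
  exact Finset.sum_congr rfl fun j _ => Finset.sum_congr rfl fun k _ => by ring

theorem exists_abs_tiltMoment_modWeight_sub_le (k₀ : ℕ) (b : ℝ) (p : ℕ) :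
    ∃ C : ℝ, 0 ≤ C ∧ ∀ (n : ℕ) (x : ℝ), 0 ≤ x → x < 1 →
      |tiltMoment n (h.modWeight k₀ b) p x - tiltMoment n h.eval p x| ≤ C := by
  refine ⟨∑ k ∈ Finset.range k₀, (k : ℝ) ^ p * |b - h.eval k|, by positivity,
    fun n x hx0 hx1 => ?_⟩
  unfold tiltMoment
  rw [← Finset.sum_sub_distrib]
  have h1 : ∀ k ∈ Finset.range (n + 1), |(k : ℝ) ^ p * h.modWeight k₀ b k * x ^ k -
      (k : ℝ) ^ p * h.eval k * x ^ k| ≤ if k < k₀ then (k : ℝ) ^ p * |b - h.eval k| else 0 := by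
    intro k _
    unfold modWeight
    split_ifs with hk
    · rw [← sub_mul, ← mul_sub, abs_mul, abs_mul, abs_of_nonneg (by positivity : (0 : ℝ) ≤ k ^ p),
        abs_of_nonneg (by positivity : (0 : ℝ) ≤ x ^ k)]
      exact mul_le_of_le_one_right (by positivity) (pow_le_one₀ hx0 hx1.le)
    · simp
  refine (Finset.abs_sum_le_sum_abs _ _).trans ((Finset.sum_le_sum h1).trans ?_)
  rw [← Finset.sum_filter]
  refine Finset.sum_le_sum_of_subset_of_nonneg (fun k hk => ?_) fun k _ _ => by positivity
  exact Finset.mem_range.2 (Finset.mem_filter.1 hk).2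

/-- Only the top exponent contributes at leading order. Lower exponents lose a factor `(1 - x) ^ ε`,
and altering finitely many weights changes the moment by a constant, so the value `b` is irrelevant.
-/
theorem exists_tiltMoment_modWeight_approx {ε : ℝ} (hε1 : ε ≤ 1)
    (hεL : ε ≤ h.topExp) (hεj : ∀ j, j ≠ Fin.last h.d → ε ≤ h.topExp - h.L j)
    (k₀ : ℕ) (b : ℝ) (p : ℕ) :
    ∃ C : ℝ, 0 ≤ C ∧ ∀ (n : ℕ) (x : ℝ), 1 ≤ n → 0 ≤ x → x < 1 →
      |tiltMoment n (h.modWeight k₀ b) p x -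
        h.leadingCoeff * momentConst h.topExp p * (1 - x) ^ (-(h.topExp + p))| ≤
      C * (1 - x) ^ (-(h.topExp + p)) * ((1 - x) ^ ε + 1 / (n * (1 - x))) := by
  obtain ⟨C₀, hC₀, h0⟩ := exists_abs_tiltMoment_modWeight_sub_le (h := h) k₀ b p
  have hj : ∀ j : Fin (h.d + 1), ∃ C : ℝ, 0 ≤ C ∧ ∀ (n : ℕ) (x : ℝ), 1 ≤ n → 0 ≤ x → x < 1 →
      |tiltMoment n (risingRatio (h.L j)) p x - (if j = Fin.last h.d then
        momentConst h.topExp p * (1 - x) ^ (-(h.topExp + p)) else 0)| ≤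
      C * (1 - x) ^ (-(h.topExp + p)) * ((1 - x) ^ ε + 1 / (n * (1 - x))) := by
    intro j
    split_ifs with hj
    · obtain ⟨C, hC, hb⟩ := exists_tiltMoment_risingRatio_approx p h.topExp_pos
      refine ⟨C, hC, fun n x hn hx0 hx1 => ?_⟩
      subst hj
      refine (hb n x hn hx0 hx1).trans ?_
      have hT := (Real.rpow_pos_of_pos (show 0 < 1 - x by linarith) (-(h.topExp + p))).le
      gcongr
      exact Real.self_le_rpow_of_le_one (by linarith) (by linarith) hε1
    · obtain ⟨C, hC, hb⟩ := exists_tiltMoment_risingRatio_le p (h.L_pos j)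
      refine ⟨C, hC, fun n x hn hx0 hx1 => ?_⟩
      have hτ : 0 < 1 - x := by linarith
      have hT := (Real.rpow_pos_of_pos hτ (-(h.topExp + p))).le
      have hnn : 0 ≤ tiltMoment n (risingRatio (h.L j)) p x :=
        tiltMoment_nonneg (fun k _ => (risingRatio_pos (h.L_pos j) k).le) p hx0
      rw [sub_zero, abs_of_nonneg hnn]
      refine (hb n x hx0 hx1).trans ?_
      rw [mul_assoc]
      refine mul_le_mul_of_nonneg_left ?_ hC
      rw [mul_add, ← Real.rpow_add hτ]
      have h1 : (1 - x) ^ (-(h.L j + p)) ≤ (1 - x) ^ (-(h.topExp + p) + ε) := by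
        apply Real.rpow_le_rpow_of_exponent_ge hτ (by linarith)
        have := hεj j hj
        linarith
      have h2 : 0 ≤ (1 - x) ^ (-(h.topExp + p)) * (1 / (n * (1 - x))) := by positivity
      linarith
  choose C hC hCb using hj
  refine ⟨C₀ + ∑ j, |h.α j| * C j, add_nonneg hC₀ (Finset.sum_nonneg fun j _ =>
    mul_nonneg (abs_nonneg _) (hC j)), fun n x hn hx0 hx1 => ?_⟩
  have hτ : 0 < 1 - x := by linarith
  set T := (1 - x) ^ (-(h.topExp + p)) with hT
  have hT0 : 0 < T := Real.rpow_pos_of_pos hτ _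
  set E := (1 - x) ^ ε + 1 / (n * (1 - x)) with hE
  have h1 : C₀ ≤ C₀ * T * E := by
    rw [mul_assoc]
    refine le_mul_of_one_le_right hC₀ ?_
    rw [hE, mul_add, hT, ← Real.rpow_add hτ]
    have h2 : 1 ≤ (1 - x) ^ (-(h.topExp + p) + ε) := by
      apply Real.one_le_rpow_of_pos_of_le_one_of_nonpos hτ (by linarith)
      have : (0 : ℝ) ≤ p := by positivity
      linarith
    have h3 : 0 ≤ (1 - x) ^ (-(h.topExp + p)) * (1 / (n * (1 - x))) := by positivity
    linarith
  have h2 : tiltMoment n h.eval p x - h.leadingCoeff * momentConst h.topExp p * T =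
      ∑ j, h.α j * (tiltMoment n (risingRatio (h.L j)) p x - (if j = Fin.last h.d then
        momentConst h.topExp p * T else 0)) := by
    simp_rw [mul_sub, Finset.sum_sub_distrib, mul_ite, mul_zero, Finset.sum_ite_eq',
      Finset.mem_univ, if_true]
    rw [tiltMoment_eval, leadingCoeff, mul_assoc]
  have h3 : |tiltMoment n h.eval p x - h.leadingCoeff * momentConst h.topExp p * T| ≤
      (∑ j, |h.α j| * C j) * T * E := by
    rw [h2, mul_assoc, Finset.sum_mul]
    refine (Finset.abs_sum_le_sum_abs _ _).trans (Finset.sum_le_sum fun j _ => ?_)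
    rw [abs_mul, mul_assoc, ← mul_assoc (C j)]
    exact mul_le_mul_of_nonneg_left (hCb j n x hn hx0 hx1) (abs_nonneg _)
  have h4 := abs_sub_le (tiltMoment n (h.modWeight k₀ b) p x) (tiltMoment n h.eval p x)
    (h.leadingCoeff * momentConst h.topExp p * T)
  have h5 := h0 n x hx0 hx1
  nlinarith

/-! ### Reversed weights, for the exterior of the unit disc -/

section Outer

variable {k₀ : ℕ} {b c : ℝ}

theorem eval_pos (hc : 0 < c) (hlow : ∀ k, k₀ ≤ k → c * risingRatio h.topExp k ≤ h.eval k)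
    {k : ℕ} (hk : k₀ ≤ k) : 0 < h.eval k :=
  lt_of_lt_of_le (mul_pos hc (risingRatio_pos h.topExp_pos k)) (hlow k hk)

theorem modWeight_nonneg (hc : 0 < c)
    (hlow : ∀ k, k₀ ≤ k → c * risingRatio h.topExp k ≤ h.eval k) (hb : 0 ≤ b) (k : ℕ) :
    0 ≤ h.modWeight k₀ b k := by
  unfold modWeight
  split_ifs with hk
  · exact hb
  · exact (eval_pos hc hlow (not_lt.1 hk)).le

theorem topExp_le_mul_risingRatio {n : ℕ} (hn : 1 ≤ n) :
    h.topExp ≤ n * risingRatio h.topExp n := by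
  have h1 := mul_risingRatio_mono h.topExp_pos hn
  rw [risingRatio_succ, risingRatio_zero] at h1
  simpa using h1

theorem exists_modWeight_le_mul_risingRatio (hb : 0 ≤ b) :
    ∃ C : ℝ, 0 ≤ C ∧ ∀ k, h.modWeight k₀ b k ≤ C * (risingRatio h.topExp k) := by
  obtain ⟨C, hC, hCb⟩ := h.exists_abs_eval_le
  refine ⟨C + ∑ k ∈ Finset.range k₀, b / risingRatio h.topExp k, ?_, fun k => ?_⟩
  · refine add_nonneg hC (Finset.sum_nonneg fun k _ => ?_)
    exact div_nonneg hb (risingRatio_pos h.topExp_pos k).le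
  · have hr := risingRatio_pos h.topExp_pos k
    have hs : ∀ k ∈ Finset.range k₀, 0 ≤ b / risingRatio h.topExp k := fun k _ =>
      div_nonneg hb (risingRatio_pos h.topExp_pos k).le
    unfold modWeight
    split_ifs with hk
    · have h1 := Finset.single_le_sum hs (Finset.mem_range.2 hk)
      rw [div_le_iff₀ hr] at h1
      nlinarith
    · have h1 := (le_abs_self _).trans (hCb k)
      have h2 := mul_nonneg (Finset.sum_nonneg hs) hr.le
      nlinarith

theorem exists_sum_modWeight_le (hc : 0 < c)
    (hlow : ∀ k, k₀ ≤ k → c * risingRatio h.topExp k ≤ h.eval k) (hb : 0 ≤ b) :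
    ∃ C : ℝ, 0 ≤ C ∧ ∀ n, k₀ ≤ n → 1 ≤ n →
      ∑ k ∈ Finset.range (n + 1), h.modWeight k₀ b k ≤ C * (n * h.eval n) := by
  obtain ⟨C, hC, hCb⟩ := exists_modWeight_le_mul_risingRatio (h := h) (k₀ := k₀) hb
  have hL := h.topExp_pos
  refine ⟨C * ((h.topExp + 1) / h.topExp / c), by positivity, fun n hn hn1 => ?_⟩
  have h1 : ∑ k ∈ Finset.range (n + 1), h.modWeight k₀ b k ≤ C * risingRatio (h.topExp + 1) n := by
    rw [← sum_risingRatio, Finset.mul_sum]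
    exact Finset.sum_le_sum fun k _ => hCb k
  refine h1.trans ?_
  rw [mul_assoc]
  refine mul_le_mul_of_nonneg_left ?_ hC
  have h2 := mul_risingRatio_add_one h.topExp n
  have h3 := hlow n hn
  have hn' : (1 : ℝ) ≤ n := by exact_mod_cast hn1
  have hr := risingRatio_pos h.topExp_pos n
  have h4 : risingRatio (h.topExp + 1) n ≤ (h.topExp + 1) / h.topExp * (n * risingRatio h.topExp n) := by
    rw [div_mul_eq_mul_div, le_div_iff₀ hL, mul_comm _ h.topExp, h2]
    have : h.topExp + n ≤ (h.topExp + 1) * n := by nlinarith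
    nlinarith
  refine h4.trans ?_
  rw [div_mul_eq_mul_div _ c, le_div_iff₀ hc, mul_assoc]
  refine mul_le_mul_of_nonneg_left ?_ (by positivity)
  nlinarith

/-- Slow variation near the top index. The condition `2 * k₀ ≤ n` keeps `n - j` at or above `k₀`,
where the modified weights are the values of `h`. -/
theorem exists_abs_modWeight_sub_le (hc : 0 < c)
    (hlow : ∀ k, k₀ ≤ k → c * risingRatio h.topExp k ≤ h.eval k) (b : ℝ) :
    ∃ C : ℝ, 0 ≤ C ∧ ∀ n j : ℕ, 2 * k₀ ≤ n → 1 ≤ n → 2 * j ≤ n →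
      |h.modWeight k₀ b (n - j) - h.eval n| ≤ C * h.eval n * (j / n) := by
  refine ⟨∑ i, |h.α i| * (4 * |h.L i - 1|) / c, Finset.sum_nonneg fun i _ => by positivity,
    fun n j hn hn1 hj => ?_⟩
  have h1 : h.modWeight k₀ b (n - j) = h.eval (n - j) := by
    unfold modWeight; rw [if_neg]; omega
  rw [h1, eval_eq, eval_eq, ← Finset.sum_sub_distrib, ← eval_eq, mul_assoc, Finset.sum_mul]
  refine (Finset.abs_sum_le_sum_abs _ _).trans (Finset.sum_le_sum fun i _ => ?_)
  rw [← mul_sub, abs_mul]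
  have h2 := abs_risingRatio_sub_le (h.L_pos i) hn1 hj
  have h3 := risingRatio_mono (h.L_pos i) (h.le_topExp i) n
  have h4 := hlow n (by omega)
  have h5 : risingRatio (h.L i) n ≤ h.eval n / c := by
    rw [le_div_iff₀ hc]; nlinarith
  calc |h.α i| * |risingRatio (h.L i) (n - j) - risingRatio (h.L i) n|
      ≤ |h.α i| * (4 * |h.L i - 1| * risingRatio (h.L i) n * (j / n)) := by gcongr
    _ ≤ |h.α i| * (4 * |h.L i - 1| * (h.eval n / c) * (j / n)) := by gcongr
    _ = _ := by ring

/-- A crude bound valid for every `j ≤ n`, unlike slow variation. It rests on `n ≤ (j + 1) (n - j)`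
for `j < n` and on `mul_risingRatio_mono`; the index `0`, reached when `j = n`, needs the term `1 /
L`. -/
theorem exists_modWeight_le_succ_mul (hc : 0 < c)
    (hlow : ∀ k, k₀ ≤ k → c * risingRatio h.topExp k ≤ h.eval k) (hb : 0 ≤ b) :
    ∃ C : ℝ, 0 ≤ C ∧ ∀ n j : ℕ, k₀ ≤ n → 1 ≤ n → j ≤ n →
      h.modWeight k₀ b (n - j) ≤ C * (j + 1) * h.eval n := by
  obtain ⟨C, hC, hCb⟩ := exists_modWeight_le_mul_risingRatio (h := h) (k₀ := k₀) hb
  have hL := h.topExp_pos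
  refine ⟨C * (1 + 1 / h.topExp) / c, by positivity, fun n j hn hn1 hj => ?_⟩
  refine (hCb (n - j)).trans ?_
  have hr := risingRatio_pos h.topExp_pos n
  have h3 := hlow n hn
  have h5 : risingRatio h.topExp n ≤ h.eval n / c := by
    rw [le_div_iff₀ hc]; nlinarith
  have h4 : risingRatio h.topExp (n - j) ≤ (1 + 1 / h.topExp) * (j + 1) * risingRatio h.topExp n := by
    rcases Nat.lt_or_ge j n with hjn | hjn
    · obtain ⟨k, rfl⟩ : ∃ k, n = k + 1 + j := ⟨n - j - 1, by omega⟩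
      have h1 := mul_risingRatio_mono h.topExp_pos (show k + 1 ≤ k + 1 + j by omega)
      rw [Nat.add_sub_cancel]
      have h6 := risingRatio_pos h.topExp_pos (k + 1)
      have h7 : risingRatio h.topExp (k + 1) ≤ (j + 1) * risingRatio h.topExp (k + 1 + j) := by
        have hk : (0 : ℝ) < (k : ℝ) + 1 := by positivity
        push_cast at h1
        have h8 : ((k : ℝ) + 1 + j) ≤ (k + 1) * (j + 1) := by
          have : (0 : ℝ) ≤ k := by positivity
          have : (0 : ℝ) ≤ j := by positivity
          nlinarith
        have h9 : ((k : ℝ) + 1) * risingRatio h.topExp (k + 1) ≤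
            (k + 1) * ((j + 1) * risingRatio h.topExp (k + 1 + j)) := by
          refine h1.trans ?_
          rw [← mul_assoc]
          exact mul_le_mul_of_nonneg_right h8 hr.le
        exact le_of_mul_le_mul_left h9 hk
      refine h7.trans ?_
      have : 0 ≤ 1 / h.topExp * ((j + 1) * risingRatio h.topExp (k + 1 + j)) := by positivity
      nlinarith
    · have : n = j := le_antisymm hjn hj
      subst this
      rw [Nat.sub_self, risingRatio_zero]
      have h1 := topExp_le_mul_risingRatio (h := h) hn1
      have h2 : 1 ≤ 1 / h.topExp * (n * risingRatio h.topExp n) := by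
        rw [one_div_mul_eq_div, le_div_iff₀ hL]; linarith
      have : 0 ≤ 1 / h.topExp * risingRatio h.topExp n := by positivity
      have : 0 ≤ (n : ℝ) * risingRatio h.topExp n := by positivity
      nlinarith
  calc C * risingRatio h.topExp (n - j)
      ≤ C * ((1 + 1 / h.topExp) * (j + 1) * risingRatio h.topExp n) := by gcongr
    _ ≤ C * ((1 + 1 / h.topExp) * (j + 1) * (h.eval n / c)) := by gcongr
    _ = _ := by ring

/-- Combine `x ≤ exp (-(1 - x))` with `y ^ q / q! ≤ exp y` at `y = j (1 - x)`. -/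
theorem _root_.pow_mul_pow_le_factorial_div (q j : ℕ) {x : ℝ} (hx0 : 0 ≤ x) (hx1 : x < 1) :
    (j : ℝ) ^ q * x ^ j ≤ q.factorial / (1 - x) ^ q := by
  have hτ : 0 < 1 - x := by linarith
  rw [le_div_iff₀ (by positivity)]
  have h1 : x ^ j ≤ Real.exp (-(j * (1 - x))) := by
    have := Real.add_one_le_exp (-(1 - x))
    calc x ^ j ≤ (Real.exp (-(1 - x))) ^ j := by gcongr; linarith
      _ = _ := by rw [← Real.exp_nat_mul]; ring_nf
  have h2 := Real.pow_div_factorial_le_exp (x := j * (1 - x)) (by positivity) q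
  rw [div_le_iff₀ (by positivity)] at h2
  calc (j : ℝ) ^ q * x ^ j * (1 - x) ^ q = (j * (1 - x)) ^ q * x ^ j := by rw [mul_pow]; ring
    _ ≤ (Real.exp (j * (1 - x)) * q.factorial) * Real.exp (-(j * (1 - x))) := by gcongr
    _ = q.factorial * (Real.exp (j * (1 - x)) * Real.exp (-(j * (1 - x)))) := by ring
    _ = _ := by rw [← Real.exp_add]; simp

/-- The reversed weights are compared with the constant `h(n)`, that is with exponent `1`. For `j ≤
n / 2` slow variation costs a factor `j / n`, that is one more moment divided by `n`. For `j > n /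
2` the factor `4 j ^ 2 / n ^ 2 ≥ 1` is inserted, `j ^ (p + 2) x ^ j` is bounded uniformly, and the
total mass `O(n h(n))` leaves the same error `1 / (n (1 - x))`. -/
theorem exists_tiltMoment_reverse_approx (hc : 0 < c)
    (hlow : ∀ k, k₀ ≤ k → c * risingRatio h.topExp k ≤ h.eval k) (hb : 0 ≤ b) (p : ℕ) :
    ∃ C : ℝ, 0 ≤ C ∧ ∀ (n : ℕ) (x : ℝ), 2 * k₀ ≤ n → 1 ≤ n → 0 ≤ x → x < 1 →
      |tiltMoment n (fun j => h.modWeight k₀ b (n - j)) p x -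
        h.eval n * momentConst 1 p * (1 - x) ^ (-((1 : ℝ) + p))| ≤
      C * (h.eval n * (1 - x) ^ (-((1 : ℝ) + p))) * ((1 - x) + 1 / (n * (1 - x))) := by
  obtain ⟨C₁, hC₁, h1⟩ := exists_tiltMoment_risingRatio_approx p one_pos
  obtain ⟨C₂, hC₂, h2⟩ := exists_tiltMoment_risingRatio_le (p + 1) one_pos
  obtain ⟨C₃, hC₃, h3⟩ := exists_abs_modWeight_sub_le hc hlow b
  obtain ⟨C₄, hC₄, h4⟩ := exists_sum_modWeight_le hc hlow hb
  refine ⟨C₁ + (C₃ + 2) * C₂ + 4 * (p + 2).factorial * C₄, by positivity,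
    fun n x hn hn1 hx0 hx1 => ?_⟩
  have hτ : 0 < 1 - x := by linarith
  have hn' : (0 : ℝ) < n := by exact_mod_cast hn1
  have hH : 0 < h.eval n := eval_pos hc hlow (by omega)
  set T := (1 - x) ^ (-((1 : ℝ) + p)) with hT
  have hT0 : 0 < T := Real.rpow_pos_of_pos hτ _
  have hTs : (1 - x) ^ (-((1 : ℝ) + ((p + 1 : ℕ) : ℝ))) = T / (1 - x) := by
    rw [eq_div_iff hτ.ne', mul_comm, ← Real.rpow_one_add' hτ.le]
    · rw [hT]; congr 1; push_cast; ring
    · push_cast; intro h; have : (0 : ℝ) ≤ p := by positivity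
      linarith
  have hTp : 1 / (1 - x) ^ (p + 2) = T / (1 - x) := by
    rw [← hTs, Real.rpow_neg hτ.le, ← one_div, ← Real.rpow_natCast]
    congr 2; push_cast; ring
  set F := 1 / (n * (1 - x)) with hF
  have hF0 : 0 ≤ F := by positivity
  have e1 : |tiltMoment n (risingRatio 1) p x - momentConst 1 p * T| ≤ C₁ * T * ((1 - x) + F) :=
    h1 n x hn1 hx0 hx1
  have e2 : tiltMoment n (risingRatio 1) (p + 1) x ≤ C₂ * (T / (1 - x)) := by
    rw [← hTs]; exact h2 n x hx0 hx1
  have e3 : |tiltMoment n (fun j => h.modWeight k₀ b (n - j)) p x -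
      h.eval n * tiltMoment n (risingRatio 1) p x| ≤
      (C₃ + 2) * h.eval n / n * tiltMoment n (risingRatio 1) (p + 1) x +
      4 / n ^ 2 * ((p + 2).factorial * (T / (1 - x))) *
        ∑ k ∈ Finset.range (n + 1), h.modWeight k₀ b k := by
    rw [← Finset.sum_range_reflect (fun k => h.modWeight k₀ b k) (n + 1)]
    unfold tiltMoment
    simp_rw [risingRatio_one, mul_one]
    rw [Finset.mul_sum, Finset.mul_sum, Finset.mul_sum, ← Finset.sum_sub_distrib,
      ← Finset.sum_add_distrib]
    refine (Finset.abs_sum_le_sum_abs _ _).trans (Finset.sum_le_sum fun j hj => ?_)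
    have hjn : j ≤ n := Nat.lt_succ_iff.1 (Finset.mem_range.1 hj)
    rw [show n + 1 - 1 - j = n - j by omega]
    set v := h.modWeight k₀ b (n - j) with hv
    have hv0 : 0 ≤ v := modWeight_nonneg hc hlow hb _
    have hxj : 0 ≤ x ^ j := by positivity
    have ee : (j : ℝ) ^ p * v * x ^ j - h.eval n * (j ^ p * x ^ j) =
        (v - h.eval n) * (j ^ p * x ^ j) := by ring
    rw [ee, abs_mul, abs_of_nonneg (show 0 ≤ (j : ℝ) ^ p * x ^ j by positivity)]
    have hsec : 0 ≤ 4 / (n : ℝ) ^ 2 * ((p + 2).factorial * (T / (1 - x))) * v := by positivity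
    by_cases hj2 : 2 * j ≤ n
    · have h5 := h3 n j hn hn1 hj2
      have h6 : |v - h.eval n| * (j ^ p * x ^ j) ≤ C₃ * h.eval n * (j / n) * (j ^ p * x ^ j) := by
        gcongr
      have h7 : C₃ * h.eval n * (j / n) * (j ^ p * x ^ j) ≤
          (C₃ + 2) * h.eval n / n * (j ^ (p + 1) * x ^ j) := by
        have : (C₃ + 2) * h.eval n / n * (j ^ (p + 1) * x ^ j) =
          C₃ * h.eval n * (j / n) * (j ^ p * x ^ j) + 2 * h.eval n * (j / n) * (j ^ p * x ^ j) := by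
          rw [pow_succ]; field_simp
        rw [this]
        have : 0 ≤ 2 * h.eval n * (j / n) * (j ^ p * x ^ j) := by positivity
        linarith
      linarith
    · have hjr : (n : ℝ) ≤ 2 * j := by
        have : n ≤ 2 * j := by omega
        exact_mod_cast this
      have h5 : |v - h.eval n| ≤ h.eval n + v := by
        rw [abs_le]; constructor <;> linarith
      have h6 : h.eval n * (j ^ p * x ^ j) ≤ (C₃ + 2) * h.eval n / n * (j ^ (p + 1) * x ^ j) := by
        have h8 : 1 ≤ 2 * (j : ℝ) / n := by rw [le_div_iff₀ hn']; linarith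
        have : (C₃ + 2) * h.eval n / n * (j ^ (p + 1) * x ^ j) =
          (h.eval n * (j ^ p * x ^ j)) * (2 * j / n) + C₃ * h.eval n * (j / n) * (j ^ p * x ^ j) := by
          rw [pow_succ]; field_simp; ring
        rw [this]
        have h9 : 0 ≤ C₃ * h.eval n * (j / n) * (j ^ p * x ^ j) := by positivity
        have h10 : 0 ≤ h.eval n * (j ^ p * x ^ j) := by positivity
        nlinarith
      have h7 : v * (j ^ p * x ^ j) ≤ 4 / n ^ 2 * ((p + 2).factorial * (T / (1 - x))) * v := by
        have h8 := pow_mul_pow_le_factorial_div (p + 2) j hx0 hx1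
        rw [← mul_one_div, hTp] at h8
        have h9 : (j : ℝ) ^ p * x ^ j ≤ 4 / n ^ 2 * (j ^ (p + 2) * x ^ j) := by
          have h10 : 1 ≤ 4 / (n : ℝ) ^ 2 * j ^ 2 := by
            rw [div_mul_eq_mul_div, le_div_iff₀ (by positivity)]; nlinarith
          have h11 : 0 ≤ (j : ℝ) ^ p * x ^ j := by positivity
          calc (j : ℝ) ^ p * x ^ j ≤ (j ^ p * x ^ j) * (4 / (n : ℝ) ^ 2 * j ^ 2) :=
                le_mul_of_one_le_right h11 h10
            _ = _ := by ring
        rw [mul_comm v]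
        refine mul_le_mul_of_nonneg_right (h9.trans ?_) hv0
        gcongr
      have h8 : |v - h.eval n| * (j ^ p * x ^ j) ≤ (h.eval n + v) * (j ^ p * x ^ j) := by gcongr
      rw [add_mul] at h8
      linarith
  have e4 := h4 n (by omega) hn1
  have e5 : (C₃ + 2) * h.eval n / n * tiltMoment n (risingRatio 1) (p + 1) x ≤
      (C₃ + 2) * C₂ * (h.eval n * T) * F := by
    calc _ ≤ (C₃ + 2) * h.eval n / n * (C₂ * (T / (1 - x))) := by gcongr
      _ = _ := by rw [hF]; field_simp
  have e6 : 4 / (n : ℝ) ^ 2 * ((p + 2).factorial * (T / (1 - x))) *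
        ∑ k ∈ Finset.range (n + 1), h.modWeight k₀ b k ≤
      4 * (p + 2).factorial * C₄ * (h.eval n * T) * F := by
    calc _ ≤ 4 / (n : ℝ) ^ 2 * ((p + 2).factorial * (T / (1 - x))) * (C₄ * (n * h.eval n)) := by
          gcongr
      _ = _ := by rw [hF]; field_simp
  have e7 : |h.eval n * tiltMoment n (risingRatio 1) p x - h.eval n * momentConst 1 p * T| ≤
      C₁ * (h.eval n * T) * ((1 - x) + F) := by
    rw [mul_assoc, ← mul_sub, abs_mul, abs_of_pos hH]
    calc _ ≤ h.eval n * (C₁ * T * ((1 - x) + F)) := by gcongr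
      _ = _ := by ring
  have e8 := abs_sub_le (tiltMoment n (fun j => h.modWeight k₀ b (n - j)) p x)
    (h.eval n * tiltMoment n (risingRatio 1) p x) (h.eval n * momentConst 1 p * T)
  have e9 : 0 ≤ ((C₃ + 2) * C₂ + 4 * (p + 2).factorial * C₄) * (h.eval n * T) * (1 - x) := by
    positivity
  calc _ ≤ ((C₃ + 2) * C₂ * (h.eval n * T) * F + 4 * (p + 2).factorial * C₄ * (h.eval n * T) * F)
        + C₁ * (h.eval n * T) * ((1 - x) + F) := by linarith
    _ ≤ _ := by
      have : (C₁ + (C₃ + 2) * C₂ + 4 * (p + 2).factorial * C₄) * (h.eval n * T) * ((1 - x) + F) =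
        ((C₃ + 2) * C₂ * (h.eval n * T) * F + 4 * (p + 2).factorial * C₄ * (h.eval n * T) * F)
        + C₁ * (h.eval n * T) * ((1 - x) + F) +
        ((C₃ + 2) * C₂ + 4 * (p + 2).factorial * C₄) * (h.eval n * T) * (1 - x) := by ring
      linarith

end Outer

end GenPoly

/-! ### Asymptotics of the standard deviation near the unit circle -/

/-- A quotient whose value is the standard deviation `tiltStd n v x` when both weights are `v`. -/
noncomputable def tiltQuot (n : ℕ) (v₁ v₂ : ℕ → ℝ) (x : ℝ) : ℝ :=
  √(tiltSpread n v₁ x / 2) / tiltMoment n v₂ 0 x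

theorem tiltSpread_half_eq (n : ℕ) (v : ℕ → ℝ) (x : ℝ) :
    tiltSpread n v x / 2 = tiltMoment n v 0 x * tiltMoment n v 2 x - tiltMoment n v 1 x ^ 2 := by
  have h1 : tiltMoment n v 2 x = ∑ k ∈ Finset.range (n + 1), ((k : ℝ) - 0) ^ 2 * (v k * x ^ k) :=
    Finset.sum_congr rfl fun k _ => by ring
  have h2 : tiltMoment n v 1 x = ∑ k ∈ Finset.range (n + 1), ((k : ℝ) - 0) * (v k * x ^ k) :=
    Finset.sum_congr rfl fun k _ => by ring
  rw [tiltSpread_eq n v x 0, h1, h2]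
  ring

theorem tiltMoment_zero_inv (n : ℕ) (v : ℕ → ℝ) {x : ℝ} (hx : x ≠ 0) :
    tiltMoment n v 0 x⁻¹ * x ^ n = tiltMoment n (fun j => v (n - j)) 0 x := by
  unfold tiltMoment
  rw [Finset.sum_mul, ← Finset.sum_range_reflect]
  refine Finset.sum_congr rfl fun j hj => ?_
  have hjn : j ≤ n := Nat.lt_succ_iff.1 (Finset.mem_range.1 hj)
  obtain ⟨k, rfl⟩ := Nat.exists_eq_add_of_le hjn
  beta_reduce
  rw [show j + k + 1 - 1 - j = k by omega, show j + k - j = k by omega, pow_add, inv_pow]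
  field_simp

theorem tiltSpread_inv (n : ℕ) (v : ℕ → ℝ) {x : ℝ} (hx : x ≠ 0) :
    tiltSpread n v x⁻¹ * (x ^ n) ^ 2 = tiltSpread n (fun j => v (n - j)) x := by
  unfold tiltSpread
  rw [Finset.sum_mul, ← Finset.sum_range_reflect]
  refine Finset.sum_congr rfl fun i hi => ?_
  rw [Finset.sum_mul, ← Finset.sum_range_reflect]
  refine Finset.sum_congr rfl fun j hj => ?_
  have hin : i ≤ n := Nat.lt_succ_iff.1 (Finset.mem_range.1 hi)
  have hjn : j ≤ n := Nat.lt_succ_iff.1 (Finset.mem_range.1 hj)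
  rw [show n + 1 - 1 - i = n - i by omega, show n + 1 - 1 - j = n - j by omega,
    Nat.cast_sub hin, Nat.cast_sub hjn, inv_pow, inv_pow]
  have e1 : (x ^ (n - i))⁻¹ = x ^ i / x ^ n := by
    rw [eq_div_iff (pow_ne_zero _ hx), inv_mul_eq_iff_eq_mul₀ (pow_ne_zero _ hx), ← pow_add]
    congr 1; omega
  have e2 : (x ^ (n - j))⁻¹ = x ^ j / x ^ n := by
    rw [eq_div_iff (pow_ne_zero _ hx), inv_mul_eq_iff_eq_mul₀ (pow_ne_zero _ hx), ← pow_add]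
    congr 1; omega
  rw [e1, e2]
  field_simp
  ring

/-- Inversion of `x` reverses the order of the weights, which brings the exterior of the unit disc
to its interior. -/
theorem tiltQuot_inv (n : ℕ) (v₁ v₂ : ℕ → ℝ) {x : ℝ} (hx : 0 < x) :
    tiltQuot n v₁ v₂ x⁻¹ = tiltQuot n (fun j => v₁ (n - j)) (fun j => v₂ (n - j)) x := by
  unfold tiltQuot
  rw [← tiltSpread_inv n v₁ hx.ne', ← tiltMoment_zero_inv n v₂ hx.ne', mul_div_right_comm,
    Real.sqrt_mul' _ (by positivity), Real.sqrt_sq (by positivity),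
    mul_div_mul_right _ _ (by positivity)]

/-- After scaling by `S` and powers of `τ` the moments are within `C η` of `1`, `c₁`, `c₂`, so the
variance is within `O(η)` of `lam`. As `lam > 0`, the square root preserves this order; a negative
radicand does no harm, its square root being `0`. -/
theorem exists_sqrt_div_approx {c₁ c₂ lam C : ℝ} (hlam : 0 < lam) (hc : c₂ - c₁ ^ 2 = lam)
    (hC : 0 ≤ C) : ∃ C' η₀ : ℝ, 0 ≤ C' ∧ 0 < η₀ ∧ ∀ S τ η M₀ M₁ M₂ Z : ℝ, 0 < S → 0 < τ → 0 ≤ η →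
      η ≤ η₀ → |M₀ - S| ≤ C * S * η → |M₁ - S * c₁ / τ| ≤ C * (S / τ) * η →
      |M₂ - S * c₂ / τ ^ 2| ≤ C * (S / τ ^ 2) * η → |Z - S| ≤ C * S * η →
      |√(M₀ * M₂ - M₁ ^ 2) / Z - √lam / τ| ≤ C' * (η / τ) := by
  have hsl : 0 < √lam := Real.sqrt_pos.2 hlam
  set K := C * (|c₂| + 1 + 1 + (2 * |c₁| + 1)) with hK
  have hK0 : 0 ≤ K := by positivity
  -- The threshold gives `C η ≤ 1 / 2`, which keeps the normalized denominator at least `1 / 2`.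
  refine ⟨2 * (K / √lam + √lam * C), 1 / (2 * (C + 1)), by positivity, by positivity, ?_⟩
  intro S τ η M₀ M₁ M₂ Z hS hτ hη hη0 h0 h1 h2 hZ
  set m₀ := M₀ / S with hm0
  set m₁ := M₁ * τ / S with hm1
  set m₂ := M₂ * τ ^ 2 / S with hm2
  set z := Z / S with hz
  have hCη : C * η ≤ 1 / 2 := by
    rw [le_div_iff₀ (by positivity)] at hη0
    nlinarith
  have e0 : |m₀ - 1| ≤ C * η := by
    have : m₀ - 1 = (M₀ - S) / S := by rw [hm0]; field_simp
    rw [this, abs_div, abs_of_pos hS, div_le_iff₀ hS]; linarith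
  have ez : |z - 1| ≤ C * η := by
    have : z - 1 = (Z - S) / S := by rw [hz]; field_simp
    rw [this, abs_div, abs_of_pos hS, div_le_iff₀ hS]; linarith
  have e1 : |m₁ - c₁| ≤ C * η := by
    have : m₁ - c₁ = (M₁ - S * c₁ / τ) * (τ / S) := by rw [hm1]; field_simp
    rw [this, abs_mul, abs_of_pos (div_pos hτ hS)]
    calc _ ≤ C * (S / τ) * η * (τ / S) := by gcongr
      _ = _ := by field_simp
  have e2 : |m₂ - c₂| ≤ C * η := by
    have : m₂ - c₂ = (M₂ - S * c₂ / τ ^ 2) * (τ ^ 2 / S) := by rw [hm2]; field_simp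
    rw [this, abs_mul, abs_of_pos (div_pos (pow_pos hτ 2) hS)]
    calc _ ≤ C * (S / τ ^ 2) * η * (τ ^ 2 / S) := by gcongr
      _ = _ := by field_simp
  set D := m₀ * m₂ - m₁ ^ 2 with hD
  have hDl : |D - lam| ≤ K * η := by
    have e : D - lam = (m₀ - 1) * (m₂ - c₂) + (m₀ - 1) * c₂ + (m₂ - c₂) -
        (m₁ - c₁) * ((m₁ - c₁) + 2 * c₁) := by rw [hD, ← hc]; ring
    have f1 : |(m₀ - 1) * (m₂ - c₂)| ≤ C * η * 1 := by
      rw [abs_mul]; exact mul_le_mul e0 (by linarith) (abs_nonneg _) (by positivity)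
    have f2 : |(m₀ - 1) * c₂| ≤ C * η * |c₂| := by
      rw [abs_mul]; gcongr
    have f3 : |(m₁ - c₁) * ((m₁ - c₁) + 2 * c₁)| ≤ C * η * (1 + 2 * |c₁|) := by
      rw [abs_mul]
      refine mul_le_mul e1 ?_ (abs_nonneg _) (by positivity)
      refine (abs_add_le _ _).trans ?_
      rw [abs_mul, abs_two]; linarith
    rw [e]
    calc _ ≤ |(m₀ - 1) * (m₂ - c₂)| + |(m₀ - 1) * c₂| + |m₂ - c₂| +
          |(m₁ - c₁) * ((m₁ - c₁) + 2 * c₁)| :=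
          (abs_sub _ _).trans (add_le_add_left ((abs_add_le _ _).trans
            (add_le_add_left (abs_add_le _ _) _)) _)
      _ ≤ C * η * 1 + C * η * |c₂| + C * η + C * η * (1 + 2 * |c₁|) := by gcongr
      _ = _ := by rw [hK]; ring
  have hsq : |√D - √lam| ≤ K * η / √lam := by
    rw [le_div_iff₀ hsl]
    refine le_trans ?_ hDl
    rcases le_or_gt 0 D with hD0 | hD0
    · have e : D - lam = (√D - √lam) * (√D + √lam) := by
        have a1 := Real.mul_self_sqrt hD0
        have a2 := Real.mul_self_sqrt hlam.le
        linear_combination -a1 + a2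
      rw [e, abs_mul]
      refine mul_le_mul_of_nonneg_left ?_ (abs_nonneg _)
      have := Real.sqrt_nonneg D
      rw [abs_of_nonneg (by linarith)]; linarith
    · rw [Real.sqrt_eq_zero_of_nonpos hD0.le, zero_sub, abs_neg, abs_of_pos hsl,
        Real.mul_self_sqrt hlam.le, abs_of_neg (by linarith)]
      linarith
  have hz2 : 1 / 2 ≤ z := by have := (abs_le.1 ez).1; linarith
  have hquot : √(M₀ * M₂ - M₁ ^ 2) / Z = √D / z / τ := by
    have : M₀ * M₂ - M₁ ^ 2 = D * (S / τ) ^ 2 := by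
      rw [hD, hm0, hm1, hm2]; field_simp
    rw [this, Real.sqrt_mul' _ (by positivity), Real.sqrt_sq (by positivity), hz]
    field_simp
  have hz0 : 0 < z := by linarith
  have hfin : |√D / z - √lam| ≤ 2 * (K / √lam + √lam * C) * η := by
    have e : √D / z - √lam = ((√D - √lam) - √lam * (z - 1)) / z := by field_simp; ring
    rw [e, abs_div, abs_of_pos hz0, div_le_iff₀ hz0]
    have f1 : |√lam * (z - 1)| ≤ √lam * (C * η) := by
      rw [abs_mul, abs_of_pos hsl]; gcongr
    have f2 : |(√D - √lam) - √lam * (z - 1)| ≤ K * η / √lam + √lam * (C * η) :=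
      (abs_sub _ _).trans (add_le_add hsq f1)
    have f3 : K * η / √lam + √lam * (C * η) = (K / √lam + √lam * C) * η := by ring
    rw [f3] at f2
    have f4 : 0 ≤ (K / √lam + √lam * C) * η := by positivity
    nlinarith
  rw [hquot, ← sub_div, abs_div, abs_of_pos hτ, div_le_iff₀ hτ]
  refine hfin.trans (le_of_eq ?_)
  field_simp

namespace GenPoly

variable {h : GenPoly} {k₀ : ℕ} {c ε : ℝ}

/-- The limiting law is negative binomial with exponent `L`: normalized moments `L` and `L (L + 1)`,
variance `L`. -/
theorem exists_tiltQuot_inner (hα : 0 < h.leadingCoeff) (hε1 : ε ≤ 1)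
    (hεL : ε ≤ h.topExp) (hεj : ∀ j, j ≠ Fin.last h.d → ε ≤ h.topExp - h.L j) (k₀ : ℕ) (b₁ b₂ : ℝ) :
    ∃ C η₀ : ℝ, 0 ≤ C ∧ 0 < η₀ ∧ ∀ (n : ℕ) (x : ℝ), 1 ≤ n → 0 ≤ x → x < 1 →
      (1 - x) ^ ε + 1 / (n * (1 - x)) ≤ η₀ →
      |tiltQuot n (h.modWeight k₀ b₁) (h.modWeight k₀ b₂) x - √h.topExp / (1 - x)| ≤
        C * (((1 - x) ^ ε + 1 / (n * (1 - x))) / (1 - x)) := by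
  have hL := h.topExp_pos
  obtain ⟨C₀, hC₀, H0⟩ := exists_tiltMoment_modWeight_approx hε1 hεL hεj k₀ b₁ 0
  obtain ⟨C₁, hC₁, H1⟩ := exists_tiltMoment_modWeight_approx hε1 hεL hεj k₀ b₁ 1
  obtain ⟨C₂, hC₂, H2⟩ := exists_tiltMoment_modWeight_approx hε1 hεL hεj k₀ b₁ 2
  obtain ⟨C₃, hC₃, H3⟩ := exists_tiltMoment_modWeight_approx hε1 hεL hεj k₀ b₂ 0
  obtain ⟨C', η₀, hC', hη₀, H⟩ := exists_sqrt_div_approx (c₁ := h.topExp)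
    (c₂ := h.topExp * (h.topExp + 1)) (lam := h.topExp)
    (C := (C₀ + C₁ + C₂ + C₃) / h.leadingCoeff) hL (by ring) (by positivity)
  refine ⟨C', η₀, hC', hη₀, fun n x hn hx0 hx1 hη => ?_⟩
  have hτ : 0 < 1 - x := by linarith
  set η := (1 - x) ^ ε + 1 / (n * (1 - x)) with hηdef
  have hη0 : 0 ≤ η := add_nonneg (Real.rpow_pos_of_pos hτ _).le (by positivity)
  set T := (1 - x) ^ (-h.topExp) with hT
  have hT0 : 0 < T := Real.rpow_pos_of_pos hτ _
  have hTp : ∀ p : ℕ, (1 - x) ^ (-(h.topExp + p)) = T / (1 - x) ^ p := fun p => by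
    rw [neg_add, Real.rpow_add hτ, Real.rpow_neg hτ.le (p : ℝ), Real.rpow_natCast, div_eq_mul_inv]
  have g0 := H0 n x hn hx0 hx1
  have g1 := H1 n x hn hx0 hx1
  have g2 := H2 n x hn hx0 hx1
  have g3 := H3 n x hn hx0 hx1
  rw [hTp] at g0 g1 g2 g3
  rw [← hηdef] at g0 g1 g2 g3
  simp only [momentConst, Finset.prod_range_succ, Finset.prod_range_zero, pow_zero, pow_one,
    Nat.cast_zero, Nat.cast_one, add_zero, one_mul, mul_one, div_one] at g0 g1 g2 g3
  have hα' := hα.ne'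
  unfold tiltQuot
  rw [tiltSpread_half_eq]
  refine H (h.leadingCoeff * T) (1 - x) η _ _ _ _ (by positivity) hτ hη0 hη (g0.trans ?_) ?_ ?_
    (g3.trans ?_)
  · rw [div_mul_eq_mul_div, div_mul_eq_mul_div, le_div_iff₀ hα]
    have : 0 ≤ (C₁ + C₂ + C₃) * (h.leadingCoeff * T) * η := by positivity
    linarith
  · rw [show h.leadingCoeff * T * h.topExp / (1 - x) = h.leadingCoeff * h.topExp * (T / (1 - x)) by
      ring]
    refine g1.trans ?_
    rw [div_mul_eq_mul_div, div_mul_eq_mul_div, le_div_iff₀ hα]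
    have : 0 ≤ (C₀ + C₂ + C₃) * (h.leadingCoeff * (T / (1 - x))) * η := by positivity
    linarith [show (C₀ + C₁ + C₂ + C₃) * (h.leadingCoeff * T / (1 - x)) * η =
      (C₀ + C₂ + C₃) * (h.leadingCoeff * (T / (1 - x))) * η +
      C₁ * (T / (1 - x)) * η * h.leadingCoeff by ring]
  · rw [show h.leadingCoeff * T * (h.topExp * (h.topExp + 1)) / (1 - x) ^ 2 =
      h.leadingCoeff * (h.topExp * (h.topExp + 1)) * (T / (1 - x) ^ 2) by ring]
    refine g2.trans ?_
    rw [div_mul_eq_mul_div, div_mul_eq_mul_div, le_div_iff₀ hα]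
    have : 0 ≤ (C₀ + C₁ + C₃) * (h.leadingCoeff * (T / (1 - x) ^ 2)) * η := by positivity
    linarith [show (C₀ + C₁ + C₂ + C₃) * (h.leadingCoeff * T / (1 - x) ^ 2) * η =
      (C₀ + C₁ + C₃) * (h.leadingCoeff * (T / (1 - x) ^ 2)) * η +
      C₂ * (T / (1 - x) ^ 2) * η * h.leadingCoeff by ring]
  · rw [div_mul_eq_mul_div, div_mul_eq_mul_div, le_div_iff₀ hα]
    have : 0 ≤ (C₀ + C₁ + C₂) * (h.leadingCoeff * T) * η := by positivity
    linarith

/-- The limiting law is geometric: normalized moments `1` and `2`, variance `1`. -/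
theorem exists_tiltQuot_outer (hc : 0 < c)
    (hlow : ∀ k, k₀ ≤ k → c * risingRatio h.topExp k ≤ h.eval k) (hε1 : ε ≤ 1) {b₁ b₂ : ℝ}
    (hb₁ : 0 ≤ b₁) (hb₂ : 0 ≤ b₂) :
    ∃ C η₀ : ℝ, 0 ≤ C ∧ 0 < η₀ ∧ ∀ (n : ℕ) (x : ℝ), 2 * k₀ ≤ n → 1 ≤ n → 0 ≤ x → x < 1 →
      (1 - x) ^ ε + 1 / (n * (1 - x)) ≤ η₀ →
      |tiltQuot n (fun j => h.modWeight k₀ b₁ (n - j)) (fun j => h.modWeight k₀ b₂ (n - j)) x -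
        √1 / (1 - x)| ≤ C * (((1 - x) ^ ε + 1 / (n * (1 - x))) / (1 - x)) := by
  obtain ⟨C₀, hC₀, H0⟩ := exists_tiltMoment_reverse_approx hc hlow hb₁ 0
  obtain ⟨C₁, hC₁, H1⟩ := exists_tiltMoment_reverse_approx hc hlow hb₁ 1
  obtain ⟨C₂, hC₂, H2⟩ := exists_tiltMoment_reverse_approx hc hlow hb₁ 2
  obtain ⟨C₃, hC₃, H3⟩ := exists_tiltMoment_reverse_approx hc hlow hb₂ 0
  obtain ⟨C', η₀, hC', hη₀, H⟩ := exists_sqrt_div_approx (c₁ := 1)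
    (c₂ := 1 + 1) (lam := 1) (C := C₀ + C₁ + C₂ + C₃) one_pos (by ring) (by positivity)
  refine ⟨C', η₀, hC', hη₀, fun n x hn hn1 hx0 hx1 hη => ?_⟩
  have hτ : 0 < 1 - x := by linarith
  set η := (1 - x) ^ ε + 1 / (n * (1 - x)) with hηdef
  have hη0 : 0 ≤ η := add_nonneg (Real.rpow_pos_of_pos hτ _).le (by positivity)
  have hηle : (1 - x) + 1 / (n * (1 - x)) ≤ η := by
    rw [hηdef]; gcongr
    exact Real.self_le_rpow_of_le_one (by linarith) (by linarith) hε1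
  have hH : 0 < h.eval n := eval_pos hc hlow (by omega)
  have hTp : ∀ p : ℕ, (1 - x) ^ (-((1 : ℝ) + p)) = (1 - x)⁻¹ / (1 - x) ^ p := fun p => by
    rw [neg_add, Real.rpow_add hτ, Real.rpow_neg hτ.le (p : ℝ), Real.rpow_natCast,
      Real.rpow_neg_one, div_eq_mul_inv]
  have g0 := H0 n x hn hn1 hx0 hx1
  have g1 := H1 n x hn hn1 hx0 hx1
  have g2 := H2 n x hn hn1 hx0 hx1
  have g3 := H3 n x hn hn1 hx0 hx1
  rw [hTp] at g0 g1 g2 g3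
  set T := (1 - x)⁻¹ with hT
  have hT0 : 0 < T := inv_pos.2 hτ
  simp only [momentConst, Finset.prod_range_succ, Finset.prod_range_zero, pow_zero, pow_one,
    Nat.cast_zero, Nat.cast_one, add_zero, one_mul, mul_one, div_one] at g0 g1 g2 g3
  unfold tiltQuot
  rw [tiltSpread_half_eq]
  refine H (h.eval n * T) (1 - x) η _ _ _ _ (by positivity) hτ hη0 hη (g0.trans ?_) ?_ ?_
    (g3.trans ?_)
  · gcongr; linarith
  · rw [mul_one, mul_div_assoc]
    refine g1.trans ?_
    gcongr; linarith
  · rw [show h.eval n * T * (1 + 1) / (1 - x) ^ 2 = h.eval n * (1 + 1) * (T / (1 - x) ^ 2) by ring,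
      mul_div_assoc]
    refine g2.trans ?_
    gcongr; linarith
  · gcongr; linarith

end GenPoly

/-! ### Integration in the logarithmic variable -/

/-- Passage from the variable `1 - e ^ {-t}` to `t`. -/
theorem exists_exp_neg_approx {s ε C η₀ : ℝ} (hs : 0 ≤ s) (hε : 0 < ε) (hC : 0 ≤ C) (hη₀ : 0 < η₀) :
    ∃ C' δ A : ℝ, 0 ≤ C' ∧ 0 < δ ∧ δ ≤ 1 ∧ 0 < A ∧ ∀ (n : ℕ) (y t : ℝ), 1 ≤ n → A / n ≤ t → t ≤ δ →
      ((1 - Real.exp (-t)) ^ ε + 1 / (n * (1 - Real.exp (-t))) ≤ η₀ →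
        |y - s / (1 - Real.exp (-t))| ≤ C * (((1 - Real.exp (-t)) ^ ε +
          1 / (n * (1 - Real.exp (-t)))) / (1 - Real.exp (-t)))) →
      |y - s / t| ≤ C' * (1 + t ^ (ε - 1) + 1 / (n * t ^ 2)) := by
  -- The choices of `δ` and `A` give `t ^ ε ≤ η₀ / 2` and `2 / (n t) ≤ η₀ / 2`; the second bounds `1
  -- / (n τ)` because `1 / τ ≤ 2 / t` for `t ≤ 1`.
  refine ⟨4 * C + s, min 1 ((η₀ / 2) ^ (1 / ε)), 4 / η₀, by positivity,
    lt_min one_pos (Real.rpow_pos_of_pos (by positivity) _), min_le_left _ _, by positivity, ?_⟩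
  intro n y t hn hAt htδ H
  have hn' : (0 : ℝ) < n := by exact_mod_cast hn
  have ht : 0 < t := lt_of_lt_of_le (by positivity) hAt
  have ht1 : t ≤ 1 := htδ.trans (min_le_left _ _)
  set τ := 1 - Real.exp (-t) with hτ
  have hτt : τ ≤ t := by have := Real.add_one_le_exp (-t); rw [hτ]; linarith
  have hτt' : t / (1 + t) ≤ τ := by
    have h1 := Real.add_one_le_exp t
    have h2 : Real.exp (-t) ≤ 1 / (1 + t) := by
      rw [Real.exp_neg, ← one_div]
      exact one_div_le_one_div_of_le (by linarith) (by linarith)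
    have h3 : t / (1 + t) = 1 - 1 / (1 + t) := by field_simp; ring
    rw [h3]; linarith
  have hτ0 : 0 < τ := lt_of_lt_of_le (by positivity) hτt'
  have hinv : 1 / τ ≤ 1 / t + 1 := by
    have := one_div_le_one_div_of_le (by positivity) hτt'
    refine this.trans (le_of_eq ?_)
    field_simp
  have hinv2 : 1 / τ ≤ 2 / t := by
    refine hinv.trans ?_
    have : 1 ≤ 1 / t := by rw [le_div_iff₀ ht]; linarith
    have e : 2 / t = 1 / t + 1 / t := by ring
    linarith
  have hinv3 : 1 / t ≤ 1 / τ := one_div_le_one_div_of_le hτ0 hτt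
  have hτε : τ ^ ε ≤ t ^ ε := Real.rpow_le_rpow hτ0.le hτt hε.le
  have hnτ : 1 / (n * τ) ≤ 2 / (n * t) := by
    have e1 : 1 / (n * τ) = 1 / n * (1 / τ) := by field_simp
    have e2 : 2 / (n * t) = 1 / n * (2 / t) := by field_simp
    rw [e1, e2]; gcongr
  have hη : τ ^ ε + 1 / (n * τ) ≤ η₀ := by
    have h1 : t ^ ε ≤ η₀ / 2 := by
      have h2 : t ≤ (η₀ / 2) ^ (1 / ε) := htδ.trans (min_le_right _ _)
      have h3 := Real.rpow_le_rpow ht.le h2 hε.le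
      rwa [← Real.rpow_mul (by positivity), one_div_mul_cancel hε.ne', Real.rpow_one] at h3
    have h4 : 2 / (n * t) ≤ η₀ / 2 := by
      rw [div_le_iff₀ hn', div_le_iff₀ hη₀] at hAt
      rw [div_le_div_iff₀ (by positivity) (by positivity)]
      nlinarith
    linarith
  have h1 := H hη
  have h2 : C * ((τ ^ ε + 1 / (n * τ)) / τ) ≤ 4 * C * (t ^ (ε - 1) + 1 / (n * t ^ 2)) := by
    have e : (τ ^ ε + 1 / (n * τ)) / τ ≤ (t ^ ε + 2 / (n * t)) * (2 / t) := by
      rw [div_eq_mul_one_div]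
      have : 0 ≤ τ ^ ε := (Real.rpow_pos_of_pos hτ0 _).le
      gcongr
    have e2 : (t ^ ε + 2 / (n * t)) * (2 / t) = 2 * t ^ (ε - 1) + 4 * (1 / (n * t ^ 2)) := by
      rw [Real.rpow_sub_one ht.ne']; field_simp; ring
    rw [e2] at e
    have e3 : 0 ≤ t ^ (ε - 1) := (Real.rpow_pos_of_pos ht _).le
    calc _ ≤ C * (2 * t ^ (ε - 1) + 4 * (1 / (n * t ^ 2))) := by gcongr
      _ ≤ C * (4 * t ^ (ε - 1) + 4 * (1 / (n * t ^ 2))) := by gcongr; linarith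
      _ = _ := by ring
  have h3 : |s / τ - s / t| ≤ s := by
    have e : s / τ - s / t = s * (1 / τ - 1 / t) := by ring
    rw [e, abs_mul, abs_of_nonneg hs, abs_of_nonneg (by linarith)]
    nlinarith
  have h4 := abs_sub_le y (s / τ) (s / t)
  have e3 : 0 ≤ t ^ (ε - 1) := (Real.rpow_pos_of_pos ht _).le
  have e4 : 0 ≤ 1 / (n * t ^ 2) := by positivity
  have e5 : 0 ≤ s * (t ^ (ε - 1) + 1 / (n * t ^ 2)) := by positivity
  nlinarith

theorem intervalIntegral_inv_add_error {s ε C a δ N : ℝ} (hε : 0 < ε) (ha : 0 < a) (haδ : a ≤ δ) :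
    IntervalIntegrable (fun t => s / t + C * (1 + t ^ (ε - 1) + 1 / (N * t ^ 2))) volume a δ ∧
    ∫ t in a..δ, (s / t + C * (1 + t ^ (ε - 1) + 1 / (N * t ^ 2))) =
      s * (Real.log δ - Real.log a) +
        C * ((δ - a) + (δ ^ ε - a ^ ε) / ε + (1 / (N * a) - 1 / (N * δ))) := by
  have hpos : ∀ t ∈ Set.uIcc a δ, 0 < t := fun t ht => by
    rw [Set.uIcc_of_le haδ] at ht; exact lt_of_lt_of_le ha ht.1
  have hint : IntervalIntegrable (fun t => s / t + C * (1 + t ^ (ε - 1) + 1 / (N * t ^ 2)))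
      volume a δ := by
    apply ContinuousOn.intervalIntegrable
    have h1 : ContinuousOn (fun t : ℝ => s / t) (Set.uIcc a δ) :=
      continuousOn_const.div continuousOn_id fun t ht => (hpos t ht).ne'
    have h2 : ContinuousOn (fun t : ℝ => t ^ (ε - 1)) (Set.uIcc a δ) :=
      continuousOn_id.rpow_const fun t ht => Or.inl (hpos t ht).ne'
    have h3 : ContinuousOn (fun t : ℝ => 1 / (N * t ^ 2)) (Set.uIcc a δ) := by
      have : ∀ t : ℝ, 1 / (N * t ^ 2) = N⁻¹ / t ^ 2 := fun t => by
        rw [one_div, mul_inv, div_eq_mul_inv]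
      simp_rw [this]
      exact continuousOn_const.div (continuousOn_id.pow 2) fun t ht => (pow_pos (hpos t ht) 2).ne'
    exact h1.add (continuousOn_const.mul ((continuousOn_const.add h2).add h3))
  refine ⟨hint, ?_⟩
  have hderiv : ∀ t ∈ Set.uIcc a δ, HasDerivAt
      (fun t => s * Real.log t + C * (t + t ^ ε / ε - N⁻¹ * t⁻¹))
      (s / t + C * (1 + t ^ (ε - 1) + 1 / (N * t ^ 2))) t := by
    intro t ht
    have ht0 := hpos t ht
    have h1 := (Real.hasDerivAt_log ht0.ne').const_mul s
    have h2 := (Real.hasDerivAt_rpow_const (p := ε) (Or.inl ht0.ne')).div_const ε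
    have h3 := (hasDerivAt_inv ht0.ne').const_mul N⁻¹
    have h4 := h1.add ((((hasDerivAt_id t).add h2).sub h3).const_mul C)
    refine HasDerivAt.congr_deriv h4 ?_
    rw [one_div, mul_inv, mul_div_cancel_left₀ _ hε.ne']
    ring
  rw [intervalIntegral.integral_eq_sub_of_hasDerivAt hderiv hint]
  rw [one_div, one_div, mul_inv, mul_inv]
  ring

/-- On `(0, A / n)` the bound `f ≤ n` gives at most `A`, and beyond `δ` the integral is at most `R`.
In between, `s / t` integrates to `s log n + O(1)`, while `t ^ (ε - 1)` and `1 / (n t ^ 2)` have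
integrals bounded uniformly in `n`. -/
theorem exists_oneSided_bound {s ε C δ A r R : ℝ} (hs : 0 ≤ s) (hε : 0 < ε) (hC : 0 ≤ C)
    (hδ : 0 < δ) (hδ1 : δ ≤ 1) (hA : 0 < A) (hr : 0 < r) :
    ∃ K : ℝ, ∀ (n : ℕ) (f : ℝ → ℝ), 1 ≤ n → A / n ≤ δ → Continuous f → (∀ t, 0 ≤ f t) →
      IntegrableOn f (Set.Ioi 0) → (∀ t, f t ≤ n) →
      (∀ t, A / n ≤ t → t ≤ δ →
        r⁻¹ * (s / t - C * (1 + t ^ (ε - 1) + 1 / (n * t ^ 2))) ≤ f t ∧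
        f t ≤ r * (s / t + C * (1 + t ^ (ε - 1) + 1 / (n * t ^ 2)))) →
      ∫ t in Set.Ioi δ, f t ≤ R →
      r⁻¹ * (s * Real.log n - K) ≤ ∫ t in Set.Ioi 0, f t ∧
        ∫ t in Set.Ioi 0, f t ≤ r * (s * Real.log n + K) := by
  set K₁ := s * (|Real.log δ| + |Real.log A|) + C * (1 + 1 / ε + 1 / A) with hK₁
  refine ⟨K₁ + (A + |R|) / r, fun n f hn haδ hf hf0 hint hfn hmid hfar => ?_⟩
  have hn' : (0 : ℝ) < n := by exact_mod_cast hn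
  set a := A / n with ha
  have ha0 : 0 < a := by positivity
  have hI1 := intervalIntegral_inv_add_error (s := s) (C := C) (N := n) hε ha0 haδ
  have hI2 := intervalIntegral_inv_add_error (s := s) (C := -C) (N := n) hε ha0 haδ
  set E := (δ - a) + (δ ^ ε - a ^ ε) / ε + (1 / (n * a) - 1 / (n * δ)) with hE
  have hE1 : E ≤ 1 + 1 / ε + 1 / A := by
    have e1 : (δ ^ ε - a ^ ε) / ε ≤ 1 / ε := by
      gcongr
      have h1 : δ ^ ε ≤ 1 := Real.rpow_le_one hδ.le hδ1 hε.le
      have h2 := (Real.rpow_pos_of_pos ha0 ε).le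
      linarith
    have e2 : 1 / (n * a) = 1 / A := by rw [ha]; field_simp
    have e3 : 0 ≤ 1 / (n * δ) := by positivity
    linarith
  have hlog : Real.log δ - Real.log a = Real.log n + (Real.log δ - Real.log A) := by
    rw [ha, Real.log_div hA.ne' hn'.ne']; ring
  have hlogb : |s * (Real.log δ - Real.log A)| ≤ s * (|Real.log δ| + |Real.log A|) := by
    rw [abs_mul, abs_of_nonneg hs]
    gcongr
    exact abs_sub _ _
  have hlogb' := abs_le.1 hlogb
  have hCE : C * E ≤ C * (1 + 1 / ε + 1 / A) := by gcongr
  have hup : ∫ t in a..δ, f t ≤ r * (s * Real.log n + K₁) := by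
    have h1 : ∫ t in a..δ, f t ≤
        ∫ t in a..δ, r * (s / t + C * (1 + t ^ (ε - 1) + 1 / (n * t ^ 2))) :=
      intervalIntegral.integral_mono_on haδ (hf.intervalIntegrable _ _) (hI1.1.const_mul r)
        fun t ht => (hmid t ht.1 ht.2).2
    rw [intervalIntegral.integral_const_mul, hI1.2, hlog] at h1
    refine h1.trans (mul_le_mul_of_nonneg_left ?_ hr.le)
    rw [hK₁]; linarith
  have hdown : r⁻¹ * (s * Real.log n - K₁) ≤ ∫ t in a..δ, f t := by
    have h1 : ∫ t in a..δ, r⁻¹ * (s / t + -C * (1 + t ^ (ε - 1) + 1 / (n * t ^ 2))) ≤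
        ∫ t in a..δ, f t :=
      intervalIntegral.integral_mono_on haδ (hI2.1.const_mul r⁻¹) (hf.intervalIntegrable _ _)
        fun t ht => by
          have := (hmid t ht.1 ht.2).1
          rwa [neg_mul, ← sub_eq_add_neg]
    rw [intervalIntegral.integral_const_mul, hI2.2, hlog] at h1
    refine le_trans (mul_le_mul_of_nonneg_left ?_ (inv_nonneg.2 hr.le)) h1
    rw [hK₁]; linarith
  have hnear : ∫ t in (0 : ℝ)..a, f t ≤ A := by
    have h1 : ∫ t in (0 : ℝ)..a, f t ≤ ∫ t in (0 : ℝ)..a, (n : ℝ) :=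
      intervalIntegral.integral_mono_on ha0.le (hf.intervalIntegrable _ _)
        intervalIntegrable_const fun t _ => hfn t
    rw [intervalIntegral.integral_const, sub_zero, smul_eq_mul] at h1
    refine h1.trans (le_of_eq ?_)
    rw [ha]; field_simp
  have hnear0 : 0 ≤ ∫ t in (0 : ℝ)..a, f t :=
    intervalIntegral.integral_nonneg ha0.le fun t _ => hf0 t
  have hfar0 : 0 ≤ ∫ t in Set.Ioi δ, f t := setIntegral_nonneg measurableSet_Ioi fun t _ => hf0 t
  have hsplit : ∫ t in Set.Ioi 0, f t = (∫ t in (0 : ℝ)..a, f t) + (∫ t in a..δ, f t) +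
      ∫ t in Set.Ioi δ, f t := by
    rw [intervalIntegral.integral_add_adjacent_intervals (hf.intervalIntegrable _ _)
      (hf.intervalIntegrable _ _), intervalIntegral.integral_interval_add_Ioi hint
      (hint.mono_set (Set.Ioi_subset_Ioi hδ.le))]
  have hR := le_abs_self R
  have hKr : r * (s * Real.log n + (K₁ + (A + |R|) / r)) = r * (s * Real.log n + K₁) + (A + |R|) := by
    field_simp; ring
  have hKr' : r⁻¹ * (s * Real.log n - (K₁ + (A + |R|) / r)) ≤ r⁻¹ * (s * Real.log n - K₁) := by
    refine mul_le_mul_of_nonneg_left ?_ (inv_nonneg.2 hr.le)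
    have : 0 ≤ (A + |R|) / r := by positivity
    linarith
  rw [hsplit, hKr]
  constructor <;> linarith

/-! ### Comparison of weights and bounds for the standard deviation -/

section Comparison

variable {n : ℕ} {v w : ℕ → ℝ} {x : ℝ}

theorem tiltSpread_nonneg (hv : ∀ k ≤ n, 0 ≤ v k) (hx : 0 ≤ x) : 0 ≤ tiltSpread n v x :=
  Finset.sum_nonneg fun i hi => Finset.sum_nonneg fun j hj => by
    have := hv i (Nat.lt_succ_iff.1 (Finset.mem_range.1 hi))
    have := hv j (Nat.lt_succ_iff.1 (Finset.mem_range.1 hj))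
    positivity

/-- All terms of the double sum are nonnegative. The usual formula `M₀ M₂ - M₁ ^ 2` hides this
monotonicity. -/
theorem tiltSpread_mono (hv : ∀ k ≤ n, 0 ≤ v k) (hvw : ∀ k ≤ n, v k ≤ w k) (hx : 0 ≤ x) :
    tiltSpread n v x ≤ tiltSpread n w x :=
  Finset.sum_le_sum fun i hi => Finset.sum_le_sum fun j hj => by
    have hi' := Nat.lt_succ_iff.1 (Finset.mem_range.1 hi)
    have hj' := Nat.lt_succ_iff.1 (Finset.mem_range.1 hj)
    have h1 := hv i hi'
    have h2 := hv j hj'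
    have h3 := hvw i hi'
    have h4 := hvw j hj'
    have h5 : 0 ≤ w i := h1.trans h3
    gcongr

theorem tiltMoment_mono (p : ℕ) (hvw : ∀ k ≤ n, v k ≤ w k) (hx : 0 ≤ x) :
    tiltMoment n v p x ≤ tiltMoment n w p x :=
  Finset.sum_le_sum fun i hi => by
    have := hvw i (Nat.lt_succ_iff.1 (Finset.mem_range.1 hi))
    gcongr

theorem tiltSpread_const_mul (a : ℝ) :
    tiltSpread n (fun k => a * v k) x = a ^ 2 * tiltSpread n v x := by
  unfold tiltSpread
  simp_rw [Finset.mul_sum]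
  exact Finset.sum_congr rfl fun i _ => Finset.sum_congr rfl fun j _ => by ring

theorem tiltMoment_const_mul (p : ℕ) (a : ℝ) :
    tiltMoment n (fun k => a * v k) p x = a * tiltMoment n v p x := by
  unfold tiltMoment
  rw [Finset.mul_sum]
  exact Finset.sum_congr rfl fun i _ => by ring

theorem sqrt_tiltSpread_const_mul {a : ℝ} (ha : 0 ≤ a) :
    √(tiltSpread n (fun k => a * v k) x / 2) = a * √(tiltSpread n v x / 2) := by
  rw [tiltSpread_const_mul, mul_div_assoc, Real.sqrt_mul (sq_nonneg a), Real.sqrt_sq ha]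

/-- The square root of the spread is homogeneous of degree `1` in the weights, as is the
denominator; bounding one above and the other below costs `M / m` only. -/
theorem tiltStd_le_tiltQuot {m M : ℝ} {v₁ v₂ : ℕ → ℝ} (hm : 0 < m) (hM : 0 < M)
    (hv₁ : ∀ k ≤ n, 0 ≤ v₁ k) (h1 : ∀ k ≤ n, m * v₁ k ≤ w k) (h2 : ∀ k ≤ n, w k ≤ M * v₂ k)
    {j : ℕ} (hj : j ≤ n) (hvj : 0 < v₁ j) (hx : 0 < x) :
    tiltStd n w x ≤ M / m * tiltQuot n v₂ v₁ x := by
  have hw : ∀ k ≤ n, 0 ≤ w k := fun k hk => (mul_nonneg hm.le (hv₁ k hk)).trans (h1 k hk)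
  have hZ := tiltMoment_zero_pos hv₁ hj hvj hx
  have hS : √(tiltSpread n w x / 2) ≤ M * √(tiltSpread n v₂ x / 2) := by
    rw [← sqrt_tiltSpread_const_mul hM.le]
    apply Real.sqrt_le_sqrt
    gcongr
    exact tiltSpread_mono hw h2 hx.le
  have hZ' : m * tiltMoment n v₁ 0 x ≤ tiltMoment n w 0 x := by
    rw [← tiltMoment_const_mul]; exact tiltMoment_mono 0 h1 hx.le
  unfold tiltStd tiltQuot
  rw [div_mul_div_comm]
  gcongr

theorem tiltQuot_le_tiltStd {m M : ℝ} {v₁ v₂ : ℕ → ℝ} (hm : 0 < m)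
    (hv₁ : ∀ k ≤ n, 0 ≤ v₁ k) (h1 : ∀ k ≤ n, m * v₁ k ≤ w k) (h2 : ∀ k ≤ n, w k ≤ M * v₂ k)
    {j : ℕ} (hj : j ≤ n) (hvj : 0 < v₁ j) (hx : 0 < x) :
    (M / m)⁻¹ * tiltQuot n v₁ v₂ x ≤ tiltStd n w x := by
  have hw : ∀ k ≤ n, 0 ≤ w k := fun k hk => (mul_nonneg hm.le (hv₁ k hk)).trans (h1 k hk)
  have hZ := tiltMoment_zero_pos hw hj ((mul_pos hm hvj).trans_le (h1 j hj)) hx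
  have hS : m * √(tiltSpread n v₁ x / 2) ≤ √(tiltSpread n w x / 2) := by
    rw [← sqrt_tiltSpread_const_mul hm.le]
    apply Real.sqrt_le_sqrt
    gcongr
    exact tiltSpread_mono (fun k hk => mul_nonneg hm.le (hv₁ k hk)) h1 hx.le
  have hZ' : tiltMoment n w 0 x ≤ M * tiltMoment n v₂ 0 x := by
    rw [← tiltMoment_const_mul]; exact tiltMoment_mono 0 h2 hx.le
  unfold tiltStd tiltQuot
  rw [inv_div, div_mul_div_comm]
  gcongr

theorem tiltStd_le_natCast (hw : ∀ k ≤ n, 0 ≤ w k) (hx : 0 ≤ x) : tiltStd n w x ≤ n := by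
  have hZ := tiltMoment_nonneg hw 0 hx
  have hS : tiltSpread n w x / 2 ≤ (n * tiltMoment n w 0 x) ^ 2 := by
    have h1 : tiltSpread n w x ≤ ∑ i ∈ Finset.range (n + 1), ∑ j ∈ Finset.range (n + 1),
        (n : ℝ) ^ 2 * (w i * x ^ i) * (w j * x ^ j) := by
      refine Finset.sum_le_sum fun i hi => Finset.sum_le_sum fun j hj => ?_
      have hi' := Nat.lt_succ_iff.1 (Finset.mem_range.1 hi)
      have hj' := Nat.lt_succ_iff.1 (Finset.mem_range.1 hj)
      have h1 := hw i hi'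
      have h2 := hw j hj'
      have h3 : ((i : ℝ) - j) ^ 2 ≤ (n : ℝ) ^ 2 := by
        have a1 : (i : ℝ) ≤ n := by exact_mod_cast hi'
        have a2 : (j : ℝ) ≤ n := by exact_mod_cast hj'
        have a3 : (0 : ℝ) ≤ i := by positivity
        have a4 : (0 : ℝ) ≤ j := by positivity
        exact sq_le_sq' (by linarith) (by linarith)
      gcongr
    have h2 : ∑ i ∈ Finset.range (n + 1), ∑ j ∈ Finset.range (n + 1),
        (n : ℝ) ^ 2 * (w i * x ^ i) * (w j * x ^ j) = (n * tiltMoment n w 0 x) ^ 2 := by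
      unfold tiltMoment
      simp only [pow_zero, one_mul]
      rw [mul_pow, pow_two (∑ k ∈ Finset.range (n + 1), w k * x ^ k), Finset.sum_mul_sum,
        Finset.mul_sum]
      refine Finset.sum_congr rfl fun i _ => ?_
      rw [Finset.mul_sum]
      exact Finset.sum_congr rfl fun j _ => by ring
    rw [h2] at h1
    have h3 := tiltSpread_nonneg hw hx
    linarith
  unfold tiltStd
  refine div_le_of_le_mul₀ hZ (by positivity) ?_
  rw [← Real.sqrt_sq (show (0 : ℝ) ≤ n * tiltMoment n w 0 x by positivity)]
  exact Real.sqrt_le_sqrt hS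

theorem tiltStd_le_sqrt_moment (hw : ∀ k ≤ n, 0 ≤ w k) (hw0 : 0 < w 0) (hx : 0 < x) :
    tiltStd n w x ≤ √(tiltMoment n w 2 x / w 0) := by
  have hZ := tiltMoment_zero_pos hw (Nat.zero_le n) hw0 hx
  have hM2 := tiltMoment_nonneg hw 2 hx.le
  have hZ0 : w 0 ≤ tiltMoment n w 0 x := by
    have := Finset.single_le_sum (f := fun k : ℕ => (k : ℝ) ^ 0 * w k * x ^ k)
      (fun k hk => by
        have := hw k (Nat.lt_succ_iff.1 (Finset.mem_range.1 hk))
        positivity) (Finset.mem_range.2 (Nat.succ_pos n))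
    simpa [tiltMoment] using this
  unfold tiltStd
  rw [← Real.sqrt_sq hZ.le, ← Real.sqrt_div' _ (by positivity)]
  apply Real.sqrt_le_sqrt
  rw [tiltSpread_half_eq]
  calc (tiltMoment n w 0 x * tiltMoment n w 2 x - tiltMoment n w 1 x ^ 2) / tiltMoment n w 0 x ^ 2
      ≤ (tiltMoment n w 0 x * tiltMoment n w 2 x) / tiltMoment n w 0 x ^ 2 := by
        gcongr; linarith [sq_nonneg (tiltMoment n w 1 x)]
    _ = tiltMoment n w 2 x / tiltMoment n w 0 x := by field_simp
    _ ≤ _ := by gcongr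

/-- The variance is at most the second moment about `a`, the mean of the weights truncated at `k₀`.
Indices up to `k₀` give at most the truncated variance, since the total mass only grows; for the
others `0 ≤ k - a ≤ k`. Then the square root is subadditive. -/
theorem tiltStd_le_add_tail {k₀ : ℕ} (hw : ∀ k ≤ n, 0 ≤ w k) (hk₀ : k₀ ≤ n) (hwk : 0 < w k₀)
    (hx : 0 < x) :
    tiltStd n w x ≤ tiltStd k₀ w x +
      √((∑ k ∈ Finset.Ico (k₀ + 1) (n + 1), (k : ℝ) ^ 2 * w k * x ^ k) / (w k₀ * x ^ k₀)) := by
  have hw' : ∀ k ≤ k₀, 0 ≤ w k := fun k hk => hw k (hk.trans hk₀)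
  set T := ∑ k ∈ Finset.Ico (k₀ + 1) (n + 1), (k : ℝ) ^ 2 * w k * x ^ k with hT
  have hwI : ∀ k ∈ Finset.Ico (k₀ + 1) (n + 1), 0 ≤ w k * x ^ k := fun k hk => by
    have := hw k (Nat.lt_succ_iff.1 (Finset.mem_Ico.1 hk).2)
    positivity
  have hT0 : 0 ≤ T := Finset.sum_nonneg fun k hk => by
    rw [mul_assoc]; exact mul_nonneg (by positivity) (hwI k hk)
  have hZ := tiltMoment_zero_pos hw hk₀ hwk hx
  have hY := tiltMoment_zero_pos hw' le_rfl hwk hx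
  set Z := tiltMoment n w 0 x with hZdef
  set Y := tiltMoment k₀ w 0 x with hYdef
  have hYw : w k₀ * x ^ k₀ ≤ Y := by
    have := Finset.single_le_sum (f := fun k : ℕ => (k : ℝ) ^ 0 * w k * x ^ k)
      (fun k hk => by
        have := hw' k (Nat.lt_succ_iff.1 (Finset.mem_range.1 hk))
        positivity) (Finset.mem_range.2 (Nat.lt_succ_self k₀))
    simpa [hYdef, tiltMoment] using this
  have hsplit : ∀ f : ℕ → ℝ, ∑ k ∈ Finset.range (n + 1), f k =
      ∑ k ∈ Finset.range (k₀ + 1), f k + ∑ k ∈ Finset.Ico (k₀ + 1) (n + 1), f k := fun f =>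
    (Finset.sum_range_add_sum_Ico f (by omega)).symm
  have hYZ : Y ≤ Z := by
    rw [hZdef, hYdef, tiltMoment, tiltMoment, hsplit]
    have : 0 ≤ ∑ k ∈ Finset.Ico (k₀ + 1) (n + 1), (k : ℝ) ^ 0 * w k * x ^ k :=
      Finset.sum_nonneg fun k hk => by simpa using hwI k hk
    linarith
  set a := tiltMoment k₀ w 1 x / Y with ha
  have hmean : ∑ k ∈ Finset.range (k₀ + 1), ((k : ℝ) - a) * (w k * x ^ k) = 0 := by
    have h1 : ∑ k ∈ Finset.range (k₀ + 1), ((k : ℝ) - a) * (w k * x ^ k) =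
        tiltMoment k₀ w 1 x - a * Y := by
      rw [hYdef, tiltMoment, tiltMoment, Finset.mul_sum, ← Finset.sum_sub_distrib]
      exact Finset.sum_congr rfl fun k _ => by ring
    rw [h1, ha]; field_simp; ring
  have ha0 : 0 ≤ a := div_nonneg (tiltMoment_nonneg hw' 1 hx.le) hY.le
  have hak : a ≤ k₀ := by
    rw [ha, div_le_iff₀ hY, hYdef, tiltMoment, tiltMoment, Finset.mul_sum]
    refine Finset.sum_le_sum fun k hk => ?_
    have h1 := Nat.lt_succ_iff.1 (Finset.mem_range.1 hk)
    have h2 := hw' k h1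
    have h3 : (k : ℝ) ≤ k₀ := by exact_mod_cast h1
    have h4 : 0 ≤ w k * x ^ k := by positivity
    simp only [pow_one, pow_zero, one_mul, mul_assoc]
    exact mul_le_mul_of_nonneg_right h3 h4
  have hlow : tiltSpread k₀ w x / 2 =
      Y * ∑ k ∈ Finset.range (k₀ + 1), ((k : ℝ) - a) ^ 2 * (w k * x ^ k) := by
    rw [tiltSpread_eq k₀ w x a, hmean]; ring
  have hhigh : tiltSpread n w x / 2 ≤
      Z * (∑ k ∈ Finset.range (k₀ + 1), ((k : ℝ) - a) ^ 2 * (w k * x ^ k) + T) := by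
    have h1 : ∑ k ∈ Finset.range (n + 1), ((k : ℝ) - a) ^ 2 * (w k * x ^ k) ≤
        ∑ k ∈ Finset.range (k₀ + 1), ((k : ℝ) - a) ^ 2 * (w k * x ^ k) + T := by
      rw [hsplit]
      gcongr
      refine Finset.sum_le_sum fun k hk => ?_
      rw [mul_assoc]
      refine mul_le_mul_of_nonneg_right ?_ (hwI k hk)
      have h3 : (k₀ : ℝ) + 1 ≤ k := by exact_mod_cast (Finset.mem_Ico.1 hk).1
      have h4 : 0 ≤ (k : ℝ) - a := by linarith
      gcongr; linarith
    rw [tiltSpread_eq n w x a, mul_div_cancel_left₀ _ (two_ne_zero)]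
    have h2 := mul_le_mul_of_nonneg_left h1 hZ.le
    have h3 := sq_nonneg (∑ k ∈ Finset.range (n + 1), ((k : ℝ) - a) * (w k * x ^ k))
    linarith
  set Q := ∑ k ∈ Finset.range (k₀ + 1), ((k : ℝ) - a) ^ 2 * (w k * x ^ k) with hQ
  have hQ0 : 0 ≤ Q := Finset.sum_nonneg fun k hk => by
    have := hw' k (Nat.lt_succ_iff.1 (Finset.mem_range.1 hk))
    positivity
  have e1 : tiltStd n w x ≤ √(Q / Y + T / (w k₀ * x ^ k₀)) := by
    unfold tiltStd
    have hdiv : √(tiltSpread n w x / 2) / Z = √(tiltSpread n w x / 2 / Z ^ 2) := by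
      rw [Real.sqrt_div' (tiltSpread n w x / 2) (sq_nonneg Z), Real.sqrt_sq hZ.le]
    rw [← hZdef, hdiv]
    apply Real.sqrt_le_sqrt
    calc tiltSpread n w x / 2 / Z ^ 2 ≤ Z * (Q + T) / Z ^ 2 := by gcongr
      _ = Q / Z + T / Z := by field_simp
      _ ≤ Q / Y + T / (w k₀ * x ^ k₀) := by
        have := hYw.trans hYZ
        gcongr
  have e2 : tiltStd k₀ w x = √(Q / Y) := by
    unfold tiltStd
    have hdiv : √(tiltSpread k₀ w x / 2) / Y = √(tiltSpread k₀ w x / 2 / Y ^ 2) := by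
      rw [Real.sqrt_div' (tiltSpread k₀ w x / 2) (sq_nonneg Y), Real.sqrt_sq hY.le]
    rw [← hYdef, hdiv, hlow]
    congr 1; field_simp
  rw [e2]
  refine e1.trans (Real.sqrt_le_iff.2 ⟨by positivity, ?_⟩)
  rw [add_sq, Real.sq_sqrt (by positivity), Real.sq_sqrt (by positivity)]
  have : 0 ≤ 2 * √(Q / Y) * √(T / (w k₀ * x ^ k₀)) := by positivity
  linarith

end Comparison

/-! ### Decay away from the unit circle and the total integral -/

/-- The index `0` drops out of a moment of positive order, so a factor `x` can be taken out; this
yields the exponential decay. -/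
theorem exists_tiltMoment_risingRatio_le_mul {L ρ : ℝ} (hL : 0 < L) (hρ0 : 0 < ρ) (hρ1 : ρ < 1)
    (p : ℕ) : ∃ D : ℝ, 0 ≤ D ∧ ∀ (n : ℕ) (x : ℝ), 0 ≤ x → x ≤ ρ →
      tiltMoment n (risingRatio L) (p + 1) x ≤ D * x := by
  obtain ⟨C, hC, H⟩ := exists_tiltMoment_risingRatio_le (p + 1) hL
  have hρ' : 0 < 1 - ρ := by linarith
  refine ⟨C * (1 - ρ) ^ (-(L + (p + 1 : ℕ))) / ρ, by positivity, fun n x hx0 hxρ => ?_⟩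
  have h1 : tiltMoment n (risingRatio L) (p + 1) x ≤
      x / ρ * tiltMoment n (risingRatio L) (p + 1) ρ := by
    unfold tiltMoment
    rw [Finset.mul_sum]
    refine Finset.sum_le_sum fun k _ => ?_
    rcases k with _ | k
    · simp
    have h2 : x ^ (k + 1) ≤ x / ρ * ρ ^ (k + 1) := by
      rw [pow_succ', pow_succ', ← mul_assoc, div_mul_cancel₀ _ hρ0.ne']
      gcongr
    have h3 := risingRatio_pos hL (k + 1)
    calc _ ≤ ((k + 1 : ℕ) : ℝ) ^ (p + 1) * risingRatio L (k + 1) * (x / ρ * ρ ^ (k + 1)) := by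
          gcongr
      _ = _ := by ring
  refine h1.trans ?_
  calc _ ≤ x / ρ * (C * (1 - ρ) ^ (-(L + (p + 1 : ℕ)))) := by
        gcongr; exact H n ρ hρ0.le hρ1
    _ = _ := by ring

theorem sqrt_exp_neg (t : ℝ) : √(Real.exp (-t)) = Real.exp (-(1 / 2) * t) := by
  rw [Real.sqrt_eq_iff_mul_self_eq (Real.exp_pos _).le (Real.exp_pos _).le, ← Real.exp_add]
  congr 1; ring

namespace GenPoly

variable {h : GenPoly} {k₀ : ℕ} {b c r : ℝ}

/-- The weights `w 0, ..., w n` lie, up to a scaling and the factor `r`, between the values of `h`;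
for indices below `k₀` the lower bound is `0` and the upper one is `b`. -/
def IsComparable (h : GenPoly) (k₀ : ℕ) (b r : ℝ) (n : ℕ) (w : ℕ → ℝ) : Prop :=
  ∃ m M : ℝ, 0 < m ∧ 0 < M ∧ M / m = r ∧
    ∀ k ≤ n, m * h.modWeight k₀ 0 k ≤ w k ∧ w k ≤ M * h.modWeight k₀ b k

namespace IsComparable

variable {n : ℕ} {w : ℕ → ℝ}

theorem nonneg (hw : h.IsComparable k₀ b r n w) (hc : 0 < c)
    (hlow : ∀ k, k₀ ≤ k → c * risingRatio h.topExp k ≤ h.eval k) {k : ℕ} (hk : k ≤ n) : 0 ≤ w k := by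
  obtain ⟨m, M, hm, -, -, H⟩ := hw
  exact (mul_nonneg hm.le (modWeight_nonneg hc hlow le_rfl k)).trans (H k hk).1

theorem pos (hw : h.IsComparable k₀ b r n w) (hc : 0 < c)
    (hlow : ∀ k, k₀ ≤ k → c * risingRatio h.topExp k ≤ h.eval k) {k : ℕ} (hk₀ : k₀ ≤ k)
    (hk : k ≤ n) : 0 < w k := by
  obtain ⟨m, M, hm, -, -, H⟩ := hw
  refine lt_of_lt_of_le ?_ (H k hk).1
  unfold modWeight
  rw [if_neg (by omega)]
  exact mul_pos hm (eval_pos hc hlow hk₀)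

theorem tiltStd_le (hw : h.IsComparable k₀ b r n w) (hc : 0 < c)
    (hlow : ∀ k, k₀ ≤ k → c * risingRatio h.topExp k ≤ h.eval k) (hn : k₀ ≤ n) {x : ℝ}
    (hx : 0 < x) :
    tiltStd n w x ≤ r * tiltQuot n (h.modWeight k₀ b) (h.modWeight k₀ 0) x := by
  obtain ⟨m, M, hm, hM, rfl, H⟩ := hw
  refine tiltStd_le_tiltQuot hm hM (fun k _ => modWeight_nonneg hc hlow le_rfl k)
    (fun k hk => (H k hk).1) (fun k hk => (H k hk).2) hn ?_ hx
  unfold modWeight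
  rw [if_neg (by omega)]
  exact eval_pos hc hlow le_rfl

theorem le_tiltStd (hw : h.IsComparable k₀ b r n w) (hc : 0 < c)
    (hlow : ∀ k, k₀ ≤ k → c * risingRatio h.topExp k ≤ h.eval k) (hn : k₀ ≤ n) {x : ℝ}
    (hx : 0 < x) :
    r⁻¹ * tiltQuot n (h.modWeight k₀ 0) (h.modWeight k₀ b) x ≤ tiltStd n w x := by
  obtain ⟨m, M, hm, hM, rfl, H⟩ := hw
  refine tiltQuot_le_tiltStd hm (fun k _ => modWeight_nonneg hc hlow le_rfl k)
    (fun k hk => (H k hk).1) (fun k hk => (H k hk).2) hn ?_ hx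
  unfold modWeight
  rw [if_neg (by omega)]
  exact eval_pos hc hlow le_rfl

theorem continuous_tiltStd_exp (hw : h.IsComparable k₀ b r n w) (hc : 0 < c)
    (hlow : ∀ k, k₀ ≤ k → c * risingRatio h.topExp k ≤ h.eval k) (hn : k₀ ≤ n) :
    Continuous fun u => tiltStd n w (Real.exp u) :=
  _root_.continuous_tiltStd_exp (fun _ hk => hw.nonneg hc hlow hk) hn (hw.pos hc hlow le_rfl hn)

theorem integrable_tiltStd_exp (hw : h.IsComparable k₀ b r n w) (hc : 0 < c)
    (hlow : ∀ k, k₀ ≤ k → c * risingRatio h.topExp k ≤ h.eval k) (hn : k₀ ≤ n) :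
    Integrable fun u => tiltStd n w (Real.exp u) :=
  (integral_tiltStd_exp_le (fun _ hk => hw.nonneg hc hlow hk) hn (hw.pos hc hlow le_rfl hn)).1

end IsComparable

/-- Far outside the disc the top weight dominates: the variance about the index `n` is `O(exp
(-t))`. -/
theorem exists_tiltStd_exp_le (hc : 0 < c)
    (hlow : ∀ k, k₀ ≤ k → c * risingRatio h.topExp k ≤ h.eval k) (hb : 0 ≤ b) {δ : ℝ}
    (hδ : 0 < δ) :
    ∃ K : ℝ, ∀ (n : ℕ) (w : ℕ → ℝ) (t : ℝ), k₀ ≤ n → 1 ≤ n → h.IsComparable k₀ b r n w → δ ≤ t →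
      tiltStd n w (Real.exp t) ≤ K * Real.exp (-(1 / 2) * t) := by
  obtain ⟨C, hC, H⟩ := exists_modWeight_le_succ_mul hc hlow hb
  obtain ⟨D, hD, HD⟩ := exists_tiltMoment_risingRatio_le_mul one_pos (Real.exp_pos (-δ))
    (Real.exp_lt_one_iff.2 (by linarith)) 2
  refine ⟨√(r * (2 * C * D)), fun n w t hn hn1 hw ht => ?_⟩
  have hw0 : ∀ j ≤ n, 0 ≤ w (n - j) := fun j _ => hw.nonneg hc hlow (Nat.sub_le n j)
  have hwn : 0 < w (n - 0) := hw.pos hc hlow hn le_rfl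
  have hx := Real.exp_pos (-t)
  have h1 : tiltStd n w (Real.exp t) = tiltStd n (fun j => w (n - j)) (Real.exp (-t)) := by
    have := tiltQuot_inv n w w hx
    rwa [← Real.exp_neg, neg_neg] at this
  rw [h1, ← sqrt_exp_neg, ← Real.sqrt_mul' _ hx.le]
  refine (tiltStd_le_sqrt_moment hw0 hwn hx).trans (Real.sqrt_le_sqrt ?_)
  obtain ⟨m, M, hm, hM, rfl, Hw⟩ := hw
  have hhn := eval_pos hc hlow hn
  have h2 : m * h.eval n ≤ w (n - 0) := by
    have := (Hw n le_rfl).1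
    unfold modWeight at this
    rwa [if_neg (by omega)] at this
  have h3 : tiltMoment n (fun j => w (n - j)) 2 (Real.exp (-t)) ≤
      M * (2 * C * h.eval n) * tiltMoment n (risingRatio 1) 3 (Real.exp (-t)) := by
    unfold tiltMoment
    rw [Finset.mul_sum]
    refine Finset.sum_le_sum fun j hj => ?_
    have hj' := Nat.lt_succ_iff.1 (Finset.mem_range.1 hj)
    have h4 := (Hw (n - j) (Nat.sub_le n j)).2
    have h5 := mul_le_mul_of_nonneg_left (H n j hn hn1 hj') hM.le
    have h6 : (j : ℝ) ^ 2 * (j + 1) ≤ 2 * (j : ℝ) ^ 3 := by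
      have : (j : ℝ) ^ 2 ≤ (j : ℝ) ^ 3 := by
        rcases Nat.eq_zero_or_pos j with rfl | hj0
        · simp
        · exact pow_le_pow_right₀ (by exact_mod_cast hj0) (by norm_num)
      linarith
    rw [risingRatio_one]
    calc (j : ℝ) ^ 2 * w (n - j) * Real.exp (-t) ^ j
        ≤ (j : ℝ) ^ 2 * (M * (C * (j + 1) * h.eval n)) * Real.exp (-t) ^ j := by
          gcongr; exact h4.trans h5
      _ = M * C * h.eval n * ((j : ℝ) ^ 2 * (j + 1)) * Real.exp (-t) ^ j := by ring
      _ ≤ M * C * h.eval n * (2 * (j : ℝ) ^ 3) * Real.exp (-t) ^ j := by gcongr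
      _ = _ := by ring
  have h7 := HD n (Real.exp (-t)) hx.le (Real.exp_le_exp.2 (by linarith))
  calc _ ≤ (M * (2 * C * h.eval n) * (D * Real.exp (-t))) / (m * h.eval n) := by
        gcongr
        exact h3.trans (by gcongr)
    _ = _ := by field_simp

/-- Weights below `k₀` have no useful lower bound, so their part is kept as a standard deviation of
degree `k₀`. The tail starts at `k₀ + 1`, one power of `x` beyond the positive weight `w k₀`, which
gives the decay. -/
theorem exists_tiltStd_exp_neg_le (hc : 0 < c)
    (hlow : ∀ k, k₀ ≤ k → c * risingRatio h.topExp k ≤ h.eval k) (hb : 0 ≤ b) {δ : ℝ}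
    (hδ : 0 < δ) :
    ∃ K : ℝ, ∀ (n : ℕ) (w : ℕ → ℝ) (t : ℝ), k₀ ≤ n → h.IsComparable k₀ b r n w → δ ≤ t →
      tiltStd n w (Real.exp (-t)) ≤ tiltStd k₀ w (Real.exp (-t)) + K * Real.exp (-(1 / 2) * t) := by
  obtain ⟨C, hC, H⟩ := exists_modWeight_le_mul_risingRatio (h := h) (k₀ := k₀) hb
  have hL := h.topExp_pos
  set ρ := Real.exp (-δ) with hρ
  have hρ0 : 0 < ρ := Real.exp_pos _
  have hρ1 : ρ < 1 := Real.exp_lt_one_iff.2 (by linarith)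
  obtain ⟨D, hD, HD⟩ := exists_tiltMoment_risingRatio_le 2 hL
  have hρ' : 0 < 1 - ρ := by linarith
  set E := D * (1 - ρ) ^ (-(h.topExp + (2 : ℕ))) with hE
  have hE0 : 0 ≤ E := by positivity
  have hk := eval_pos hc hlow le_rfl
  refine ⟨√(r * (C * E / (ρ ^ (k₀ + 1) * h.eval k₀))), fun n w t hn hw ht => ?_⟩
  have hx := Real.exp_pos (-t)
  set x := Real.exp (-t) with hxt
  have hxρ : x ≤ ρ := Real.exp_le_exp.2 (by linarith)
  rw [← sqrt_exp_neg, ← Real.sqrt_mul' _ hx.le]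
  refine (tiltStd_le_add_tail (fun k hk => hw.nonneg hc hlow hk) hn (hw.pos hc hlow le_rfl hn)
    hx).trans (add_le_add le_rfl (Real.sqrt_le_sqrt ?_))
  obtain ⟨m, M, hm, hM, rfl, Hw⟩ := hw
  have h2 : m * h.eval k₀ ≤ w k₀ := by
    have := (Hw k₀ hn).1
    unfold modWeight at this
    rwa [if_neg (by omega)] at this
  have h3 : ∑ k ∈ Finset.Ico (k₀ + 1) (n + 1), (k : ℝ) ^ 2 * w k * x ^ k ≤
      M * C * (x / ρ) ^ (k₀ + 1) * tiltMoment n (risingRatio h.topExp) 2 ρ := by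
    unfold tiltMoment
    rw [Finset.mul_sum]
    have hsub : Finset.Ico (k₀ + 1) (n + 1) ⊆ Finset.range (n + 1) := by
      rw [Finset.range_eq_Ico]; exact Finset.Ico_subset_Ico_left (Nat.zero_le _)
    refine le_trans (Finset.sum_le_sum fun k hk => ?_) (Finset.sum_le_sum_of_subset_of_nonneg hsub
      fun k _ _ => ?_)
    · have hk' := Finset.mem_Ico.1 hk
      have h4 := (Hw k (Nat.lt_succ_iff.1 hk'.2)).2.trans (mul_le_mul_of_nonneg_left (H k) hM.le)
      have hr := risingRatio_pos hL k
      have h5 : x ^ k ≤ (x / ρ) ^ (k₀ + 1) * ρ ^ k := by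
        have h6 : (x / ρ) ^ k ≤ (x / ρ) ^ (k₀ + 1) :=
          pow_le_pow_of_le_one (by positivity) ((div_le_one hρ0).2 hxρ) hk'.1
        rw [div_pow, div_le_iff₀ (by positivity)] at h6
        exact h6
      calc (k : ℝ) ^ 2 * w k * x ^ k
          ≤ (k : ℝ) ^ 2 * (M * (C * risingRatio h.topExp k)) * ((x / ρ) ^ (k₀ + 1) * ρ ^ k) := by
            gcongr
        _ = _ := by ring
    · have hr := risingRatio_pos hL k
      positivity
  have h7 := HD n ρ hρ0.le hρ1
  calc _ ≤ (M * C * (x / ρ) ^ (k₀ + 1) * E) / (m * h.eval k₀ * x ^ k₀) := by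
        gcongr
        exact h3.trans (by gcongr)
    _ = _ := by rw [div_pow, pow_succ x]; field_simp

/-- The standard deviation lies between quotients with low weights `(0, b)` and `(b, 0)`; both have
the same asymptotics. -/
theorem exists_tiltStd_exp_neg_approx (hα : 0 < h.leadingCoeff) (hc : 0 < c)
    (hlow : ∀ k, k₀ ≤ k → c * risingRatio h.topExp k ≤ h.eval k) (hr : 0 < r) {ε : ℝ} (hε : 0 < ε)
    (hε1 : ε ≤ 1) (hεL : ε ≤ h.topExp)
    (hεj : ∀ j, j ≠ Fin.last h.d → ε ≤ h.topExp - h.L j) :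
    ∃ C δ A : ℝ, 0 ≤ C ∧ 0 < δ ∧ δ ≤ 1 ∧ 0 < A ∧ ∀ (n : ℕ) (w : ℕ → ℝ) (t : ℝ), k₀ ≤ n → 1 ≤ n →
      h.IsComparable k₀ b r n w → A / n ≤ t → t ≤ δ →
      r⁻¹ * (√h.topExp / t - C * (1 + t ^ (ε - 1) + 1 / (n * t ^ 2))) ≤
        tiltStd n w (Real.exp (-t)) ∧
      tiltStd n w (Real.exp (-t)) ≤
        r * (√h.topExp / t + C * (1 + t ^ (ε - 1) + 1 / (n * t ^ 2))) := by
  obtain ⟨C₁, η₁, hC₁, hη₁, H₁⟩ := exists_tiltQuot_inner hα hε1 hεL hεj k₀ b 0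
  obtain ⟨C₂, η₂, hC₂, hη₂, H₂⟩ := exists_tiltQuot_inner hα hε1 hεL hεj k₀ 0 b
  obtain ⟨D₁, δ₁, A₁, hD₁, hδ₁, hδ₁', hA₁, G₁⟩ :=
    exists_exp_neg_approx (Real.sqrt_nonneg h.topExp) hε hC₁ hη₁
  obtain ⟨D₂, δ₂, A₂, hD₂, hδ₂, hδ₂', hA₂, G₂⟩ :=
    exists_exp_neg_approx (Real.sqrt_nonneg h.topExp) hε hC₂ hη₂
  refine ⟨D₁ + D₂, min δ₁ δ₂, A₁ + A₂, by positivity, lt_min hδ₁ hδ₂, (min_le_left _ _).trans hδ₁',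
    by positivity, fun n w t hn hn1 hw hAt htδ => ?_⟩
  have hn' : (0 : ℝ) < n := by exact_mod_cast hn1
  rw [add_div] at hAt
  have hA₁' : 0 < A₁ / n := by positivity
  have hA₂' : 0 < A₂ / n := by positivity
  have ht : 0 < t := by linarith
  have hx1 : Real.exp (-t) < 1 := Real.exp_lt_one_iff.2 (by linarith)
  have g₁ := G₁ n _ t hn1 (by linarith) (htδ.trans (min_le_left _ _))
    (H₁ n (Real.exp (-t)) hn1 (Real.exp_pos _).le hx1)
  have g₂ := G₂ n _ t hn1 (by linarith) (htδ.trans (min_le_right _ _))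
    (H₂ n (Real.exp (-t)) hn1 (Real.exp_pos _).le hx1)
  have he : 0 ≤ 1 + t ^ (ε - 1) + 1 / (n * t ^ 2) := by positivity
  set e := 1 + t ^ (ε - 1) + 1 / (n * t ^ 2)
  have e1 := mul_nonneg hD₁ he
  have e2 := mul_nonneg hD₂ he
  rw [abs_le] at g₁ g₂
  constructor
  · refine le_trans ?_ (hw.le_tiltStd hc hlow hn (Real.exp_pos _))
    refine mul_le_mul_of_nonneg_left ?_ (inv_nonneg.2 hr.le)
    linarith [g₂.1]
  · refine (hw.tiltStd_le hc hlow hn (Real.exp_pos _)).trans ?_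
    refine mul_le_mul_of_nonneg_left ?_ hr.le
    linarith [g₁.2]

theorem exists_tiltStd_exp_approx (hc : 0 < c)
    (hlow : ∀ k, k₀ ≤ k → c * risingRatio h.topExp k ≤ h.eval k) (hb : 0 ≤ b) (hr : 0 < r) {ε : ℝ}
    (hε : 0 < ε) (hε1 : ε ≤ 1) :
    ∃ C δ A : ℝ, 0 ≤ C ∧ 0 < δ ∧ δ ≤ 1 ∧ 0 < A ∧ ∀ (n : ℕ) (w : ℕ → ℝ) (t : ℝ), 2 * k₀ ≤ n →
      1 ≤ n → h.IsComparable k₀ b r n w → A / n ≤ t → t ≤ δ →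
      r⁻¹ * (√1 / t - C * (1 + t ^ (ε - 1) + 1 / (n * t ^ 2))) ≤ tiltStd n w (Real.exp t) ∧
      tiltStd n w (Real.exp t) ≤ r * (√1 / t + C * (1 + t ^ (ε - 1) + 1 / (n * t ^ 2))) := by
  obtain ⟨C₁, η₁, hC₁, hη₁, H₁⟩ := exists_tiltQuot_outer hc hlow hε1 hb le_rfl
  obtain ⟨C₂, η₂, hC₂, hη₂, H₂⟩ := exists_tiltQuot_outer hc hlow hε1 le_rfl hb
  obtain ⟨D₁, δ₁, A₁, hD₁, hδ₁, hδ₁', hA₁, G₁⟩ :=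
    exists_exp_neg_approx (Real.sqrt_nonneg 1) hε hC₁ hη₁
  obtain ⟨D₂, δ₂, A₂, hD₂, hδ₂, hδ₂', hA₂, G₂⟩ :=
    exists_exp_neg_approx (Real.sqrt_nonneg 1) hε hC₂ hη₂
  refine ⟨D₁ + D₂, min δ₁ δ₂, A₁ + A₂, by positivity, lt_min hδ₁ hδ₂, (min_le_left _ _).trans hδ₁',
    by positivity, fun n w t hn hn1 hw hAt htδ => ?_⟩
  have hn' : (0 : ℝ) < n := by exact_mod_cast hn1
  rw [add_div] at hAt
  have hA₁' : 0 < A₁ / n := by positivity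
  have hA₂' : 0 < A₂ / n := by positivity
  have ht : 0 < t := by linarith
  have hx1 : Real.exp (-t) < 1 := Real.exp_lt_one_iff.2 (by linarith)
  have hinv : ∀ v₁ v₂ : ℕ → ℝ, tiltQuot n v₁ v₂ (Real.exp t) =
      tiltQuot n (fun j => v₁ (n - j)) (fun j => v₂ (n - j)) (Real.exp (-t)) := fun v₁ v₂ => by
    rw [← tiltQuot_inv n v₁ v₂ (Real.exp_pos (-t)), ← Real.exp_neg, neg_neg]
  have g₁ := G₁ n _ t hn1 (by linarith) (htδ.trans (min_le_left _ _))
    (H₁ n (Real.exp (-t)) hn hn1 (Real.exp_pos _).le hx1)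
  have g₂ := G₂ n _ t hn1 (by linarith) (htδ.trans (min_le_right _ _))
    (H₂ n (Real.exp (-t)) hn hn1 (Real.exp_pos _).le hx1)
  rw [← hinv] at g₁ g₂
  have he : 0 ≤ 1 + t ^ (ε - 1) + 1 / (n * t ^ 2) := by positivity
  set e := 1 + t ^ (ε - 1) + 1 / (n * t ^ 2)
  have e1 := mul_nonneg hD₁ he
  have e2 := mul_nonneg hD₂ he
  rw [abs_le] at g₁ g₂
  constructor
  · refine le_trans ?_ (hw.le_tiltStd hc hlow (by omega) (Real.exp_pos _))
    refine mul_le_mul_of_nonneg_left ?_ (inv_nonneg.2 hr.le)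
    linarith [g₂.1]
  · refine (hw.tiltStd_le hc hlow (by omega) (Real.exp_pos _)).trans ?_
    refine mul_le_mul_of_nonneg_left ?_ hr.le
    linarith [g₁.2]

theorem exists_div_natCast_le {A δ : ℝ} (hδ : 0 < δ) : ∃ n₁ : ℕ, ∀ n, n₁ ≤ n → 1 ≤ n → A / n ≤ δ := by
  obtain ⟨n₁, hn₁⟩ := exists_nat_ge (A / δ)
  refine ⟨n₁, fun n hn hn1 => ?_⟩
  have hn' : (0 : ℝ) < n := by exact_mod_cast hn1
  have : (n₁ : ℝ) ≤ n := by exact_mod_cast hn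
  rw [div_le_iff₀ hn', mul_comm, ← div_le_iff₀ hδ]
  linarith

/-- The zeros inside the unit disc. -/
theorem exists_integral_tiltStd_exp_neg_bound (hα : 0 < h.leadingCoeff) (hc : 0 < c)
    (hlow : ∀ k, k₀ ≤ k → c * risingRatio h.topExp k ≤ h.eval k) (hb : 0 ≤ b) (hr : 0 < r) :
    ∃ (K : ℝ) (n₁ : ℕ), ∀ (n : ℕ) (w : ℕ → ℝ), n₁ ≤ n → k₀ ≤ n → 1 ≤ n →
      h.IsComparable k₀ b r n w →
      r⁻¹ * (√h.topExp * Real.log n - K) ≤ ∫ t in Set.Ioi 0, tiltStd n w (Real.exp (-t)) ∧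
      ∫ t in Set.Ioi 0, tiltStd n w (Real.exp (-t)) ≤ r * (√h.topExp * Real.log n + K) := by
  obtain ⟨ε, hε, hε1, hεL, hεj⟩ := h.exists_gap
  obtain ⟨C, δ, A, hC, hδ, hδ1, hA, H⟩ :=
    exists_tiltStd_exp_neg_approx (b := b) hα hc hlow hr hε hε1 hεL hεj
  obtain ⟨K₁, HK⟩ := exists_tiltStd_exp_neg_le (r := r) hc hlow hb hδ
  -- The term `π k₀` bounds the integral of the truncated standard deviation, uniformly over its low
  -- weights.
  obtain ⟨K, HB⟩ := exists_oneSided_bound (R := Real.pi * k₀ + K₁ * ∫ t in Set.Ioi δ,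
    Real.exp (-(1 / 2) * t)) (Real.sqrt_nonneg h.topExp) hε hC hδ hδ1 hA hr
  obtain ⟨n₁, hn₁⟩ := exists_div_natCast_le (A := A) hδ
  refine ⟨K, n₁, fun n w hnn hn hn1 hw => ?_⟩
  have hw0 : ∀ k ≤ n, 0 ≤ w k := fun k hk => hw.nonneg hc hlow hk
  have hI : Integrable fun t => tiltStd n w (Real.exp (-t)) :=
    (hw.integrable_tiltStd_exp hc hlow hn).comp_neg
  refine HB n _ hn1 (hn₁ n hnn hn1) ((hw.continuous_tiltStd_exp hc hlow hn).comp continuous_neg)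
    (fun t => tiltStd_nonneg hw0 (Real.exp_pos _).le) hI.integrableOn
    (fun t => tiltStd_le_natCast hw0 (Real.exp_pos _).le) (fun t => H n w t hn hn1 hw) ?_
  have hw1 : ∀ k ≤ k₀, 0 ≤ w k := fun k hk => hw0 k (hk.trans hn)
  obtain ⟨hJ, hJb⟩ := integral_tiltStd_exp_le hw1 le_rfl (hw.pos hc hlow le_rfl hn)
  have hJ' : Integrable fun t => tiltStd k₀ w (Real.exp (-t)) := hJ.comp_neg
  have hexp : IntegrableOn (fun t => K₁ * Real.exp (-(1 / 2) * t)) (Set.Ioi δ) :=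
    (exp_neg_integrableOn_Ioi δ (by norm_num : (0 : ℝ) < 1 / 2)).const_mul K₁
  calc ∫ t in Set.Ioi δ, tiltStd n w (Real.exp (-t))
      ≤ ∫ t in Set.Ioi δ, (tiltStd k₀ w (Real.exp (-t)) + K₁ * Real.exp (-(1 / 2) * t)) :=
        setIntegral_mono_on hI.integrableOn (hJ'.integrableOn.add hexp) measurableSet_Ioi
          fun t ht => HK n w t hn hw (le_of_lt ht)
    _ = (∫ t in Set.Ioi δ, tiltStd k₀ w (Real.exp (-t))) +
          K₁ * ∫ t in Set.Ioi δ, Real.exp (-(1 / 2) * t) := by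
        rw [integral_add hJ'.integrableOn hexp, integral_const_mul]
    _ ≤ _ := by
        gcongr
        refine (setIntegral_le_integral hJ' (Filter.Eventually.of_forall fun t =>
          tiltStd_nonneg hw1 (Real.exp_pos _).le)).trans ?_
        rwa [integral_neg_eq_self (fun u => tiltStd k₀ w (Real.exp u))]

/-- The zeros outside the unit disc. -/
theorem exists_integral_tiltStd_exp_bound (hc : 0 < c)
    (hlow : ∀ k, k₀ ≤ k → c * risingRatio h.topExp k ≤ h.eval k) (hb : 0 ≤ b) (hr : 0 < r) :
    ∃ (K : ℝ) (n₁ : ℕ), ∀ (n : ℕ) (w : ℕ → ℝ), n₁ ≤ n → 2 * k₀ ≤ n → 1 ≤ n →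
      h.IsComparable k₀ b r n w →
      r⁻¹ * (√1 * Real.log n - K) ≤ ∫ t in Set.Ioi 0, tiltStd n w (Real.exp t) ∧
      ∫ t in Set.Ioi 0, tiltStd n w (Real.exp t) ≤ r * (√1 * Real.log n + K) := by
  -- Outside the disc the exponent gap plays no role, so `ε = 1`.
  obtain ⟨C, δ, A, hC, hδ, hδ1, hA, H⟩ :=
    exists_tiltStd_exp_approx hc hlow hb hr one_pos le_rfl
  obtain ⟨K₁, HK⟩ := exists_tiltStd_exp_le (r := r) hc hlow hb hδ
  obtain ⟨K, HB⟩ := exists_oneSided_bound (R := K₁ * ∫ t in Set.Ioi δ,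
    Real.exp (-(1 / 2) * t)) (Real.sqrt_nonneg 1) one_pos hC hδ hδ1 hA hr
  obtain ⟨n₁, hn₁⟩ := exists_div_natCast_le (A := A) hδ
  refine ⟨K, n₁, fun n w hnn hn hn1 hw => ?_⟩
  have hw0 : ∀ k ≤ n, 0 ≤ w k := fun k hk => hw.nonneg hc hlow hk
  have hI := hw.integrable_tiltStd_exp hc hlow (by omega)
  refine HB n _ hn1 (hn₁ n hnn hn1) (hw.continuous_tiltStd_exp hc hlow (by omega))
    (fun t => tiltStd_nonneg hw0 (Real.exp_pos _).le) hI.integrableOn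
    (fun t => tiltStd_le_natCast hw0 (Real.exp_pos _).le) (fun t => H n w t hn hn1 hw) ?_
  rw [← integral_const_mul]
  exact setIntegral_mono_on hI.integrableOn
    ((exp_neg_integrableOn_Ioi δ (by norm_num : (0 : ℝ) < 1 / 2)).const_mul K₁) measurableSet_Ioi
    fun t ht => HK n w t (by omega) hn1 hw (le_of_lt ht)

theorem exists_integral_tiltStd_bound (hα : 0 < h.leadingCoeff) (hc : 0 < c)
    (hlow : ∀ k, k₀ ≤ k → c * risingRatio h.topExp k ≤ h.eval k) (hb : 0 ≤ b) (hr : 0 < r) :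
    ∃ (K : ℝ) (n₁ : ℕ), k₀ ≤ n₁ ∧ 1 ≤ n₁ ∧ ∀ (n : ℕ) (w : ℕ → ℝ), n₁ ≤ n →
      h.IsComparable k₀ b r n w →
      r⁻¹ * ((1 + √h.topExp) * Real.log n - K) ≤ ∫ u, tiltStd n w (Real.exp u) ∧
      ∫ u, tiltStd n w (Real.exp u) ≤ r * ((1 + √h.topExp) * Real.log n + K) := by
  obtain ⟨K₁, n₁, H₁⟩ := exists_integral_tiltStd_exp_neg_bound hα hc hlow hb hr
  obtain ⟨K₂, n₂, H₂⟩ := exists_integral_tiltStd_exp_bound hc hlow hb hr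
  refine ⟨K₁ + K₂, n₁ + n₂ + 2 * k₀ + 1, by omega, by omega, fun n w hn hw => ?_⟩
  obtain ⟨a₁, b₁⟩ := H₁ n w (by omega) (by omega) (by omega) hw
  obtain ⟨a₂, b₂⟩ := H₂ n w (by omega) (by omega) (by omega) hw
  have hI := hw.integrable_tiltStd_exp hc hlow (by omega)
  have hsplit : ∫ u, tiltStd n w (Real.exp u) = (∫ t in Set.Ioi 0, tiltStd n w (Real.exp (-t))) +
      ∫ t in Set.Ioi 0, tiltStd n w (Real.exp t) := by
    rw [integral_comp_neg_Ioi (f := fun u => tiltStd n w (Real.exp u)), neg_zero]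
    exact (intervalIntegral.integral_Iic_add_Ioi hI.integrableOn hI.integrableOn).symm
  rw [hsplit]
  rw [Real.sqrt_one] at a₂ b₂
  constructor <;> linarith

end GenPoly

/-! ### Transfer to random variables and conclusion -/

section Expectation

variable {n : ℕ} {Ω : Type u} [MeasurableSpace Ω] {μ : Measure Ω}
  {ξ : Fin (n + 1) → Ω → ℝ}

theorem expectation_numRealZeros {c : Fin (n + 1) → ℝ} {j : Fin (n + 1)} (hj : c j ≠ 0)
    (hind : iIndepFun ξ μ) (hlaw : ∀ i, HasLaw (ξ i) (gaussianReal 0 1) μ) :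
    Integrable (fun ω => (numRealZeros (weightedPoly n c (fun i => ξ i ω)) : ℝ)) μ ∧
    ∫ ω, (numRealZeros (weightedPoly n c (fun i => ξ i ω)) : ℝ) ∂μ =
      (weightedPoly n c 1).natTrailingDegree +
        1 / Real.pi * ∫ u, tiltStd n (sqWeight c) (Real.exp u) := by
  obtain ⟨-, hint, heq⟩ := kacRice hj
  have hX := hind.hasLaw_pi hlaw
  refine ⟨?_, ?_⟩
  · rw [← hX.map_eq] at hint
    exact hint.comp_aemeasurable hX.aemeasurable
  · rw [← heq]
    exact hX.integral_comp hint.aestronglyMeasurable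

theorem integrable_numRealZeros [IsProbabilityMeasure μ] (c : Fin (n + 1) → ℝ) (hind : iIndepFun ξ μ)
    (hlaw : ∀ i, HasLaw (ξ i) (gaussianReal 0 1) μ) :
    Integrable (fun ω => (numRealZeros (weightedPoly n c (fun i => ξ i ω)) : ℝ)) μ := by
  by_cases hc : ∃ j, c j ≠ 0
  · obtain ⟨j, hj⟩ := hc
    exact (expectation_numRealZeros hj hind hlaw).1
  · push Not at hc
    have : ∀ ω, weightedPoly n c (fun i => ξ i ω) = 0 := fun ω => by simp [weightedPoly, hc]
    simp_rw [this]
    exact integrable_const _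

theorem expectation_numRealZeros_le [IsProbabilityMeasure μ] (c : Fin (n + 1) → ℝ) (hind : iIndepFun ξ μ)
    (hlaw : ∀ i, HasLaw (ξ i) (gaussianReal 0 1) μ) :
    ∫ ω, (numRealZeros (weightedPoly n c (fun i => ξ i ω)) : ℝ) ∂μ ≤ n := by
  have h1 := integral_mono (integrable_numRealZeros c hind hlaw) (integrable_const (n : ℝ))
    fun ω => Nat.cast_le.2 (numRealZeros_weightedPoly_le c _)
  simpa using h1

end Expectation

/-- The integral bounds carry the factor `r`, weakened here to `r ^ 2` using `r ≥ 1`. The lower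
bound is trivial when its bracket is not positive; otherwise `r⁻¹` may be lowered to `(r ^ 2)⁻¹`. -/
theorem bounds_of_integral_bounds {s l K r I k k₀ E : ℝ} (hs : 0 ≤ s) (hl : 0 ≤ l) (hr : 1 ≤ r)
    (hI0 : 0 ≤ I) (hI1 : r⁻¹ * (s * l - K) ≤ I) (hI2 : I ≤ r * (s * l + K)) (hk : 0 ≤ k)
    (hkk : k ≤ k₀) (hE : E = k + 1 / Real.pi * I) {K' : ℝ} (hK' : |K| / Real.pi + k₀ ≤ K') :
    (r ^ 2)⁻¹ * (s / Real.pi * l - K') ≤ E ∧ E ≤ r ^ 2 * (s / Real.pi * l + K') := by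
  have hpi := Real.pi_pos
  have hr0 : 0 < r := by linarith
  have hrr : r ≤ r ^ 2 := by nlinarith
  have hKa := abs_le.1 (le_refl |K|)
  have hE0 : 0 ≤ E := by rw [hE]; positivity
  have hG : 0 ≤ s / Real.pi * l := by positivity
  have hKpi : 0 ≤ |K| / Real.pi := by positivity
  constructor
  · rcases le_or_gt (s / Real.pi * l - K') 0 with h0 | h0
    · exact (mul_nonpos_of_nonneg_of_nonpos (by positivity) h0).trans hE0
    · calc (r ^ 2)⁻¹ * (s / Real.pi * l - K') ≤ r⁻¹ * (s / Real.pi * l - K') := by gcongr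
        _ ≤ r⁻¹ * ((s * l - K) / Real.pi) := by
          gcongr
          have : (s * l - |K|) / Real.pi ≤ (s * l - K) / Real.pi := by gcongr; exact hKa.2
          have h1 : (s * l - |K|) / Real.pi = s / Real.pi * l - |K| / Real.pi := by ring
          linarith
        _ = 1 / Real.pi * (r⁻¹ * (s * l - K)) := by ring
        _ ≤ 1 / Real.pi * I := by gcongr
        _ ≤ E := by rw [hE]; linarith
  · have h1 : (s * l + K) / Real.pi ≤ s / Real.pi * l + |K| / Real.pi := by
      have : (s * l + K) / Real.pi ≤ (s * l + |K|) / Real.pi := by gcongr; exact hKa.2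
      have h1 : (s * l + |K|) / Real.pi = s / Real.pi * l + |K| / Real.pi := by ring
      linarith
    calc E = k + 1 / Real.pi * I := hE
      _ ≤ k₀ + 1 / Real.pi * (r * (s * l + K)) := by gcongr
      _ = k₀ + r * ((s * l + K) / Real.pi) := by ring
      _ ≤ k₀ + r * (s / Real.pi * l + |K| / Real.pi) := by gcongr
      _ ≤ r ^ 2 * k₀ + r ^ 2 * (s / Real.pi * l + |K| / Real.pi) := by
        have h2 : 0 ≤ k₀ := hk.trans hkk
        have h3 : k₀ ≤ r ^ 2 * k₀ := le_mul_of_one_le_left h2 (by nlinarith)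
        gcongr
      _ = r ^ 2 * (s / Real.pi * l + (|K| / Real.pi + k₀)) := by ring
      _ ≤ _ := by gcongr

namespace GenPoly

theorem degree_add_one (h : GenPoly) : h.degree + 1 = h.topExp := by
  unfold degree topExp; ring

/-- Passing from `N₀` to a larger `k₀` makes room for indices where `h` may fail to be positive;
their upper bounds are absorbed by the sum of `|h|`. -/
theorem isComparable_sqWeight {h : GenPoly} {N₀ k₀ n : ℕ} (hN : N₀ ≤ k₀) {C₁ m M : ℝ}
    (hC₁ : 0 ≤ C₁) (hm : 0 < m) (hM : 0 < M) {c : Fin (n + 1) → ℝ}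
    (h1 : ∀ k : Fin (n + 1), N₀ ≤ (k : ℕ) → m * h.eval k ≤ c k ^ 2 ∧ c k ^ 2 ≤ M * h.eval k)
    (h2 : ∀ k : Fin (n + 1), (k : ℕ) < N₀ → c k ^ 2 ≤ C₁ * M) :
    h.IsComparable k₀ (C₁ + ∑ k ∈ Finset.range k₀, |h.eval k|) (M / m) n (sqWeight c) := by
  refine ⟨m, M, hm, hM, rfl, fun k hk => ?_⟩
  have hw : sqWeight c k = c ⟨k, Nat.lt_succ_of_le hk⟩ ^ 2 :=
    sqWeight_coe c ⟨k, Nat.lt_succ_of_le hk⟩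
  have h1' := h1 ⟨k, Nat.lt_succ_of_le hk⟩
  have h2' := h2 ⟨k, Nat.lt_succ_of_le hk⟩
  rw [← hw] at h1' h2'
  unfold modWeight
  split_ifs with hkk
  · refine ⟨by simpa using sqWeight_nonneg c k, ?_⟩
    have hsum : |h.eval k| ≤ ∑ k ∈ Finset.range k₀, |h.eval k| :=
      Finset.single_le_sum (f := fun k => |h.eval k|) (fun _ _ => abs_nonneg _)
        (Finset.mem_range.2 hkk)
    have habs := abs_nonneg (h.eval k)
    rcases lt_or_ge k N₀ with hkN | hkN
    · calc sqWeight c k ≤ C₁ * M := h2' hkN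
        _ ≤ M * (C₁ + ∑ k ∈ Finset.range k₀, |h.eval k|) := by
          rw [mul_comm]; gcongr; linarith
    · calc sqWeight c k ≤ M * h.eval k := (h1' hkN).2
        _ ≤ M * (C₁ + ∑ k ∈ Finset.range k₀, |h.eval k|) := by
          gcongr; linarith [le_abs_self (h.eval k)]
  · exact h1' (hN.trans (not_lt.1 hkk))

theorem exists_expectation_bounds {h : GenPoly} (hα : 0 < h.leadingCoeff) (N₀ : ℕ) {C₁ r : ℝ}
    (hC₁ : 0 < C₁) (hr : 0 < r) :
    ∃ K : ℝ, ∀ (n : ℕ), 1 ≤ n → ∀ (m M : ℝ), 0 < m → 0 < M → M / m = r →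
      ∀ c : Fin (n + 1) → ℝ,
        (∀ k : Fin (n + 1), N₀ ≤ (k : ℕ) → m * h.eval k ≤ c k ^ 2 ∧ c k ^ 2 ≤ M * h.eval k) →
        (∀ k : Fin (n + 1), (k : ℕ) < N₀ → c k ^ 2 ≤ C₁ * M) →
      ∀ (Ω : Type u) [MeasurableSpace Ω] (μ : Measure Ω) [IsProbabilityMeasure μ]
        (ξ : Fin (n + 1) → Ω → ℝ),
        iIndepFun ξ μ → (∀ i, HasLaw (ξ i) (gaussianReal 0 1) μ) →
        Integrable (fun ω => (numRealZeros (weightedPoly n c (fun i => ξ i ω)) : ℝ)) μ ∧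
        m ^ 2 / M ^ 2 * ((1 + √(h.degree + 1)) / Real.pi * Real.log n - K) ≤
          ∫ ω, (numRealZeros (weightedPoly n c (fun i => ξ i ω)) : ℝ) ∂μ ∧
        ∫ ω, (numRealZeros (weightedPoly n c (fun i => ξ i ω)) : ℝ) ∂μ ≤
          M ^ 2 / m ^ 2 * ((1 + √(h.degree + 1)) / Real.pi * Real.log n + K) := by
  obtain ⟨k₁, hk₁⟩ := h.exists_le_eval hα
  set k₀ := max N₀ k₁ with hk₀
  have hc : 0 < h.leadingCoeff / 2 := by positivity
  have hlow : ∀ k, k₀ ≤ k → h.leadingCoeff / 2 * risingRatio h.topExp k ≤ h.eval k :=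
    fun k hk => hk₁ k ((le_max_right _ _).trans hk)
  set b := C₁ + ∑ k ∈ Finset.range k₀, |h.eval k| with hb
  have hb0 : 0 ≤ b := by positivity
  obtain ⟨K, n₁, hn₁, hn₁', H⟩ := exists_integral_tiltStd_bound hα hc hlow hb0 hr
  rw [degree_add_one]
  set s := 1 + √h.topExp with hs
  have hs0 : 0 ≤ s := by positivity
  have hpi := Real.pi_pos
  have hlog₁ : 0 ≤ Real.log n₁ := Real.log_natCast_nonneg n₁
  -- The first two terms serve `n ≥ n₁`, `k₀` bounding the multiplicity of the root `0`. The last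
  -- two serve `n < n₁`: the expectation is at most `n₁`, and the lower bound becomes nonpositive.
  refine ⟨|K| / Real.pi + k₀ + (n₁ / r ^ 2 + s / Real.pi * Real.log n₁), ?_⟩
  intro n hn m M hm hM hMm c h1 h2 Ω _ μ _ ξ hind hlaw
  have hrM : M ^ 2 / m ^ 2 = r ^ 2 := by rw [← hMm, div_pow]
  have hrm : m ^ 2 / M ^ 2 = (r ^ 2)⁻¹ := by rw [← hrM, inv_div]
  rw [hrM, hrm]
  refine ⟨integrable_numRealZeros c hind hlaw, ?_⟩
  have hlog : 0 ≤ Real.log n := Real.log_natCast_nonneg n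
  have hE0 : 0 ≤ ∫ ω, (numRealZeros (weightedPoly n c (fun i => ξ i ω)) : ℝ) ∂μ :=
    integral_nonneg fun ω => Nat.cast_nonneg _
  rcases lt_or_ge n n₁ with hnn | hnn
  · have hEn := expectation_numRealZeros_le c hind hlaw
    have hn' : (n : ℝ) ≤ n₁ := by exact_mod_cast hnn.le
    have hK0 : 0 ≤ |K| / Real.pi + k₀ := by positivity
    have hKn : 0 ≤ (n₁ : ℝ) / r ^ 2 := by positivity
    have hG : s / Real.pi * Real.log n ≤ s / Real.pi * Real.log n₁ := by
      have : (0 : ℝ) < n := by exact_mod_cast hn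
      gcongr
    have hG0 : 0 ≤ s / Real.pi * Real.log n := by positivity
    constructor
    · refine le_trans (mul_nonpos_of_nonneg_of_nonpos (by positivity) ?_) hE0
      linarith
    · calc _ ≤ (n₁ : ℝ) := hEn.trans hn'
        _ = r ^ 2 * (n₁ / r ^ 2) := by field_simp
        _ ≤ _ := by gcongr; linarith
  · have hw : h.IsComparable k₀ b r n (sqWeight c) := by
      rw [← hMm]; exact isComparable_sqWeight (le_max_left _ _) hC₁.le hm hM h1 h2
    obtain ⟨i1, i2⟩ := H n (sqWeight c) hnn hw
    have hkn : k₀ < n + 1 := by omega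
    have hwk : 0 < sqWeight c k₀ := hw.pos hc hlow le_rfl (by omega)
    rw [show sqWeight c k₀ = c ⟨k₀, hkn⟩ ^ 2 from sqWeight_coe c ⟨k₀, hkn⟩] at hwk
    have hj : c ⟨k₀, hkn⟩ ≠ 0 := fun h0 => by rw [h0] at hwk; simp at hwk
    -- The hypotheses at the index `k₀`, where `h` is positive, force `m ≤ M`. For small `n` this
    -- index may be absent and `r < 1` is possible, which is why that case was treated without it.
    have hr1 : 1 ≤ r := by
      obtain ⟨a1, a2⟩ := h1 ⟨k₀, hkn⟩ (le_max_left _ _)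
      have := le_of_mul_le_mul_right (a1.trans a2) (eval_pos hc hlow le_rfl)
      rwa [← hMm, one_le_div hm]
    have hI0 : 0 ≤ ∫ u, tiltStd n (sqWeight c) (Real.exp u) :=
      integral_nonneg fun u => tiltStd_nonneg (fun k _ => sqWeight_nonneg c k) (Real.exp_pos u).le
    refine bounds_of_integral_bounds hs0 hlog hr1 hI0 i1 i2 (Nat.cast_nonneg _)
      (Nat.cast_le.2 (natTrailingDegree_weightedPoly_le hj))
      (expectation_numRealZeros hj hind hlaw).2 ?_
    have : 0 ≤ (n₁ : ℝ) / r ^ 2 + s / Real.pi * Real.log n₁ := by positivity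
    linarith

/-- The generalized polynomial `-h`. -/
def neg (h : GenPoly) : GenPoly where
  d := h.d
  L := h.L
  α := fun j => -h.α j
  L_pos := h.L_pos
  L_strictMono := h.L_strictMono
  α_last_ne_zero := neg_ne_zero.2 h.α_last_ne_zero

theorem eval_neg (h : GenPoly) (k : ℕ) : h.neg.eval k = -h.eval k := by
  simp [eval, neg]
  rfl

theorem exists_eval_neg {h : GenPoly} (hα : h.leadingCoeff < 0) :
    ∃ k₁, ∀ k, k₁ ≤ k → h.eval k < 0 := by
  have hα' : 0 < h.neg.leadingCoeff := neg_pos.2 hα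
  obtain ⟨k₁, hk₁⟩ := h.neg.exists_le_eval hα'
  refine ⟨k₁, fun k hk => ?_⟩
  have h1 := hk₁ k hk
  have h2 := mul_pos (half_pos hα') (risingRatio_pos h.neg.topExp_pos k)
  rw [eval_neg] at h1
  linarith

/-- A positive leading coefficient is the comparison case with `m = M = 1`. With a negative one `h`
is eventually negative, so `c_n ^ 2 = h(n)` confines `n` to a bounded range and the claim is
trivial. -/
theorem exists_abs_expectation_sub_le (h : GenPoly) :
    ∃ K : ℝ, ∀ (n : ℕ), 1 ≤ n →
      ∀ c : Fin (n + 1) → ℝ, (∀ k : Fin (n + 1), c k ^ 2 = h.eval k) →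
      ∀ (Ω : Type u) [MeasurableSpace Ω] (μ : Measure Ω) [IsProbabilityMeasure μ]
        (ξ : Fin (n + 1) → Ω → ℝ),
        iIndepFun ξ μ → (∀ i, HasLaw (ξ i) (gaussianReal 0 1) μ) →
        Integrable (fun ω => (numRealZeros (weightedPoly n c (fun i => ξ i ω)) : ℝ)) μ ∧
        |∫ ω, (numRealZeros (weightedPoly n c (fun i => ξ i ω)) : ℝ) ∂μ -
            (1 + √(h.degree + 1)) / Real.pi * Real.log n| ≤ K := by
  rcases lt_or_gt_of_ne h.α_last_ne_zero with hα | hα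
  · obtain ⟨k₁, hk₁⟩ := exists_eval_neg hα
    refine ⟨k₁ + (1 + √(h.degree + 1)) / Real.pi * Real.log k₁, ?_⟩
    intro n hn c hc Ω _ μ _ ξ hind hlaw
    refine ⟨integrable_numRealZeros c hind hlaw, ?_⟩
    have hnk : n < k₁ := by
      by_contra! hkn
      have h1 := hc (Fin.last n)
      have h2 := hk₁ n hkn
      rw [Fin.val_last] at h1
      linarith [sq_nonneg (c (Fin.last n))]
    have hpi := Real.pi_pos
    have hn0 : (0 : ℝ) < n := by exact_mod_cast hn
    have hnk' : (n : ℝ) ≤ k₁ := by exact_mod_cast hnk.le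
    have hE0 : 0 ≤ ∫ ω, (numRealZeros (weightedPoly n c (fun i => ξ i ω)) : ℝ) ∂μ :=
      integral_nonneg fun ω => Nat.cast_nonneg _
    have hEn := expectation_numRealZeros_le c hind hlaw
    have hlog : 0 ≤ Real.log n := Real.log_natCast_nonneg n
    have hG0 : 0 ≤ (1 + √(h.degree + 1)) / Real.pi * Real.log n := by positivity
    have hG : (1 + √(h.degree + 1)) / Real.pi * Real.log n ≤
        (1 + √(h.degree + 1)) / Real.pi * Real.log k₁ := by gcongr
    rw [abs_le]
    constructor <;> linarith
  · obtain ⟨K, H⟩ := exists_expectation_bounds.{u} hα 0 one_pos one_pos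
    refine ⟨K, fun n hn c hc Ω _ μ _ ξ hind hlaw => ?_⟩
    obtain ⟨h1, h2, h3⟩ := H n hn 1 1 one_pos one_pos (div_one 1) c
      (fun k _ => by rw [hc k, one_mul]; exact ⟨le_rfl, le_rfl⟩)
      (fun k hk => absurd hk (Nat.not_lt_zero _)) Ω μ ξ hind hlaw
    refine ⟨h1, abs_le.2 ⟨?_, ?_⟩⟩
    · norm_num at h2; linarith
    · norm_num at h3; linarith

end GenPoly

theorem theorem2p7 (h : GenPoly) :
    -- the two-sided bound; the constant `K` depends only on `h`, `N₀`, `C₁` and `r = M / m`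
    (0 < h.leadingCoeff →
      ∀ (N₀ : ℕ) (C₁ r : ℝ), 0 < C₁ → 0 < r →
        ∃ K : ℝ, ∀ (n : ℕ), 1 ≤ n →
          ∀ (m M : ℝ), 0 < m → 0 < M → M / m = r →
          ∀ c : Fin (n + 1) → ℝ,
            (∀ k : Fin (n + 1), N₀ ≤ (k : ℕ) →
              m * h.eval k ≤ c k ^ 2 ∧ c k ^ 2 ≤ M * h.eval k) →
            (∀ k : Fin (n + 1), (k : ℕ) < N₀ → c k ^ 2 ≤ C₁ * M) →
          ∀ (Ω : Type u) [MeasurableSpace Ω] (μ : Measure Ω) [IsProbabilityMeasure μ]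
            (ξ : Fin (n + 1) → Ω → ℝ),
            iIndepFun ξ μ → (∀ i, HasLaw (ξ i) (gaussianReal 0 1) μ) →
            Integrable (fun ω => (numRealZeros (weightedPoly n c (fun i => ξ i ω)) : ℝ)) μ ∧
            m ^ 2 / M ^ 2 * ((1 + √(h.degree + 1)) / Real.pi * Real.log n - K) ≤
              ∫ ω, (numRealZeros (weightedPoly n c (fun i => ξ i ω)) : ℝ) ∂μ ∧
            ∫ ω, (numRealZeros (weightedPoly n c (fun i => ξ i ω)) : ℝ) ∂μ ≤
              M ^ 2 / m ^ 2 * ((1 + √(h.degree + 1)) / Real.pi * Real.log n + K)) ∧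
    -- the case `c_k ^ 2 = h(k)`; the constant `K` depends only on `h`
    (∃ K : ℝ, ∀ (n : ℕ), 1 ≤ n →
      ∀ c : Fin (n + 1) → ℝ, (∀ k : Fin (n + 1), c k ^ 2 = h.eval k) →
      ∀ (Ω : Type u) [MeasurableSpace Ω] (μ : Measure Ω) [IsProbabilityMeasure μ]
        (ξ : Fin (n + 1) → Ω → ℝ),
        iIndepFun ξ μ → (∀ i, HasLaw (ξ i) (gaussianReal 0 1) μ) →
        Integrable (fun ω => (numRealZeros (weightedPoly n c (fun i => ξ i ω)) : ℝ)) μ ∧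
        |∫ ω, (numRealZeros (weightedPoly n c (fun i => ξ i ω)) : ℝ) ∂μ -
            (1 + √(h.degree + 1)) / Real.pi * Real.log n| ≤ K) := by
  exact ⟨fun hα N₀ C₁ r hC₁ hr => GenPoly.exists_expectation_bounds hα N₀ hC₁ hr,
    h.exists_abs_expectation_sub_le⟩
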